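/- Let $T$ be a finite group, $[T]$ its set of conjugacy classes ($C_\theta$ denotes the class labelled by $\theta\in[T]$), and let $\zeta$ be an irreducible complex representation of $T$ with character $\chi^\zeta$. Let $(\gamma^\theta_{k+1})_{k\ge 1,\,\theta\in[T]}$ be complex numbers and put $$R^\zeta_1=0,\qquad R^\zeta_{k+1}=\sum_{\theta\in[T]}\gamma^\theta_{k+1}\,\frac{|C_\theta|}{|T|}\,\overline{\chi^\zeta_\theta}\,(\dim\zeta)^k\quad(k\ge 1).$$ Let $m>0$ and $a_k(t)=e^{-kt/m}$ for $t\ge 0$, $k\ge1$, and define $$R^\zeta_1(t)=0,\qquad R^\zeta_2(t)=(1-a_1(t))\frac{(\dim\zeta)^2}{|T|}+a_1(t)R^\zeta_2,\qquad R^\zeta_{k+1}(t)=a_k(t)R^\zeta_{k+1}\quad(k\ge 2).$$ Suppose that $(R^\zeta_j)_{j\ge1}$ is the free cumulant sequence of a compactly supported probability $\mathfrak m^\zeta$ on $\mathbb R$. Let $\gamma^\zeta$ be the semicircle distribution with mean $0$ and variance $(\dim\zeta)^2/|T|$, let $\boxplus$ denote free additive convolution, and let $\mu_c$ denote the free compression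 of $\mu$ by a projection of rank $c\in(0,1]$ (the distribution of $pap$ in $(p\mathcal A p,\,c^{-1}\varphi)$, where $a=a^*$ has distribution $\mu$ in a $*$-probability space $(\mathcal A,\varphi)$ and $p$ is a projection with $\varphi(p)=c$ that is free from $a$); for $c=0$ let $\mu_0$ be the limit as $c\downarrow 0$, the point mass at the mean of $\mu$. Then the following hold. 1. For every $t\ge 0$, $$\mathfrak m^\zeta(t)=(\mathfrak m^\zeta)_{e^{-t/m}}\boxplus(\gamma^\zeta)_{1-e^{-t/m}}$$ is a compactly supported probability on $\mathbb R$, and its free cumulant sequence is $(R^\zeta_j(t))_{j\ge1}$. 2. Let $R^\zeta(t,w)=\sum_{k=0}^\infty R_{k+1}(\mathfrak m^\zeta(t))\,w^k$ and $R^\zeta(0,w)=\sum_{k=0}^\infty R_{k+1}(\mathfrak m^\zeta)\,w^k$ be the $R$-transforms of $\mathfrak m^\zeta(t)$ and $\mathfrak m^\zeta$, where $R_j(\mu)$ is the $j$-th free cumulant of $\mu$. There is $r>0$ such that for all $t\ge0$ and all $w\in\mathbb C$ with $|w|<r$ the series for $R^\zeta(t,w)$ and for $R^\zeta(0,e^{-t/m}w)$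 converge and $$R^\zeta(t,w)=(1-e^{-t/m})\frac{(\dim\zeta)^2}{|T|}\,w+R^\zeta(0,e^{-t/m}w).$$ 3. For $t\ge0$ and $z\in\mathbb C$ with $\operatorname{Im}z>0$, the Stieltjes transform $G^\zeta(t,z)=\int_{\mathbb R}\frac{1}{z-x}\,\mathfrak m^\zeta(t)(dx)$ does not vanish, is differentiable in $t$ (from the right at $t=0$) and in $z$, and satisfies $$\frac{\partial G^\zeta}{\partial t}=\Bigl(\frac{1}{mG^\zeta}-\frac{(\dim\zeta)^2}{|T|}\,\frac{G^\zeta}{m}\Bigr)\frac{\partial G^\zeta}{\partial z}+\frac{G^\zeta}{m}.$$ -/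

import Mathlib

open MeasureTheory

/-! ### Free cumulants -/

/-- A partition of `{0, …, n - 1}` is non-crossing if there are no `a < b < c < d` with `a, c` in
one block and `b, d` in another block. -/
def IsNoncrossing {n : ℕ} (π : Finpartition (Finset.univ : Finset (Fin n))) : Prop :=
  ∀ B ∈ π.parts, ∀ C ∈ π.parts, ∀ a ∈ B, ∀ b ∈ C, ∀ c ∈ B, ∀ d ∈ C,
    a < b → b < c → c < d → B = C

open Classical in
/-- The set `NC(n)` of non-crossing partitions of `{0, …, n - 1}`. -/
noncomputable def noncrossingPartitions (n : ℕ) :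
    Finset (Finpartition (Finset.univ : Finset (Fin n))) :=
  Finset.univ.filter IsNoncrossing

open Classical in
/-- The free cumulants of a moment sequence `M`, determined recursively by the free
moment-cumulant formula `M n = ∑_{π ∈ NC(n)} ∏_{B ∈ π} κ_{|B|}` (`n ≥ 1`): the one-block partition
contributes `κ n`, and all the blocks of the other partitions are smaller. -/
noncomputable def freeCumulantOfMoments (M : ℕ → ℝ) (n : ℕ) : ℝ :=
  M n - ∑ π ∈ (noncrossingPartitions n).filter (fun π => ∀ B ∈ π.parts, B.card < n),
    ∏ B ∈ π.parts, if _h : B.card < n then freeCumulantOfMoments M B.card else 0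
termination_by n

/-- The free moment-cumulant formula. -/
theorem moment_eq_sum_noncrossing (M : ℕ → ℝ) {n : ℕ} (hn : 1 ≤ n) :
    M n = ∑ π ∈ noncrossingPartitions n, ∏ B ∈ π.parts, freeCumulantOfMoments M B.card := by
  classical
  have : NeZero n := ⟨by omega⟩
  have hne : (Finset.univ : Finset (Fin n)) ≠ ⊥ := Finset.univ_nonempty.ne_empty
  rw [← Finset.sum_filter_add_sum_filter_not (noncrossingPartitions n)
    (fun π => ∀ B ∈ π.parts, B.card < n)]
  have h1 : (noncrossingPartitions n).filter (fun π => ¬ ∀ B ∈ π.parts, B.card < n)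
      = {Finpartition.indiscrete hne} := by
    ext π
    simp only [Finset.mem_filter, Finset.mem_singleton, noncrossingPartitions, Finset.mem_univ,
      true_and]
    constructor
    · rintro ⟨-, h⟩
      push Not at h
      obtain ⟨B, hB, hc⟩ := h
      have hBu : B = Finset.univ := by
        apply Finset.eq_univ_of_card
        have := Finset.card_le_univ B
        simp only [Fintype.card_fin] at this ⊢
        omega
      ext C
      simp only [Finpartition.indiscrete_parts, Finset.mem_singleton]
      constructor
      · intro hC
        by_contra hCB
        have hd : Disjoint C B := π.disjoint hC hB (fun h => hCB (h.trans hBu))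
        rw [hBu] at hd
        exact π.ne_bot hC (Finset.disjoint_self_iff_empty C |>.1 (hd.mono_right (Finset.subset_univ C)))
      · rintro rfl
        exact hBu ▸ hB
    · rintro rfl
      refine ⟨?_, fun h => ?_⟩
      · intro B hB C hC
        simp only [Finpartition.indiscrete_parts, Finset.mem_singleton] at hB hC
        intros
        rw [hB, hC]
      · have := h Finset.univ (by simp)
        simp at this
  rw [h1, Finset.sum_singleton]
  have h2 : ∏ B ∈ (Finpartition.indiscrete hne).parts, freeCumulantOfMoments M B.card
      = freeCumulantOfMoments M n := by simp
  rw [h2, freeCumulantOfMoments]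
  have h3 : ∀ π ∈ (noncrossingPartitions n).filter (fun π => ∀ B ∈ π.parts, B.card < n),
      ∏ B ∈ π.parts, (if _h : B.card < n then freeCumulantOfMoments M B.card else 0)
        = ∏ B ∈ π.parts, freeCumulantOfMoments M B.card := by
    intro π hπ
    refine Finset.prod_congr rfl fun B hB => ?_
    rw [dif_pos ((Finset.mem_filter.1 hπ).2 B hB)]
  rw [Finset.sum_congr rfl h3]
  ring

/-- The `j`-th free cumulant `R_j(μ)` of a measure on the line. -/
noncomputable def freeCumulant (μ : Measure ℝ) (j : ℕ) : ℝ :=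
  freeCumulantOfMoments (fun n => ∫ x, x ^ n ∂μ) j

/-- Voiculescu's `R`-transform `R_μ(w) = ∑_{k ≥ 0} R_{k+1}(μ) w ^ k`. -/
noncomputable def rTransform (μ : Measure ℝ) (w : ℂ) : ℂ :=
  ∑' k : ℕ, (freeCumulant μ (k + 1) : ℂ) * w ^ k

/-- The Stieltjes transform `G_μ(z) = ∫ 1 / (z - x) μ(dx)`. -/
noncomputable def stieltjesTransform (μ : Measure ℝ) (z : ℂ) : ℂ :=
  ∫ x : ℝ, (z - (x : ℂ))⁻¹ ∂μ

/-! ### Free independence, free convolution, free compression -/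

/-- A probability measure on the line with compact support. -/
def IsCompactProb (μ : Measure ℝ) : Prop :=
  IsProbabilityMeasure μ ∧ ∃ K : ℝ, μ (Set.Icc (-K) K)ᶜ = 0

/-- `μ` is the compactly supported probability measure with moments `M 0, M 1, …`
(there is at most one). -/
def HasMoments (μ : Measure ℝ) (M : ℕ → ℂ) : Prop :=
  IsCompactProb μ ∧ ∀ n : ℕ, ((∫ x, x ^ n ∂μ : ℝ) : ℂ) = M n

/-- `φ` is a state on the unital `*`-algebra `A`, that is, `(A, φ)` is a `*`-probability space. -/
def IsStarState {A : Type*} [Ring A] [StarRing A] [Algebra ℂ A] (φ : A →ₗ[ℂ] ℂ) : Prop :=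
  φ 1 = 1 ∧ ∀ a : A, 0 ≤ (φ (star a * a)).re ∧ (φ (star a * a)).im = 0

/-- Free independence of a family of unital subalgebras: `φ (a₁ ⋯ aₙ) = 0` whenever `n ≥ 1`, the
`aₖ` are centred, and consecutive `aₖ` come from different subalgebras. -/
def AreFree {A : Type*} [Ring A] [Algebra ℂ A] (φ : A →ₗ[ℂ] ℂ) {ι : Type*}
    (S : ι → Subalgebra ℂ A) : Prop :=
  ∀ l : List (ι × A), l ≠ [] → l.IsChain (fun x y => x.1 ≠ y.1) →
    (∀ x ∈ l, x.2 ∈ S x.1 ∧ φ x.2 = 0) → φ (l.map Prod.snd).prod = 0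

/-- Free independence of two elements, used below for self-adjoint ones (the unital algebra
generated by a self-adjoint element is a `*`-algebra). -/
def AreFreeElements {A : Type*} [Ring A] [Algebra ℂ A] (φ : A →ₗ[ℂ] ℂ) (a b : A) : Prop :=
  AreFree φ ![Algebra.adjoin ℂ {a}, Algebra.adjoin ℂ {b}]

/-- `σ` is the distribution of `a + b`, where `a` and `b` are free self-adjoint elements
of a `*`-probability space with distributions `μ` and `ν`. -/
def IsFreeConv (μ ν σ : Measure ℝ) : Prop :=
  ∃ (A : Type) (_ : Ring A) (_ : StarRing A) (_ : Algebra ℂ A) (_ : StarModule ℂ A)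
    (φ : A →ₗ[ℂ] ℂ) (a b : A),
    IsStarState φ ∧ IsSelfAdjoint a ∧ IsSelfAdjoint b ∧ AreFreeElements φ a b ∧
    HasMoments μ (fun n => φ (a ^ n)) ∧ HasMoments ν (fun n => φ (b ^ n)) ∧
    HasMoments σ (fun n => φ ((a + b) ^ n))

open Classical in
/-- The free additive convolution `μ ⊞ ν` (the zero measure if there is no such distribution). -/
noncomputable def freeConv (μ ν : Measure ℝ) : Measure ℝ :=
  if h : ∃ σ, IsFreeConv μ ν σ then h.choose else 0

/-- `ν` is the distribution of `p a p` in the compressed space `(p A p, φ(p)⁻¹ φ)` (whose unit is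
`p`), where `a` is self-adjoint with distribution `μ` and `p` is a projection of rank `φ(p) = c`
free from `a`. -/
def IsFreeCompression (c : ℝ) (μ ν : Measure ℝ) : Prop :=
  ∃ (A : Type) (_ : Ring A) (_ : StarRing A) (_ : Algebra ℂ A) (_ : StarModule ℂ A)
    (φ : A →ₗ[ℂ] ℂ) (a p : A),
    IsStarState φ ∧ IsSelfAdjoint a ∧ IsStarProjection p ∧ φ p = (c : ℂ) ∧
    AreFreeElements φ a p ∧
    HasMoments μ (fun n => φ (a ^ n)) ∧
    HasMoments ν (fun n => (c : ℂ)⁻¹ * φ (p * (p * a * p) ^ n))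

open Classical in
/-- The free compression `μ_c` of `μ` by a projection of rank `c ∈ (0, 1]`. For `c = 0` it is the
limit as `c → 0`, the point mass at the mean. (Zero measure if there is no such distribution.) -/
noncomputable def freeCompression (μ : Measure ℝ) (c : ℝ) : Measure ℝ :=
  if c = 0 then Measure.dirac (∫ x, x ∂μ)
  else if h : ∃ ν, IsFreeCompression c μ ν then h.choose else 0

/-- The semicircle distribution with mean `0` and variance `v > 0`, of density
`√(4v - x²) / (2πv)` on `[-2√v, 2√v]` (`Real.sqrt` vanishes at negative numbers). -/
noncomputable def semicircle (v : ℝ) : Measure ℝ :=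
  volume.withDensity fun x => ENNReal.ofReal (Real.sqrt (4 * v - x ^ 2) / (2 * Real.pi * v))

/-! ### The cumulants attached to an irreducible representation -/

/-- The value `χ^ζ_θ` of the character of `ζ` on the conjugacy class `θ`. -/
noncomputable def classCharacter {T V : Type*} [Group T] [AddCommGroup V] [Module ℂ V]
    (ζ : Representation ℂ T V) (θ : ConjClasses T) : ℂ :=
  Quotient.lift ζ.character (fun g h hgh => by
    obtain ⟨c, hc⟩ := isConj_iff.1 (show IsConj g h from hgh)
    rw [← hc, Representation.char_conj]) θ

open Classical in
/-- `R^ζ_1 = 0` and `R^ζ_{k+1} = ∑_θ γ_{k+1}^θ (|C_θ| / |T|) conj(χ^ζ_θ) (dim ζ)^k` for `k ≥ 1`;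
here `γ j θ` stands for `γ_j^θ`. -/
noncomputable def initialCumulant {T V : Type*} [Group T] [Fintype T] [AddCommGroup V] [Module ℂ V]
    (ζ : Representation ℂ T V) (γ : ℕ → ConjClasses T → ℂ) : ℕ → ℂ
  | 0 => 0
  | 1 => 0
  | (k + 2) => ∑ θ : ConjClasses T, γ (k + 2) θ * ((Nat.card θ.carrier : ℂ) / (Nat.card T : ℂ)) *
      starRingEnd ℂ (classCharacter ζ θ) * (Module.finrank ℂ V : ℂ) ^ (k + 1)

/-- The equilibrium variance `(dim ζ)² / |T|`. -/
noncomputable def plancherelWeight {T V : Type*} [Group T] [AddCommGroup V] [Module ℂ V]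
    (_ζ : Representation ℂ T V) : ℝ :=
  (Module.finrank ℂ V : ℝ) ^ 2 / (Nat.card T : ℝ)

/-- The cumulants evolved from `R` with decay factors `a k`, towards the variance `v`:
`R_1(t) = 0`, `R_2(t) = (1 - a_1) v + a_1 R_2` and `R_{k+1}(t) = a_k R_{k+1}` for `k ≥ 2`. -/
noncomputable def evolvedCumulant (a : ℕ → ℝ) (v : ℝ) (R : ℕ → ℂ) : ℕ → ℂ
  | 0 => 0
  | 1 => 0
  | 2 => (1 - (a 1 : ℂ)) * (v : ℂ) + (a 1 : ℂ) * R 2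
  | (k + 3) => (a (k + 2) : ℂ) * R (k + 3)

/-- `𝔪(t) = 𝔪_{e^{-t/m}} ⊞ γ_{1 - e^{-t/m}}`, where `γ` is the semicircle distribution of
variance `v`. -/
noncomputable def evolvedLaw (m v : ℝ) (μ : Measure ℝ) (t : ℝ) : Measure ℝ :=
  freeConv (freeCompression μ (Real.exp (-t / m)))
    (freeCompression (semicircle v) (1 - Real.exp (-t / m)))

/-!
Write `s = e^{-t/m}` and let `v` be the variance of the semicircle law. Free cumulants are additive
under free convolution, and a compression of rank `c` multiplies the `n`-th one by `c ^ (n - 1)`. So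
the evolved law `μ_s ⊞ γ_{1 - s}` has free cumulants `s ^ (n - 1) κ_n` for `n ≠ 2` and
`s κ_2 + (1 - s) v` for `n = 2`, which gives the evolved cumulants and the formula for the
`R`-transform. The differential equation is the infinitesimal form of the resulting functional
equation for the Stieltjes transform.

*Cumulants of free elements.* The non-crossing moment-cumulant formula yields a recursion
(`ncMoment_succ`), which says that the series `C` of the cumulants and `M` of the moments satisfy
`C(w M(w)) = M(w)` (`cumulantSeries_subst`). Equivalently, `C` is the unique series with constant
term `1` for which the inverse of the pencil `C(w) - w a` has expectation `1`
(`seriesMap_pencil_inverse`, `pencil_unique`). Hence `C(w) - w a = (1 + E)⁻¹` with `E` centred, and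
for free elements the inverse of the pencil of a sum or of a compression expands into alternating
products of centred elements, whose expectations vanish (`cumulantSeries_add_of_free`,
`cumulantSeries_compression_of_free`).

*Existence.* Free copies of bounded random variables live on the free product Hilbert space, whose
basis is the set of reduced words in a free product of monoids (`exists_free_representation`), and
spectral measures provide the laws of sums and compressions (`exists_isFreeConv`,
`exists_isFreeCompression`).

*Analytic cumulants.* The function `u ↦ u M(u) = G(1 / u)` is analytic and locally invertible at
`0`, so that `C` is the Taylor series of an analytic function (`exists_cumulantFunction`). This
bounds the cumulants geometrically and inverts the Stieltjes transform `G` near infinity.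

*The differential equation.* In terms of Stieltjes transforms, the relation between the cumulants
reads `s g = G_μ(z + (1 / s - 1) / g - (1 - s) v g)` with `g` the transform of `μ_s ⊞ γ_{1 - s}` at
`z`, first near infinity and then on the upper half-plane by the identity theorem
(`stieltjesTransform_subordination`). Differentiating in `z` shows that the derivative of this
equation in `g` cannot vanish (`subordinationJacobian_ne_zero`). As `g` is continuous in `s`, by
the uniform cumulant bounds and Weierstrass approximation, implicit differentiation gives the
derivative in `s`, also at the end point `s = 1`, and the equation follows by elimination.
-/

/-! ### Sums over non-crossing partitions -/


/-- `π` is the set of blocks of a non-crossing partition of the finite subset `s` of a linear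
order. Compared with `Finpartition`, partitions of varying sets share one type, which the
recursion on the ground set needs. -/
structure IsNCPart {α : Type*} [LinearOrder α] (s : Finset α) (π : Finset (Finset α)) : Prop where
  sub : ∀ B ∈ π, ∀ x ∈ B, x ∈ s
  cov : ∀ x ∈ s, ∃ B ∈ π, x ∈ B
  uniq : ∀ B ∈ π, ∀ C ∈ π, ∀ x, x ∈ B → x ∈ C → B = C
  ne : ∀ B ∈ π, ∃ x, x ∈ B
  nc : ∀ B ∈ π, ∀ C ∈ π, ∀ a ∈ B, ∀ b ∈ C, ∀ c ∈ B, ∀ d ∈ C, a < b → b < c → c < d → B = C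

open Classical in
/-- The non-crossing partitions of a finite subset of a linear order. -/
noncomputable def ncParts {α : Type*} [LinearOrder α] (s : Finset α) :
    Finset (Finset (Finset α)) :=
  s.powerset.powerset.filter (IsNCPart s)

theorem mem_ncParts {α : Type*} [LinearOrder α] {s : Finset α} {π : Finset (Finset α)} :
    π ∈ ncParts s ↔ IsNCPart s π := by
  classical
  simp only [ncParts, Finset.mem_filter, Finset.mem_powerset, and_iff_right_iff_imp]
  intro h B hB
  simpa [Finset.subset_iff] using h.sub B hB

/-- The sum over the non-crossing partitions of `s` of the products of the weights `κ |B|`, where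
the block of `m` is counted with `j` additional elements. -/
noncomputable def ncSum {α : Type*} [LinearOrder α] {R : Type*} [CommRing R] (κ : ℕ → R)
    (j : ℕ) (m : α) (s : Finset α) : R :=
  ∑ π ∈ ncParts s, ∏ B ∈ π, κ (B.card + if m ∈ B then j else 0)

/-- Sums over non-crossing partitions are invariant under relabelling. -/
theorem ncSum_map {α β : Type*} [LinearOrder α] [LinearOrder β] {R : Type*} [CommRing R]
    (κ : ℕ → R) (j : ℕ) (f : β ↪o α) (m : β) (s : Finset β) :
    ncSum κ j (f m) (s.map f.toEmbedding) = ncSum κ j m s := by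
  classical
  symm
  unfold ncSum
  refine Finset.sum_bij (fun π _ => π.map (Finset.mapEmbedding f.toEmbedding).toEmbedding)
    ?_ ?_ ?_ ?_
  · intro π hπ
    rw [mem_ncParts] at hπ ⊢
    obtain ⟨h1, h2, h3, h4, h5⟩ := hπ
    constructor
    · simpa using h1
    · simpa using h2
    · intro B hB C hC x hxB hxC
      simp only [Finset.mem_map, RelEmbedding.coe_toEmbedding, Finset.mapEmbedding_apply] at hB hC
      obtain ⟨B, hB, rfl⟩ := hB
      obtain ⟨C, hC, rfl⟩ := hC
      simp only [Finset.mem_map, RelEmbedding.coe_toEmbedding] at hxB hxC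
      obtain ⟨y, hy, rfl⟩ := hxB
      obtain ⟨z, hz, hzy⟩ := hxC
      rw [h3 B hB C hC y hy (f.injective hzy ▸ hz)]
    · intro B hB
      simp only [Finset.mem_map, RelEmbedding.coe_toEmbedding, Finset.mapEmbedding_apply] at hB
      obtain ⟨B, hB, rfl⟩ := hB
      obtain ⟨x, hx⟩ := h4 B hB
      exact ⟨f x, by simpa using hx⟩
    · intro B hB C hC
      simp only [Finset.mem_map, RelEmbedding.coe_toEmbedding, Finset.mapEmbedding_apply] at hB hC
      obtain ⟨B, hB, rfl⟩ := hB
      obtain ⟨C, hC, rfl⟩ := hC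
      intro a ha b hb c hc d hd
      simp only [Finset.mem_map, RelEmbedding.coe_toEmbedding] at ha hb hc hd
      obtain ⟨a, ha, rfl⟩ := ha
      obtain ⟨b, hb, rfl⟩ := hb
      obtain ⟨c, hc, rfl⟩ := hc
      obtain ⟨d, hd, rfl⟩ := hd
      simp only [OrderEmbedding.lt_iff_lt]
      intro hab hbc hcd
      rw [h5 B hB C hC a ha b hb c hc d hd hab hbc hcd]
  · intro π _ π' _ h
    exact Finset.map_injective _ h
  · intro π hπ
    rw [mem_ncParts] at hπ
    obtain ⟨h1, h2, h3, h4, h5⟩ := hπ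
    have key : ∀ B ∈ π, (B.preimage f f.injective.injOn).map f.toEmbedding = B := by
      intro B hB
      ext x
      simp only [Finset.mem_map, Finset.mem_preimage, RelEmbedding.coe_toEmbedding]
      constructor
      · rintro ⟨y, hy, rfl⟩; exact hy
      · intro hx
        have := h1 B hB x hx
        simp only [Finset.mem_map, RelEmbedding.coe_toEmbedding] at this
        obtain ⟨y, _, rfl⟩ := this
        exact ⟨y, hx, rfl⟩
    refine ⟨π.image (fun B => B.preimage f f.injective.injOn), ?_, ?_⟩
    · rw [mem_ncParts]
      constructor
      · intro B hB x hx
        simp only [Finset.mem_image] at hB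
        obtain ⟨B, hB, rfl⟩ := hB
        have := h1 B hB (f x) (by simpa using hx)
        simpa using this
      · intro x hx
        obtain ⟨B, hB, hxB⟩ := h2 (f x) (by simpa using hx)
        exact ⟨_, Finset.mem_image_of_mem _ hB, by simpa using hxB⟩
      · intro B hB C hC x hxB hxC
        simp only [Finset.mem_image] at hB hC
        obtain ⟨B, hB, rfl⟩ := hB
        obtain ⟨C, hC, rfl⟩ := hC
        congr 1
        exact h3 B hB C hC (f x) (by simpa using hxB) (by simpa using hxC)
      · intro B hB
        simp only [Finset.mem_image] at hB
        obtain ⟨B, hB, rfl⟩ := hB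
        obtain ⟨x, hx⟩ := h4 B hB
        rw [← key B hB] at hx
        simp only [Finset.mem_map] at hx
        obtain ⟨y, hy, -⟩ := hx
        exact ⟨y, hy⟩
      · intro B hB C hC a ha b hb c hc d hd hab hbc hcd
        simp only [Finset.mem_image] at hB hC
        obtain ⟨B, hB, rfl⟩ := hB
        obtain ⟨C, hC, rfl⟩ := hC
        simp only [Finset.mem_preimage] at ha hb hc hd
        congr 1
        exact h5 B hB C hC _ ha _ hb _ hc _ hd (by simpa) (by simpa) (by simpa)
    · ext B
      simp only [Finset.mem_image, Finset.mem_map, RelEmbedding.coe_toEmbedding,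
        Finset.mapEmbedding_apply]
      constructor
      · rintro ⟨_, ⟨C, hC, rfl⟩, rfl⟩
        exact (key C hC).symm ▸ hC
      · intro hB
        exact ⟨_, ⟨B, hB, rfl⟩, key B hB⟩
  · intro π _
    rw [Finset.prod_map]
    refine Finset.prod_congr rfl fun B _ => ?_
    simp

/-- If `d` is the second element, after `m`, of the block of `m`, then the partition splits into
a partition of the elements between `m` and `d` and a partition of the elements from `d` on. -/
theorem ncSum_filter_next {α : Type*} [LinearOrder α] {R : Type*} [CommRing R] (κ : ℕ → R)
    (j : ℕ) {m : α} {s : Finset α} (hm : ∀ x ∈ s, m < x) {d : α} (hd : d ∈ s)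
    [DecidablePred fun π : Finset (Finset α) => ∃ B ∈ π, m ∈ B ∧ d ∈ B ∧ ∀ x ∈ B, x = m ∨ d ≤ x] :
    ∑ π ∈ (ncParts (insert m s)).filter
        (fun π => ∃ B ∈ π, m ∈ B ∧ d ∈ B ∧ ∀ x ∈ B, x = m ∨ d ≤ x),
      ∏ B ∈ π, κ (B.card + if m ∈ B then j else 0)
    = ncSum κ 0 m (s.filter (· < d)) * ncSum κ (j + 1) d (s.filter (d ≤ ·)) := by
  classical
  have hmd := hm d hd
  have hms : m ∉ s := fun h => lt_irrefl _ (hm m h)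
  symm
  unfold ncSum
  rw [Finset.sum_mul_sum, ← Finset.sum_product']
  -- `g` puts `m` back into the block of `d`; the pair of partitions `(π₁, π₂)` corresponds to the
  -- partition `π₁ ∪ g(π₂)`.
  set g : Finset α → Finset α := fun B => if d ∈ B then insert m B else B with hg
  have hgd : ∀ B, d ∈ g B ↔ d ∈ B := by
    intro B; simp only [hg]; split_ifs with h <;> simp [h]
  have hgx : ∀ B x, x ∈ g B ↔ x ∈ B ∨ (x = m ∧ d ∈ B) := by
    intro B x; simp only [hg]; split_ifs with h <;> simp [h]; tauto
  refine Finset.sum_bij (fun p _ => p.1 ∪ p.2.image g) ?_ ?_ ?_ ?_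
  · rintro ⟨π₁, π₂⟩ h
    simp only [Finset.mem_product, mem_ncParts] at h
    obtain ⟨⟨a1, a2, a3, a4, a5⟩, ⟨b1, b2, b3, b4, b5⟩⟩ := h
    simp only [Finset.mem_filter] at a1 a2 b1 b2
    have hmB : ∀ B ∈ π₂, m ∉ B := fun B hB h => hms (b1 B hB m h).1
    rw [Finset.mem_filter, mem_ncParts]
    refine ⟨⟨?_, ?_, ?_, ?_, ?_⟩, ?_⟩
    · intro B hB x hx
      rw [Finset.mem_union, Finset.mem_image] at hB
      rcases hB with hB | ⟨B, hB, rfl⟩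
      · exact Finset.mem_insert_of_mem (a1 B hB x hx).1
      · rw [hgx] at hx
        rcases hx with hx | ⟨rfl, -⟩
        · exact Finset.mem_insert_of_mem (b1 B hB x hx).1
        · simp
    · intro x hx
      rw [Finset.mem_insert] at hx
      simp only [Finset.mem_union, Finset.mem_image]
      rcases hx with rfl | hx
      · obtain ⟨B, hB, hdB⟩ := b2 d ⟨hd, le_rfl⟩
        exact ⟨g B, Or.inr ⟨B, hB, rfl⟩, (hgx _ _).2 (Or.inr ⟨rfl, hdB⟩)⟩
      · rcases lt_or_ge x d with h | h
        · obtain ⟨B, hB, hxB⟩ := a2 x ⟨hx, h⟩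
          exact ⟨B, Or.inl hB, hxB⟩
        · obtain ⟨B, hB, hxB⟩ := b2 x ⟨hx, h⟩
          exact ⟨g B, Or.inr ⟨B, hB, rfl⟩, (hgx _ _).2 (Or.inl hxB)⟩
    · intro B hB C hC x hxB hxC
      rw [Finset.mem_union, Finset.mem_image] at hB hC
      rcases hB with hB | ⟨B, hB, rfl⟩ <;> rcases hC with hC | ⟨C, hC, rfl⟩
      · exact a3 B hB C hC x hxB hxC
      · rw [hgx] at hxC
        grind
      · rw [hgx] at hxB
        grind
      · rw [hgx] at hxB hxC
        congr 1
        have := hmB B hB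
        have := hmB C hC
        rcases hxB with hxB | ⟨rfl, hxB⟩ <;> rcases hxC with hxC | ⟨hx', hxC⟩
        · exact b3 B hB C hC x hxB hxC
        · exact absurd (hx' ▸ hxB) (hmB B hB)
        · exact absurd hxC (hmB C hC)
        · exact b3 B hB C hC d hxB hxC
    · intro B hB
      rw [Finset.mem_union, Finset.mem_image] at hB
      rcases hB with hB | ⟨B, hB, rfl⟩
      · exact a4 B hB
      · obtain ⟨x, hx⟩ := b4 B hB
        exact ⟨x, (hgx _ _).2 (Or.inl hx)⟩
    · intro B hB C hC w hw x hx y hy z hz hwx hxy hyz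
      rw [Finset.mem_union, Finset.mem_image] at hB hC
      rcases hB with hB | ⟨B, hB, rfl⟩ <;> rcases hC with hC | ⟨C, hC, rfl⟩
      · exact a5 B hB C hC w hw x hx y hy z hz hwx hxy hyz
      · rw [hgx] at hx hz
        grind
      · rw [hgx] at hw hy
        grind
      · rw [hgx] at hw hx hy hz
        congr 1
        have hx' : x ∈ C := by grind
        have hy' : y ∈ B := by grind
        have hz' : z ∈ C := by grind
        rcases hw with hw | ⟨rfl, hdB⟩
        · exact b5 B hB C hC w hw x hx' y hy' z hz' hwx hxy hyz
        · have hdx := (b1 C hC x hx').2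
          rcases hdx.eq_or_lt with rfl | hdx
          · exact b3 B hB C hC _ hdB hx'
          · exact b5 B hB C hC d hdB x hx' y hy' z hz' hdx hxy hyz
    · obtain ⟨B, hB, hdB⟩ := b2 d ⟨hd, le_rfl⟩
      refine ⟨g B, Finset.mem_union_right _ (Finset.mem_image_of_mem _ hB),
        (hgx _ _).2 (Or.inr ⟨rfl, hdB⟩), (hgd B).2 hdB, ?_⟩
      intro x hx
      rw [hgx] at hx
      rcases hx with hx | ⟨rfl, -⟩
      · exact Or.inr (b1 B hB x hx).2
      · exact Or.inl rfl
  · rintro ⟨π₁, π₂⟩ h ⟨ρ₁, ρ₂⟩ h' heq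
    simp only [Finset.mem_product, mem_ncParts] at h h'
    obtain ⟨⟨a1, a2, a3, a4, a5⟩, ⟨b1, b2, b3, b4, b5⟩⟩ := h
    obtain ⟨⟨c1, c2, c3, c4, c5⟩, ⟨d1, d2, d3, d4, d5⟩⟩ := h'
    clear a2 a3 a5 b2 b3 b5 c2 c3 c5 d2 d3 d5
    simp only [Finset.mem_filter] at a1 b1 c1 d1
    have heq : ∀ B, (B ∈ π₁ ∨ ∃ C ∈ π₂, g C = B) ↔ (B ∈ ρ₁ ∨ ∃ C ∈ ρ₂, g C = B) := by
      intro B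
      have := Finset.ext_iff.1 heq B
      simpa only [Finset.mem_union, Finset.mem_image] using this
    have hgB : ∀ B : Finset α, m ∉ B → (g B).erase m = B := by
      intro B hB
      ext x
      rw [Finset.mem_erase, hgx]
      grind
    have hinj : ∀ B C : Finset α, m ∉ B → m ∉ C → g B = g C → B = C := by
      intro B C hB hC h
      rw [← hgB B hB, ← hgB C hC, h]
    have low : ∀ π : Finset (Finset α), (∀ B ∈ π, ∀ x ∈ B, x ∈ s ∧ d ≤ x) → (∀ B ∈ π, ∃ x, x ∈ B) →
        ∀ B ∈ π, ∀ C : Finset α, (∀ x ∈ C, x ∈ s ∧ x < d) → g B ≠ C := by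
      rintro π h1 h2 B hB C hC rfl
      obtain ⟨x, hx⟩ := h2 B hB
      have := hC x ((hgx _ _).2 (Or.inl hx))
      exact absurd this.2 (not_lt.2 (h1 B hB x hx).2)
    have e1 : π₁ = ρ₁ := by
      ext B
      constructor
      · intro hB
        rcases (heq B).1 (Or.inl hB) with h | ⟨C, hC, h⟩
        · exact h
        · exact absurd h (low ρ₂ d1 d4 C hC B (a1 B hB))
      · intro hB
        rcases (heq B).2 (Or.inl hB) with h | ⟨C, hC, h⟩
        · exact h
        · exact absurd h (low π₂ b1 b4 C hC B (c1 B hB))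
    have e2 : π₂ = ρ₂ := by
      ext B
      constructor
      · intro hB
        rcases (heq (g B)).1 (Or.inr ⟨B, hB, rfl⟩) with h | ⟨C, hC, h⟩
        · exact absurd rfl (low π₂ b1 b4 B hB (g B) (c1 _ h))
        · have := hinj C B (fun h => hms (d1 C hC m h).1) (fun h => hms (b1 B hB m h).1) h
          exact this ▸ hC
      · intro hB
        rcases (heq (g B)).2 (Or.inr ⟨B, hB, rfl⟩) with h | ⟨C, hC, h⟩
        · exact absurd rfl (low ρ₂ d1 d4 B hB (g B) (a1 _ h))
        · have := hinj C B (fun h => hms (b1 C hC m h).1) (fun h => hms (d1 B hB m h).1) h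
          exact this ▸ hC
    rw [e1, e2]
  · intro π hπ
    rw [Finset.mem_filter, mem_ncParts] at hπ
    obtain ⟨⟨a1, a2, a3, a4, a5⟩, B₀, hB₀, hmB₀, hdB₀, hB₀'⟩ := hπ
    simp only [Finset.mem_insert] at a1 a2
    -- A block with elements on both sides of `d` would cross the block of `m` and `d`.
    have hside : ∀ B ∈ π, m ∉ B → ∀ x ∈ B, x < d → ∀ y ∈ B, y < d := by
      intro B hB hmB x hx hxd y hy
      by_contra hyd
      rw [not_lt] at hyd
      have hxm : m < x := by
        rcases a1 B hB x hx with rfl | h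
        · exact absurd hx hmB
        · exact hm x h
      rcases hyd.eq_or_lt with rfl | hyd
      · exact hmB (a3 B hB B₀ hB₀ _ hy hdB₀ ▸ hmB₀)
      · have := a5 B₀ hB₀ B hB m hmB₀ x hx d hdB₀ y hy hxm hxd hyd
        exact hmB (this ▸ hmB₀)
    have hm0 : ∀ B ∈ π, m ∈ B → B = B₀ := fun B hB h => a3 B hB B₀ hB₀ m h hmB₀
    refine ⟨(π.filter (fun B => ∀ x ∈ B, x ∈ s ∧ x < d),
      (π.filter (fun B => ∃ x ∈ B, d ≤ x)).image (fun B => B.erase m)), ?_, ?_⟩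
    · rw [Finset.mem_product, mem_ncParts, mem_ncParts]
      constructor
      · refine ⟨?_, ?_, ?_, ?_, ?_⟩
        · intro B hB x hx
          simp only [Finset.mem_filter] at hB ⊢
          exact hB.2 x hx
        · intro x hx
          simp only [Finset.mem_filter] at hx ⊢
          obtain ⟨B, hB, hxB⟩ := a2 x (Or.inr hx.1)
          have hmB : m ∉ B := by
            intro h
            rw [hm0 B hB h] at hxB
            rcases hB₀' x hxB with rfl | h
            · exact hms hx.1
            · exact absurd hx.2 (not_lt.2 h)
          refine ⟨B, ⟨hB, fun y hy => ⟨?_, hside B hB hmB x hxB hx.2 y hy⟩⟩, hxB⟩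
          rcases a1 B hB y hy with rfl | h
          · exact absurd hy hmB
          · exact h
        · intro B hB C hC
          exact a3 B (Finset.mem_filter.1 hB).1 C (Finset.mem_filter.1 hC).1
        · intro B hB
          exact a4 B (Finset.mem_filter.1 hB).1
        · intro B hB C hC
          exact a5 B (Finset.mem_filter.1 hB).1 C (Finset.mem_filter.1 hC).1
      · refine ⟨?_, ?_, ?_, ?_, ?_⟩
        · intro B hB x hx
          simp only [Finset.mem_image, Finset.mem_filter] at hB ⊢
          obtain ⟨B, ⟨hB, y, hy, hdy⟩, rfl⟩ := hB
          rw [Finset.mem_erase] at hx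
          refine ⟨(a1 B hB x hx.2).resolve_left hx.1, ?_⟩
          by_cases hmB : m ∈ B
          · rw [hm0 B hB hmB] at hx
            exact (hB₀' x hx.2).resolve_left hx.1
          · by_contra h
            exact absurd (hside B hB hmB x hx.2 (not_le.1 h) y hy) (not_lt.2 hdy)
        · intro x hx
          simp only [Finset.mem_image, Finset.mem_filter] at hx ⊢
          obtain ⟨B, hB, hxB⟩ := a2 x (Or.inr hx.1)
          exact ⟨B.erase m, ⟨B, ⟨hB, x, hxB, hx.2⟩, rfl⟩,
            Finset.mem_erase.2 ⟨fun h => hms (h ▸ hx.1), hxB⟩⟩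
        · intro B hB C hC x hxB hxC
          simp only [Finset.mem_image, Finset.mem_filter] at hB hC
          obtain ⟨B, ⟨hB, -⟩, rfl⟩ := hB
          obtain ⟨C, ⟨hC, -⟩, rfl⟩ := hC
          rw [a3 B hB C hC x (Finset.mem_erase.1 hxB).2 (Finset.mem_erase.1 hxC).2]
        · intro B hB
          simp only [Finset.mem_image, Finset.mem_filter] at hB
          obtain ⟨B, ⟨hB, y, hy, hdy⟩, rfl⟩ := hB
          exact ⟨y, Finset.mem_erase.2 ⟨fun h => by
            rw [h] at hdy; exact absurd hmd (not_lt.2 hdy), hy⟩⟩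
        · intro B hB C hC w hw x hx y hy z hz hwx hxy hyz
          simp only [Finset.mem_image, Finset.mem_filter] at hB hC
          obtain ⟨B, ⟨hB, -⟩, rfl⟩ := hB
          obtain ⟨C, ⟨hC, -⟩, rfl⟩ := hC
          rw [a5 B hB C hC w (Finset.mem_erase.1 hw).2 x (Finset.mem_erase.1 hx).2 y
            (Finset.mem_erase.1 hy).2 z (Finset.mem_erase.1 hz).2 hwx hxy hyz]
    · have hge : ∀ B ∈ π, (∃ x ∈ B, d ≤ x) → g (B.erase m) = B := by
        intro B hB hB'
        ext x
        rw [hgx]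
        simp only [Finset.mem_erase]
        constructor
        · rintro (h | ⟨rfl, h⟩)
          · exact h.2
          · rw [a3 B hB B₀ hB₀ d h.2 hdB₀]; exact hmB₀
        · intro hx
          by_cases hxm : x = m
          · refine Or.inr ⟨hxm, fun h => by rw [h] at hmd; exact lt_irrefl _ hmd, ?_⟩
            rw [hm0 B hB (hxm ▸ hx)]; exact hdB₀
          · exact Or.inl ⟨hxm, hx⟩
      ext B
      simp only [Finset.mem_union, Finset.mem_image, Finset.mem_filter]
      constructor
      · rintro (h | ⟨_, ⟨C, ⟨hC, hC'⟩, rfl⟩, rfl⟩)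
        · exact h.1
        · rw [hge C hC hC']; exact hC
      · intro hB
        by_cases hB' : ∃ x ∈ B, d ≤ x
        · exact Or.inr ⟨_, ⟨B, ⟨hB, hB'⟩, rfl⟩, hge B hB hB'⟩
        · refine Or.inl ⟨hB, fun x hx => ?_⟩
          push Not at hB'
          refine ⟨(a1 B hB x hx).resolve_left ?_, hB' x hx⟩
          rintro rfl
          exact absurd (hB' d (hm0 B hB hx ▸ hdB₀)) (lt_irrefl _)
  · rintro ⟨π₁, π₂⟩ h
    simp only [Finset.mem_product, mem_ncParts] at h
    obtain ⟨⟨a1, a2, a3, a4, a5⟩, ⟨b1, b2, b3, b4, b5⟩⟩ := h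
    simp only [Finset.mem_filter] at a1 b1
    have hdisj : Disjoint π₁ (π₂.image g) := by
      rw [Finset.disjoint_left]
      intro B hB hB'
      rw [Finset.mem_image] at hB'
      obtain ⟨C, hC, rfl⟩ := hB'
      obtain ⟨x, hx⟩ := b4 C hC
      exact absurd (a1 _ hB x ((hgx _ _).2 (Or.inl hx))).2 (not_lt.2 (b1 C hC x hx).2)
    have hmB : ∀ B ∈ π₂, m ∉ B := fun B hB h => hms (b1 B hB m h).1
    have hgB : ∀ B ∈ π₂, (g B).erase m = B := by
      intro B hB
      have := hmB B hB
      ext x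
      rw [Finset.mem_erase, hgx]
      grind
    rw [Finset.prod_union hdisj, Finset.prod_image]
    · congr 1
      · refine Finset.prod_congr rfl fun B hB => ?_
        have hB' : m ∉ B := fun h => hms (a1 B hB m h).1
        simp [hB']
      · refine Finset.prod_congr rfl fun B hB => ?_
        have h1 := hmB B hB
        by_cases h : d ∈ B
        · simp only [hg, h, if_true, Finset.mem_insert_self, Finset.card_insert_of_notMem h1]
          congr 1; omega
        · simp [hg, h, h1]
    · intro B hB C hC h
      rw [← hgB B hB, ← hgB C hC, h]

theorem ncSum_zero {α : Type*} [LinearOrder α] {R : Type*} [CommRing R] (κ : ℕ → R)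
    (m : α) (s : Finset α) : ncSum κ 0 m s = ∑ π ∈ ncParts s, ∏ B ∈ π, κ B.card := by
  simp [ncSum]

theorem ncSum_empty {α : Type*} [LinearOrder α] {R : Type*} [CommRing R] (κ : ℕ → R) (j : ℕ)
    (m : α) : ncSum κ j m ∅ = 1 := by
  have : ncParts (∅ : Finset α) = {∅} := by
    ext π
    rw [mem_ncParts, Finset.mem_singleton]
    constructor
    · rintro ⟨h1, -, -, h4, -⟩
      refine Finset.eq_empty_of_forall_notMem fun B hB => ?_
      obtain ⟨x, hx⟩ := h4 B hB
      simpa using h1 B hB x hx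
    · rintro rfl
      constructor <;> simp
  rw [ncSum, this]
  simp

/-- The non-crossing partitions in which the least element `m` is a singleton. -/
theorem ncSum_filter_singleton {α : Type*} [LinearOrder α] {R : Type*} [CommRing R] (κ : ℕ → R)
    (j : ℕ) {m : α} {s : Finset α} (hm : ∀ x ∈ s, m < x) :
    ∑ π ∈ (ncParts (insert m s)).filter (fun π => {m} ∈ π),
      ∏ B ∈ π, κ (B.card + if m ∈ B then j else 0) = κ (1 + j) * ncSum κ 0 m s := by
  classical
  have hms : m ∉ s := fun h => lt_irrefl _ (hm m h)
  rw [ncSum_zero, Finset.mul_sum]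
  symm
  refine Finset.sum_bij (fun π _ => insert {m} π) ?_ ?_ ?_ ?_
  · intro π hπ
    rw [mem_ncParts] at hπ
    obtain ⟨h1, h2, h3, h4, h5⟩ := hπ
    rw [Finset.mem_filter, mem_ncParts]
    refine ⟨⟨?_, ?_, ?_, ?_, ?_⟩, Finset.mem_insert_self _ _⟩
    · intro B hB x hx
      rcases Finset.mem_insert.1 hB with rfl | hB
      · simp_all
      · exact Finset.mem_insert_of_mem (h1 B hB x hx)
    · intro x hx
      rcases Finset.mem_insert.1 hx with rfl | hx
      · exact ⟨{x}, by simp⟩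
      · obtain ⟨B, hB, hxB⟩ := h2 x hx
        exact ⟨B, Finset.mem_insert_of_mem hB, hxB⟩
    · intro B hB C hC x hxB hxC
      rw [Finset.mem_insert] at hB hC
      rcases hB with rfl | hB <;> rcases hC with rfl | hC
      · rfl
      · rw [Finset.mem_singleton] at hxB
        exact absurd (h1 C hC x hxC) (hxB ▸ hms)
      · rw [Finset.mem_singleton] at hxC
        exact absurd (h1 B hB x hxB) (hxC ▸ hms)
      · exact h3 B hB C hC x hxB hxC
    · intro B hB
      rcases Finset.mem_insert.1 hB with rfl | hB
      · exact ⟨m, by simp⟩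
      · exact h4 B hB
    · intro B hB C hC a ha b hb c hc d hd hab hbc hcd
      rw [Finset.mem_insert] at hB hC
      rcases hB with rfl | hB <;> rcases hC with rfl | hC
      · rfl
      · rw [Finset.mem_singleton] at ha hc
        exact absurd (hab.trans hbc) (by rw [ha, hc]; exact lt_irrefl _)
      · rw [Finset.mem_singleton] at hb hd
        exact absurd (hbc.trans hcd) (by rw [hb, hd]; exact lt_irrefl _)
      · exact h5 B hB C hC a ha b hb c hc d hd hab hbc hcd
  · intro π hπ ρ hρ h
    rw [mem_ncParts] at hπ hρ
    have h1 : ({m} : Finset α) ∉ π := fun h => hms (hπ.sub _ h m (by simp))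
    have h2 : ({m} : Finset α) ∉ ρ := fun h => hms (hρ.sub _ h m (by simp))
    rw [← Finset.erase_insert h1, ← Finset.erase_insert h2, h]
  · intro π hπ
    rw [Finset.mem_filter, mem_ncParts] at hπ
    obtain ⟨⟨h1, h2, h3, h4, h5⟩, hmπ⟩ := hπ
    refine ⟨π.erase {m}, ?_, Finset.insert_erase hmπ⟩
    have hne : ∀ B ∈ π.erase {m}, m ∉ B := by
      intro B hB hmB
      rw [Finset.mem_erase] at hB
      exact hB.1 (h3 B hB.2 {m} hmπ m hmB (by simp))
    rw [mem_ncParts]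
    refine ⟨?_, ?_, ?_, ?_, ?_⟩
    · intro B hB x hx
      rcases Finset.mem_insert.1 (h1 B (Finset.mem_of_mem_erase hB) x hx) with rfl | h
      · exact absurd hx (hne B hB)
      · exact h
    · intro x hx
      obtain ⟨B, hB, hxB⟩ := h2 x (Finset.mem_insert_of_mem hx)
      refine ⟨B, Finset.mem_erase.2 ⟨?_, hB⟩, hxB⟩
      rintro rfl
      rw [Finset.mem_singleton] at hxB
      exact hms (hxB ▸ hx)
    · intro B hB C hC
      exact h3 B (Finset.mem_of_mem_erase hB) C (Finset.mem_of_mem_erase hC)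
    · intro B hB
      exact h4 B (Finset.mem_of_mem_erase hB)
    · intro B hB C hC
      exact h5 B (Finset.mem_of_mem_erase hB) C (Finset.mem_of_mem_erase hC)
  · intro π hπ
    rw [mem_ncParts] at hπ
    have h1 : ({m} : Finset α) ∉ π := fun h => hms (hπ.sub _ h m (by simp))
    rw [Finset.prod_insert h1]
    congr 1
    · simp
    · refine Finset.prod_congr rfl fun B hB => ?_
      rw [if_neg (fun h => hms (hπ.sub B hB m h)), add_zero]

/-- Recursion for sums over non-crossing partitions, according to the second element `d` of the
block of the least element `m`. -/
theorem ncSum_insert {α : Type*} [LinearOrder α] {R : Type*} [CommRing R] (κ : ℕ → R)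
    (j : ℕ) {m : α} {s : Finset α} (hm : ∀ x ∈ s, m < x) :
    ncSum κ j m (insert m s) = κ (1 + j) * ncSum κ 0 m s +
      ∑ d ∈ s, ncSum κ 0 m (s.filter (· < d)) * ncSum κ (j + 1) d (s.filter (d ≤ ·)) := by
  classical
  have hms : m ∉ s := fun h => lt_irrefl _ (hm m h)
  rw [← ncSum_filter_singleton κ j hm, ncSum,
    ← Finset.sum_filter_add_sum_filter_not (ncParts (insert m s)) (fun π => {m} ∈ π)]
  congr 1
  rw [← Finset.sum_congr rfl (fun d hd => ncSum_filter_next κ j hm hd)]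
  simp_rw [Finset.sum_filter]
  rw [Finset.sum_comm]
  refine Finset.sum_congr rfl fun π hπ => ?_
  rw [mem_ncParts] at hπ
  obtain ⟨h1, h2, h3, h4, h5⟩ := hπ
  obtain ⟨B₀, hB₀, hm0⟩ := h2 m (Finset.mem_insert_self _ _)
  by_cases hs : {m} ∈ π
  · rw [if_neg (not_not.2 hs), Finset.sum_eq_zero]
    intro d hd
    rw [if_neg]
    rintro ⟨B, hB, hmB, hdB, -⟩
    have : B = {m} := h3 B hB {m} hs m hmB (by simp)
    rw [this, Finset.mem_singleton] at hdB
    exact hms (hdB ▸ hd)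
  · rw [if_pos hs]
    have hne : (B₀.erase m).Nonempty := by
      rw [Finset.nonempty_iff_ne_empty]
      intro h
      apply hs
      have : B₀ = {m} := by rw [← Finset.insert_erase hm0, h]; rfl
      exact this ▸ hB₀
    have hd := Finset.min'_mem _ hne
    rw [Finset.sum_eq_single_of_mem ((B₀.erase m).min' hne), if_pos]
    · refine ⟨B₀, hB₀, hm0, (Finset.mem_erase.1 hd).2, fun x hx => ?_⟩
      by_cases h : x = m
      · exact Or.inl h
      · exact Or.inr (Finset.min'_le _ _ (Finset.mem_erase.2 ⟨h, hx⟩))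
    · exact (Finset.mem_insert.1 (h1 _ hB₀ _ (Finset.mem_erase.1 hd).2)).resolve_left
        (Finset.mem_erase.1 hd).1
    · intro d hds hne'
      rw [if_neg]
      rintro ⟨B, hB, hmB, hdB, hB'⟩
      have := h3 B hB B₀ hB₀ m hmB hm0
      subst this
      apply hne'
      apply le_antisymm
      · exact (hB' _ (Finset.mem_erase.1 hd).2).resolve_left (Finset.mem_erase.1 hd).1
      · exact Finset.min'_le _ _ (Finset.mem_erase.2 ⟨fun h => hms (by rwa [h] at hds), hdB⟩)

/-- The sum over the non-crossing partitions of `{0, …, n - 1}` of the products of the weights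
`κ |B|`, where the block of `0` is counted with `j` additional elements. -/
noncomputable def ncMoment {R : Type*} [CommRing R] (κ : ℕ → R) (j n : ℕ) : R :=
  ncSum κ j 0 (Finset.range n)

theorem ncMoment_zero {R : Type*} [CommRing R] (κ : ℕ → R) (j : ℕ) : ncMoment κ j 0 = 1 := by
  rw [ncMoment, Finset.range_zero, ncSum_empty]

theorem ncSum_Ico {R : Type*} [CommRing R] (κ : ℕ → R) (j a n : ℕ) :
    ncSum κ j a (Finset.Ico a (a + n)) = ncMoment κ j n := by
  have := ncSum_map κ j (OrderEmbedding.addLeft a) 0 (Finset.range n)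
  rw [ncMoment, ← this]
  congr 1
  ext x
  simp only [Finset.mem_Ico, Finset.mem_map, Finset.mem_range, RelEmbedding.coe_toEmbedding,
    OrderEmbedding.addLeft_apply]
  constructor
  · intro h; exact ⟨x - a, by omega, by omega⟩
  · rintro ⟨y, hy, rfl⟩; omega

/-- The block of `0` is a singleton, or its second element is `i + 1` for some `i < n`. -/
theorem ncMoment_succ {R : Type*} [CommRing R] (κ : ℕ → R) (j n : ℕ) :
    ncMoment κ j (n + 1) = κ (1 + j) * ncMoment κ 0 n +
      ∑ i ∈ Finset.range n, ncMoment κ 0 i * ncMoment κ (j + 1) (n - i) := by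
  have h0 : Finset.range (n + 1) = insert 0 (Finset.Ico 1 (1 + n)) := by
    ext x; simp only [Finset.mem_range, Finset.mem_insert, Finset.mem_Ico]; omega
  have hz : ∀ (a b : ℕ) (s : Finset ℕ), ncSum κ 0 a s = ncSum κ 0 b s := by
    intro a b s; rw [ncSum_zero, ncSum_zero]
  rw [ncMoment, h0, ncSum_insert κ j (by intro x hx; rw [Finset.mem_Ico] at hx; omega), hz 0 1,
    ncSum_Ico]
  congr 1
  rw [Finset.sum_Ico_eq_sum_range]
  refine Finset.sum_congr (by simp) fun i hi => ?_
  have hi' : i < n := by simpa using hi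
  have e1 : (Finset.Ico 1 (1 + n)).filter (· < 1 + i) = Finset.Ico 1 (1 + i) := by
    ext x; simp only [Finset.mem_filter, Finset.mem_Ico]; omega
  have e2 : (Finset.Ico 1 (1 + n)).filter (1 + i ≤ ·) = Finset.Ico (1 + i) (1 + i + (n - i)) := by
    ext x; simp only [Finset.mem_filter, Finset.mem_Ico]; omega
  rw [e1, e2, hz 0 1, ncSum_Ico, ncSum_Ico]

/-- `ncMoment κ 0 n` is the right-hand side of the free moment-cumulant formula. -/
theorem sum_noncrossingPartitions {R : Type*} [CommRing R] (κ : ℕ → R) (n : ℕ) :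
    ∑ π ∈ noncrossingPartitions n, ∏ B ∈ π.parts, κ B.card = ncMoment κ 0 n := by
  classical
  cases n with
  | zero =>
    rw [ncMoment_zero]
    have h : ∀ π : Finpartition (Finset.univ : Finset (Fin 0)), π.parts = ∅ := by
      intro π
      refine Finset.eq_empty_of_forall_notMem fun B hB => ?_
      obtain ⟨x, -⟩ := Finset.nonempty_of_ne_empty (π.ne_bot hB)
      exact x.elim0
    have h2 : noncrossingPartitions 0 =
        {(Finpartition.empty (Finset (Fin 0))).copy Finset.univ_eq_empty.symm} := by
      ext π
      rw [Finset.mem_singleton]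
      simp only [noncrossingPartitions, Finset.mem_filter, Finset.mem_univ, true_and]
      refine ⟨fun _ => Finpartition.ext ((h π).trans (h _).symm), fun _ B hB => ?_⟩
      rw [h π] at hB
      simp at hB
    rw [h2, Finset.sum_singleton, h, Finset.prod_empty]
  | succ n =>
    have hmap := ncSum_map κ 0 (Fin.valOrderEmb (n + 1)) 0 Finset.univ
    have hr : (Finset.univ : Finset (Fin (n + 1))).map (Fin.valOrderEmb (n + 1)).toEmbedding =
        Finset.range (n + 1) := by
      ext x
      simp only [Finset.mem_map, Finset.mem_univ, true_and, Finset.mem_range,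
        RelEmbedding.coe_toEmbedding, Fin.valOrderEmb_apply]
      exact ⟨by rintro ⟨y, rfl⟩; exact y.2, fun h => ⟨⟨x, h⟩, rfl⟩⟩
    rw [hr] at hmap
    have h0 : (Fin.valOrderEmb (n + 1)) 0 = 0 := rfl
    rw [h0] at hmap
    rw [ncMoment, hmap, ncSum_zero]
    refine Finset.sum_bij (fun π _ => π.parts) ?_ ?_ ?_ ?_
    · intro π hπ
      simp only [noncrossingPartitions, Finset.mem_filter, Finset.mem_univ, true_and] at hπ
      rw [mem_ncParts]
      refine ⟨fun _ _ _ _ => Finset.mem_univ _, fun x hx => ?_, ?_, ?_, hπ⟩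
      · obtain ⟨B, hB, hx⟩ := π.exists_mem hx
        exact ⟨B, hB, hx⟩
      · intro B hB C hC x hxB hxC
        exact π.eq_of_mem_parts hB hC hxB hxC
      · intro B hB
        exact π.nonempty_of_mem_parts hB
    · intro π _ ρ _ h
      exact Finpartition.ext h
    · intro π hπ
      rw [mem_ncParts] at hπ
      obtain ⟨h1, h2, h3, h4, h5⟩ := hπ
      refine ⟨Finpartition.ofExistsUnique π (fun _ _ => Finset.subset_univ _) ?_ ?_, ?_, rfl⟩
      · intro x hx
        obtain ⟨B, hB, hxB⟩ := h2 x hx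
        exact ⟨B, ⟨hB, hxB⟩, fun C hC => h3 C hC.1 B hB x hC.2 hxB⟩
      · intro h
        obtain ⟨x, hx⟩ := h4 ∅ h
        simp at hx
      · simp only [noncrossingPartitions, Finset.mem_filter, Finset.mem_univ, true_and]
        exact h5
    · intro π _
      rfl

/-- Geometric bounds on the cumulants pass to the moments; the number of non-crossing partitions
of `n` points is a Catalan number. -/
theorem abs_ncMoment_le {κ : ℕ → ℝ} {D : ℝ} (hκ : ∀ n, 1 ≤ n → |κ n| ≤ D ^ n)
    (n j : ℕ) (hn : 1 ≤ n) : |ncMoment κ j n| ≤ D ^ (n + j) * catalan n := by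
  have hD : 0 ≤ D := by simpa using (abs_nonneg _).trans (hκ 1 le_rfl)
  induction n using Nat.strong_induction_on generalizing j with
  | _ n ih =>
    have ih0 : ∀ i < n, |ncMoment κ 0 i| ≤ D ^ i * catalan i := by
      intro i hi
      rcases Nat.eq_zero_or_pos i with rfl | hi0
      · simp [ncMoment_zero]
      · simpa using ih i hi 0 hi0
    obtain ⟨n, rfl⟩ : ∃ k, n = k + 1 := ⟨n - 1, by omega⟩
    rw [ncMoment_succ, catalan_succ', Finset.Nat.sum_antidiagonal_eq_sum_range_succ
      (fun i k => catalan i * catalan k), Finset.sum_range_succ]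
    simp only [Nat.sub_self, catalan_zero, mul_one]
    push_cast
    rw [mul_add, add_comm (D ^ (n + 1 + j) * _), Finset.mul_sum]
    refine (abs_add_le _ _).trans (add_le_add ?_ ((Finset.abs_sum_le_sum_abs _ _).trans
      (Finset.sum_le_sum fun i hi => ?_)))
    · rw [abs_mul, show n + 1 + j = (1 + j) + n by ring, pow_add, mul_assoc]
      exact mul_le_mul (hκ _ (by omega)) (ih0 n (by omega)) (abs_nonneg _) (by positivity)
    · have hi' : i < n := by simpa using hi
      rw [abs_mul, show n + 1 + j = i + (n - i + (j + 1)) by omega, pow_add]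
      calc _ ≤ (D ^ i * catalan i) * (D ^ (n - i + (j + 1)) * catalan (n - i)) :=
            mul_le_mul (ih0 i (by omega)) (ih (n - i) (by omega) (j + 1) (by omega))
              (abs_nonneg _) (by positivity)
        _ = _ := by ring

theorem moment_eq_ncMoment {M : ℕ → ℝ} (h0 : M 0 = 1) (n : ℕ) :
    M n = ncMoment (freeCumulantOfMoments M) 0 n := by
  rcases Nat.eq_zero_or_pos n with rfl | hn
  · rw [h0, ncMoment_zero]
  · rw [moment_eq_sum_noncrossing M hn, sum_noncrossingPartitions]

/-! ### The functional equation for the generating series of the moments -/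

theorem map_ncMoment {R S : Type*} [CommRing R] [CommRing S] (f : R →+* S) (κ : ℕ → R) (j n : ℕ) :
    ncMoment (fun n => f (κ n)) j n = f (ncMoment κ j n) := by
  simp only [ncMoment, ncSum, map_sum, map_prod]

/-- The series `1 + ∑_{n ≥ 1} κ n w ^ n`. -/
noncomputable def cumulantSeries {R : Type*} [CommRing R] (κ : ℕ → R) : PowerSeries R :=
  PowerSeries.mk fun n => if n = 0 then 1 else κ n

/-- The series of the moments with free cumulants `κ`. -/
noncomputable def momentSeries {R : Type*} [CommRing R] (κ : ℕ → R) : PowerSeries R :=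
  PowerSeries.mk (ncMoment κ 0)

open PowerSeries in
theorem eq_zero_of_eq_X_mul_succ {R : Type*} [CommRing R] {H : ℕ → PowerSeries R}
    {N : PowerSeries R} (h : ∀ j, H j = X * (N * H (j + 1))) (j : ℕ) : H j = 0 := by
  ext n
  rw [map_zero]
  induction n using Nat.strong_induction_on generalizing j with
  | _ n ih =>
    rw [h j]
    cases n with
    | zero => simp
    | succ n =>
      rw [coeff_succ_X_mul, coeff_mul]
      refine Finset.sum_eq_zero fun p hp => ?_
      rw [Finset.HasAntidiagonal.mem_antidiagonal] at hp
      rw [ih p.2 (by omega) (j + 1), mul_zero]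

open PowerSeries in
theorem hasSubst_X_mul {R : Type*} [CommRing R] (N : PowerSeries R) : HasSubst (X * N) :=
  HasSubst.of_constantCoeff_zero' (by simp)

open PowerSeries in
/-- The functional equation `C(w M(w)) = M(w)` between the series of moments and of free
cumulants. -/
theorem cumulantSeries_subst {R : Type*} [CommRing R] (κ : ℕ → R) :
    (cumulantSeries κ).subst (X * momentSeries κ) = momentSeries κ := by
  set N := momentSeries κ with hN
  have hT := hasSubst_X_mul N
  -- The tails `D j` of the cumulant series, and the moments with `j` additional elements in
  -- the first block, satisfy the same recursion.
  set D : ℕ → PowerSeries R := fun j => mk fun n => if n = 0 then 0 else κ (n + j) with hD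
  set G : ℕ → PowerSeries R := fun j => mk (ncMoment κ j) - 1 with hG
  have hDrec : ∀ j, D j = X * (C (κ (1 + j)) + D (j + 1)) := by
    intro j
    ext n
    cases n with
    | zero => simp [hD]
    | succ n =>
      rw [coeff_succ_X_mul]
      rcases Nat.eq_zero_or_pos n with rfl | hn
      · simp [hD]
      · simp only [hD, coeff_mk, map_add, coeff_C, hn.ne', if_false, zero_add]
        rw [if_neg (by omega)]
        congr 1; omega
  have hGrec : ∀ j, G j = X * (N * (C (κ (1 + j)) + G (j + 1))) := by
    intro j
    ext n
    cases n with
    | zero => simp [hG, ncMoment_zero]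
    | succ n =>
      rw [coeff_succ_X_mul, mul_add, map_add, coeff_mul_C, coeff_mul,
        Finset.Nat.sum_antidiagonal_eq_sum_range_succ
          (fun i k => coeff i N * coeff k (G (j + 1))), Finset.sum_range_succ]
      simp only [hG, map_sub, coeff_mk, coeff_one, Nat.succ_ne_zero, if_false, sub_zero,
        Nat.sub_self, if_true, ncMoment_zero, sub_self, mul_zero, add_zero, ncMoment_succ, hN,
        momentSeries]
      rw [mul_comm]
      congr 1
      refine Finset.sum_congr rfl fun i hi => ?_
      have : i < n := by simpa using hi
      rw [if_neg (by omega), sub_zero]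
  have hzero := eq_zero_of_eq_X_mul_succ (N := N) (H := fun j => G j - (D j).subst (X * N)) (by
    intro j
    have h1 : (D j).subst (X * N) =
        X * N * (C (κ (1 + j)) + (D (j + 1)).subst (X * N)) := by
      conv_lhs => rw [hDrec j]
      rw [subst_mul hT, subst_X hT, subst_add hT, subst_C]
      rfl
    rw [h1]
    conv_lhs => rw [hGrec j]
    ring) 0
  have h1 : cumulantSeries κ = 1 + D 0 := by
    ext n
    rcases Nat.eq_zero_or_pos n with rfl | hn
    · simp [cumulantSeries, hD]
    · simp [cumulantSeries, hD, hn.ne', coeff_one]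
  have h2 : N = 1 + G 0 := by simp [hG, hN, momentSeries]
  rw [h1, subst_add hT]
  conv_rhs => rw [h2, sub_eq_zero.1 hzero]
  congr 1
  rw [← coe_substAlgHom hT, map_one]

/-! ### Linear functionals on power series with coefficients in an algebra -/

/-- The coefficientwise extension of a linear functional to power series. -/
noncomputable def seriesMap {A : Type*} [Ring A] [Algebra ℂ A] (φ : A →ₗ[ℂ] ℂ)
    (f : PowerSeries A) : PowerSeries ℂ :=
  PowerSeries.mk fun n => φ (PowerSeries.coeff n f)

section functionals

open PowerSeries

section seriesMap

variable {A : Type*} [Ring A] [Algebra ℂ A] (φ : A →ₗ[ℂ] ℂ)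

@[simp]
theorem coeff_seriesMap (f : PowerSeries A) (n : ℕ) : coeff n (seriesMap φ f) = φ (coeff n f) := by
  simp [seriesMap]

theorem seriesMap_sub (f g : PowerSeries A) :
    seriesMap φ (f - g) = seriesMap φ f - seriesMap φ g := by
  ext n; simp

theorem seriesMap_add (f g : PowerSeries A) :
    seriesMap φ (f + g) = seriesMap φ f + seriesMap φ g := by
  ext n; simp

theorem seriesMap_map_mul (c : PowerSeries ℂ) (f : PowerSeries A) :
    seriesMap φ (PowerSeries.map (algebraMap ℂ A) c * f) = c * seriesMap φ f := by
  ext n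
  simp [coeff_mul, ← Algebra.smul_def]

theorem seriesMap_one (h : φ 1 = 1) : seriesMap φ (1 : PowerSeries A) = 1 := by
  ext n
  rcases Nat.eq_zero_or_pos n with rfl | hn
  · simp [h]
  · simp [coeff_one, hn.ne']

theorem commute_map_algebraMap (c : PowerSeries ℂ) (f : PowerSeries A) :
    Commute (PowerSeries.map (algebraMap ℂ A) c) f := by
  ext n
  rw [coeff_mul, coeff_mul, ← Finset.Nat.sum_antidiagonal_swap]
  refine Finset.sum_congr rfl fun p _ => ?_
  exact Algebra.commutes _ _

theorem seriesMap_map_aeval (a : A) (f : PowerSeries (Polynomial ℂ)) :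
    seriesMap φ (PowerSeries.map (Polynomial.aeval a : Polynomial ℂ →ₐ[ℂ] A).toRingHom f) =
      seriesMap (φ ∘ₗ (Polynomial.aeval a : Polynomial ℂ →ₐ[ℂ] A).toLinearMap) f := by
  ext n; simp

theorem map_aeval_map_C (a : A) (c : PowerSeries ℂ) :
    PowerSeries.map (Polynomial.aeval a : Polynomial ℂ →ₐ[ℂ] A).toRingHom
      (PowerSeries.map Polynomial.C c) = PowerSeries.map (algebraMap ℂ A) c := by
  ext n; simp

end seriesMap

/-- The series `c(w) - w x`, over the polynomials in `x`. The series `c` of the free cumulants of a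
functional is characterized by the value `1` of the functional on the inverse of its pencil. -/
noncomputable def pencil (c : PowerSeries ℂ) : PowerSeries (Polynomial ℂ) :=
  PowerSeries.map Polynomial.C c - X * C Polynomial.X

theorem map_aeval_pencil {A : Type*} [Ring A] [Algebra ℂ A] (a : A) (c : PowerSeries ℂ) :
    PowerSeries.map (Polynomial.aeval a : Polynomial ℂ →ₐ[ℂ] A).toRingHom (pencil c) =
      PowerSeries.map (algebraMap ℂ A) c - X * C a := by
  rw [pencil, map_sub, map_aeval_map_C]
  simp

theorem exists_pencil_inverse {c : PowerSeries ℂ} (hc : constantCoeff c = 1) :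
    ∃ Y : PowerSeries (Polynomial ℂ), pencil c * Y = 1 ∧ constantCoeff Y = 1 := by
  have h1 : constantCoeff (pencil c) = 1 := by
    rw [← coeff_zero_eq_constantCoeff_apply, pencil, map_sub, coeff_map, coeff_zero_X_mul,
      coeff_zero_eq_constantCoeff_apply, hc, map_one, sub_zero]
  have hu : IsUnit (pencil c) := by
    rw [PowerSeries.isUnit_iff_constantCoeff, h1]
    exact isUnit_one
  obtain ⟨Y, hY⟩ := hu.exists_right_inv
  refine ⟨Y, hY, ?_⟩
  have := congrArg constantCoeff hY
  rwa [map_mul, h1, one_mul, map_one] at this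

/-- Substitution of a series with linear term `X` is injective, as such a series has a
compositional inverse. -/
theorem eq_of_subst_eq {T : PowerSeries ℂ} (h0 : constantCoeff T = 0) (h1 : coeff 1 T = 1)
    {f g : PowerSeries ℂ} (h : f.subst T = g.subst T) : f = g := by
  have : Invertible (coeff 1 T) := ⟨1, by simp [h1], by simp [h1]⟩
  have hT : HasSubst T := HasSubst.of_constantCoeff_zero' h0
  have hS : HasSubst T.substInv := HasSubst.of_constantCoeff_zero' (constantCoeff_substInv T)
  have h2 : ∀ f : PowerSeries ℂ, PowerSeries.subst T.substInv (PowerSeries.subst T f) = f := by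
    intro f
    rw [PowerSeries.subst_comp_subst_apply hT hS, subst_substInv_right T h0, X_subst]
  rw [← h2 f, ← h2 g, h]

theorem coeff_one_X_mul_momentSeries (κ : ℕ → ℂ) : coeff 1 (X * momentSeries κ) = 1 := by
  rw [show (1 : ℕ) = 0 + 1 from rfl, coeff_succ_X_mul]
  simp [momentSeries, ncMoment_zero]

/-- If `L` has free cumulants `κ` and `C` is their series, then `L` takes the value `1` on
`(C(w) - w x)⁻¹`. -/
theorem seriesMap_pencil_inverse {L : Polynomial ℂ →ₗ[ℂ] ℂ} {κ : ℕ → ℂ}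
    (hL : ∀ n, L (Polynomial.X ^ n) = ncMoment κ 0 n) {Y : PowerSeries (Polynomial ℂ)}
    (hY : pencil (cumulantSeries κ) * Y = 1) : seriesMap L Y = 1 := by
  set N := momentSeries κ with hN
  set T := X * N with hTdef
  set T' : PowerSeries (Polynomial ℂ) := PowerSeries.map Polynomial.C T with hT'
  have hT : HasSubst T := hasSubst_X_mul N
  have hT0 : constantCoeff T' = 0 := by
    rw [hT', ← coeff_zero_eq_constantCoeff_apply, coeff_map, hTdef]; simp
  have hTs : HasSubst T' := HasSubst.of_constantCoeff_zero' hT0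
  have hL1 : seriesMap L (mk fun n => (Polynomial.X : Polynomial ℂ) ^ n) = N := by
    ext n; simp [hL, hN, momentSeries]
  -- Substitute `w = z M(z)`.
  have h1 : (PowerSeries.map Polynomial.C N - T' * C Polynomial.X) * Y.subst T' = 1 := by
    have := congrArg (substAlgHom hTs) hY
    rw [map_mul, map_one, pencil, map_sub, map_mul, substAlgHom_X] at this
    simp only [coe_substAlgHom] at this
    have hmap : PowerSeries.map Polynomial.C ((cumulantSeries κ).subst T) =
        (PowerSeries.map Polynomial.C (cumulantSeries κ)).subst T' :=
      PowerSeries.map_subst hT _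
    rw [subst_C, ← hmap, cumulantSeries_subst] at this
    exact this
  have hN1 : N * N⁻¹ = 1 := by
    apply PowerSeries.mul_inv_cancel
    rw [← coeff_zero_eq_constantCoeff_apply]
    simp [hN, momentSeries, ncMoment_zero]
  have hgeom : (mk fun n => (Polynomial.X : Polynomial ℂ) ^ n) * (1 - X * C Polynomial.X) = 1 := by
    ext n
    rw [mul_sub, mul_one, mul_comm X (C _), ← mul_assoc]
    cases n with
    | zero => simp
    | succ n =>
      rw [map_sub, coeff_succ_mul_X, coeff_mul_C]
      simp [pow_succ, coeff_one]
  have h2 : Y.subst T' = PowerSeries.map Polynomial.C N⁻¹ *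
      mk fun n => (Polynomial.X : Polynomial ℂ) ^ n := by
    have e : PowerSeries.map Polynomial.C N * PowerSeries.map Polynomial.C N⁻¹ = 1 := by
      rw [← map_mul, hN1, map_one]
    have h3 : PowerSeries.map Polynomial.C N * ((1 - X * C Polynomial.X) * Y.subst T') = 1 := by
      have h3 : T' = X * PowerSeries.map Polynomial.C N := by rw [hT', hTdef, map_mul, map_X]
      refine Eq.trans ?_ h1
      generalize Y.subst T' = W
      rw [h3]; ring
    calc Y.subst T' = (mk fun n => (Polynomial.X : Polynomial ℂ) ^ n) * (1 - X * C Polynomial.X) *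
          ((PowerSeries.map Polynomial.C N * PowerSeries.map Polynomial.C N⁻¹) *
            Y.subst T') := by rw [hgeom, e]; ring
      _ = (PowerSeries.map Polynomial.C N * ((1 - X * C Polynomial.X) * Y.subst T')) *
          (PowerSeries.map Polynomial.C N⁻¹ * mk fun n => (Polynomial.X : Polynomial ℂ) ^ n) := by
          ring
      _ = _ := by rw [h3, one_mul]
  have h4 : seriesMap L (Y.subst T') = 1 := by
    rw [h2]
    have := seriesMap_map_mul L N⁻¹ (mk fun n => (Polynomial.X : Polynomial ℂ) ^ n)
    rw [Polynomial.algebraMap_eq] at this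
    rw [this, hL1, mul_comm, hN1]
  -- The functional acts on coefficients, so it commutes with the substitution of a scalar series.
  have h5 : seriesMap L (Y.subst T') = (seriesMap L Y).subst T := by
    ext n
    rw [coeff_seriesMap, coeff_subst' hTs, coeff_subst' hT]
    have hfin := coeff_subst_finite' hTs Y n
    rw [map_finsum L hfin]
    refine finsum_congr fun d => ?_
    rw [coeff_seriesMap, hT', ← map_pow, coeff_map, smul_eq_mul, mul_comm,
      ← Polynomial.smul_eq_C_mul, map_smul, smul_eq_mul, smul_eq_mul, mul_comm]
  refine eq_of_subst_eq (T := T) (by simp [hTdef]) (coeff_one_X_mul_momentSeries κ) ?_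
  rw [← h5, h4, ← coe_substAlgHom hT, map_one]

/-- The resolvent identity `Y - Z = (d - c) Y Z` shows that at most one series gives expectation `1`
to the inverse of its pencil. -/
theorem pencil_unique {L : Polynomial ℂ →ₗ[ℂ] ℂ} (hL : L 1 = 1) {c d : PowerSeries ℂ}
    {Y Z : PowerSeries (Polynomial ℂ)} (hY1 : constantCoeff Y = 1) (hZ1 : constantCoeff Z = 1)
    (hY : pencil c * Y = 1) (hZ : pencil d * Z = 1) (hLY : seriesMap L Y = 1)
    (hLZ : seriesMap L Z = 1) : c = d := by
  have h1 : Y - Z = PowerSeries.map (algebraMap ℂ (Polynomial ℂ)) (d - c) * (Y * Z) := by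
    rw [Polynomial.algebraMap_eq, map_sub]
    calc Y - Z = Y * (pencil d * Z) - Z * (pencil c * Y) := by rw [hY, hZ]; ring
      _ = _ := by simp only [pencil]; ring
  have h2 := congrArg (seriesMap L) h1
  rw [seriesMap_sub, hLY, hLZ, sub_self, seriesMap_map_mul] at h2
  have h3 : seriesMap L (Y * Z) ≠ 0 := by
    intro h
    have := congrArg (coeff 0) h
    rw [coeff_seriesMap, coeff_zero_eq_constantCoeff_apply, map_mul, hY1, hZ1, mul_one, hL] at this
    simp at this
  have := (mul_eq_zero.1 h2.symm).resolve_right h3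
  exact (sub_eq_zero.1 this).symm

end functionals

section additivity

open PowerSeries

/-! ### Alternating products of centred elements -/

section alternating

variable {A : Type*} [Ring A] [Algebra ℂ A] {ι : Type*}

/-- The span of the alternating products of centred elements of the algebras `S i` whose first
factor lies in `S i`. -/
def alternatingSpan (φ : A →ₗ[ℂ] ℂ) (S : ι → Subalgebra ℂ A) (i : ι) : Submodule ℂ A :=
  Submodule.span ℂ {x | ∃ (e : A) (l : List (ι × A)),
    ((i, e) :: l).IsChain (fun x y => x.1 ≠ y.1) ∧
    (∀ x ∈ (i, e) :: l, x.2 ∈ S x.1 ∧ φ x.2 = 0) ∧ (((i, e) :: l).map Prod.snd).prod = x}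

theorem AreFree.apply_eq_zero {φ : A →ₗ[ℂ] ℂ} {S : ι → Subalgebra ℂ A} (h : AreFree φ S) {i : ι}
    {x : A} (hx : x ∈ alternatingSpan φ S i) : φ x = 0 := by
  have : alternatingSpan φ S i ≤ LinearMap.ker φ := by
    refine Submodule.span_le.2 ?_
    rintro _ ⟨e, l, h1, h2, rfl⟩
    exact h _ (List.cons_ne_nil _ _) h1 h2
  exact this hx

/-- The subspace of centred elements of `S i`. -/
def centred (φ : A →ₗ[ℂ] ℂ) (S : ι → Subalgebra ℂ A) (i : ι) : Submodule ℂ A :=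
  (S i).toSubmodule ⊓ LinearMap.ker φ

theorem centred_le_alternatingSpan (φ : A →ₗ[ℂ] ℂ) (S : ι → Subalgebra ℂ A) (i : ι) :
    centred φ S i ≤ alternatingSpan φ S i := by
  rintro e ⟨h1, h2⟩
  refine Submodule.subset_span ⟨e, [], List.isChain_singleton _, ?_, by simp⟩
  intro x hx
  rw [List.mem_singleton] at hx
  subst hx
  exact ⟨h1, h2⟩

theorem mul_mem_alternatingSpan {φ : A →ₗ[ℂ] ℂ} {S : ι → Subalgebra ℂ A} {i j : ι} (hij : i ≠ j)
    {e y : A} (he : e ∈ centred φ S i) (hy : y ∈ alternatingSpan φ S j) :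
    e * y ∈ alternatingSpan φ S i := by
  induction hy using Submodule.span_induction with
  | mem y hy =>
    obtain ⟨f, l, h1, h2, rfl⟩ := hy
    refine Submodule.subset_span ⟨e, (j, f) :: l, ?_, ?_, by simp⟩
    · exact List.isChain_cons_cons.2 ⟨hij, h1⟩
    · intro x hx
      rcases List.mem_cons.1 hx with rfl | hx
      · exact ⟨he.1, he.2⟩
      · exact h2 x hx
  | zero => simp
  | add x y _ _ hx hy => rw [mul_add]; exact add_mem hx hy
  | smul c x _ hx => rw [mul_smul_comm]; exact Submodule.smul_mem _ _ hx

theorem coeff_mul_mem_alternatingSpan {φ : A →ₗ[ℂ] ℂ} {S : ι → Subalgebra ℂ A} {i j : ι}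
    (hij : i ≠ j) {E f : PowerSeries A} (hE : ∀ n, coeff n E ∈ centred φ S i)
    (hf : ∀ n, coeff n f ∈ alternatingSpan φ S j) (n : ℕ) :
    coeff n (E * f) ∈ alternatingSpan φ S i := by
  rw [coeff_mul]
  exact Submodule.sum_mem _ fun p _ => mul_mem_alternatingSpan hij (hE _) (hf _)

/-- Solutions of `R = G + P Q R` have coefficients in the span of the alternating products that
start in `S i`, if `P`, `Q` are centred and `G` has this property. -/
theorem coeff_mem_alternatingSpan_of_eq {φ : A →ₗ[ℂ] ℂ} {S : ι → Subalgebra ℂ A} {i j : ι}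
    (hij : i ≠ j) {P Q G R : PowerSeries A} (hP : ∀ n, coeff n P ∈ centred φ S i)
    (hQ : ∀ n, coeff n Q ∈ centred φ S j) (h0 : coeff 0 P * coeff 0 Q = 0)
    (hG : ∀ n, coeff n G ∈ alternatingSpan φ S i) (hR : R = G + P * (Q * R)) (n : ℕ) :
    coeff n R ∈ alternatingSpan φ S i := by
  induction n using Nat.strong_induction_on with
  | _ n ih =>
    rw [hR, map_add]
    refine add_mem (hG n) ?_
    rw [coeff_mul]
    refine Submodule.sum_mem _ fun p hp => ?_
    rw [coeff_mul, Finset.mul_sum]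
    refine Submodule.sum_mem _ fun q hq => ?_
    rw [Finset.HasAntidiagonal.mem_antidiagonal] at hp hq
    rcases (show q.2 ≤ n by omega).eq_or_lt with h | h
    · have h1 : p.1 = 0 := by omega
      have h2 : q.1 = 0 := by omega
      rw [h1, h2, ← mul_assoc, h0, zero_mul]
      exact zero_mem _
    · exact mul_mem_alternatingSpan hij (hP _) (mul_mem_alternatingSpan hij.symm (hQ _) (ih _ h))

/-- Freeness, for series of alternating products. -/
theorem seriesMap_eq_zero {φ : A →ₗ[ℂ] ℂ} {S : ι → Subalgebra ℂ A} (h : AreFree φ S) {i : ι}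
    {f : PowerSeries A} (hf : ∀ n, coeff n f ∈ alternatingSpan φ S i) : seriesMap φ f = 0 := by
  ext n
  rw [coeff_seriesMap, h.apply_eq_zero (hf n), map_zero]

end alternating

/-! ### The resolvent of an element with given free cumulants -/

section resolvent

variable {A : Type*} [Ring A] [Algebra ℂ A] {φ : A →ₗ[ℂ] ℂ}

theorem constantCoeff_cumulantSeries {R : Type*} [CommRing R] (κ : ℕ → R) :
    constantCoeff (cumulantSeries κ) = 1 := by
  rw [← coeff_zero_eq_constantCoeff_apply]; simp [cumulantSeries]

/-- The inverse of `c(w) - w a`, where `c` is the image of `C` under `w ↦ r w`, is `1 + E` with `E`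
centred. -/
theorem exists_centred_resolvent (hφ : φ 1 = 1) {a : A} {κ : ℕ → ℂ}
    (ha : ∀ n, φ (a ^ n) = ncMoment κ 0 n) (r : ℂ) :
    ∃ E : PowerSeries A, (∀ n, coeff n E ∈ Algebra.adjoin ℂ {a}) ∧ (∀ n, φ (coeff n E) = 0) ∧
      coeff 0 E = 0 ∧
      (PowerSeries.map (algebraMap ℂ A) (rescale r (cumulantSeries κ)) -
        X * C (algebraMap ℂ A r * a)) * (1 + E) = 1 ∧
      (1 + E) * (PowerSeries.map (algebraMap ℂ A) (rescale r (cumulantSeries κ)) -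
        X * C (algebraMap ℂ A r * a)) = 1 := by
  obtain ⟨Y, hY, hY1⟩ := exists_pencil_inverse (constantCoeff_cumulantSeries κ)
  set ev := PowerSeries.map (Polynomial.aeval a : Polynomial ℂ →ₐ[ℂ] A).toRingHom with hev
  set L : Polynomial ℂ →ₗ[ℂ] ℂ :=
    φ ∘ₗ (Polynomial.aeval a : Polynomial ℂ →ₐ[ℂ] A).toLinearMap with hLdef
  have hL : seriesMap L Y = 1 := seriesMap_pencil_inverse (by intro n; simp [hLdef, ha]) hY
  set Y' := rescale (Polynomial.C r) Y with hY'
  have hresc : ev (rescale (Polynomial.C r) (pencil (cumulantSeries κ))) =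
      PowerSeries.map (algebraMap ℂ A) (rescale r (cumulantSeries κ)) -
        X * C (algebraMap ℂ A r * a) := by
    rw [pencil, map_sub, map_sub]
    congr 1
    · ext n; simp [hev]
    · ext n
      cases n with
      | zero => simp [hev]
      | succ n =>
        rw [coeff_succ_X_mul, hev, coeff_map, coeff_rescale, coeff_succ_X_mul, coeff_C, coeff_C]
        split_ifs with h
        · subst h; simp
        · simp
  have hEn : ∀ n, φ (coeff n (ev Y' - 1)) = 0 := by
    intro n
    have h1 := congrArg (coeff n) hL
    rw [coeff_seriesMap] at h1
    have h2 : coeff n (ev Y') = algebraMap ℂ A (r ^ n) * Polynomial.aeval a (coeff n Y) := by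
      rw [hev, coeff_map, hY', coeff_rescale]; simp
    rw [map_sub, map_sub, h2, ← Algebra.smul_def, map_smul]
    have h3 : φ (Polynomial.aeval a (coeff n Y)) = coeff n (1 : PowerSeries ℂ) := h1
    rw [h3, coeff_one, coeff_one]
    split_ifs with h
    · subst h; simp [hφ]
    · simp
  refine ⟨ev Y' - 1, ?_, hEn, ?_, ?_, ?_⟩
  · intro n
    rw [map_sub]
    refine sub_mem ?_ ?_
    · rw [hev, coeff_map]
      exact Polynomial.aeval_mem_adjoin_singleton ℂ a
    · rw [coeff_one]
      split_ifs
      · exact one_mem _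
      · exact zero_mem _
  · rw [hev, map_sub, coeff_map, hY', coeff_rescale, coeff_zero_eq_constantCoeff_apply, hY1]
    simp
  · rw [add_sub_cancel, ← hresc, ← map_mul, hY', ← map_mul, hY, map_one, map_one]
  · rw [add_sub_cancel, ← hresc, ← map_mul, hY', ← map_mul, mul_comm, hY, map_one, map_one]

/-- If the inverse of `c(w) - w a` has expectation `1`, then `c` is the series of the free
cumulants. -/
theorem eq_cumulantSeries {L : Polynomial ℂ →ₗ[ℂ] ℂ} {κ : ℕ → ℂ}
    (hL : ∀ n, L (Polynomial.X ^ n) = ncMoment κ 0 n) {c : PowerSeries ℂ}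
    {Y : PowerSeries (Polynomial ℂ)} (hY1 : constantCoeff Y = 1) (hY : pencil c * Y = 1)
    (hLY : seriesMap L Y = 1) : c = cumulantSeries κ := by
  obtain ⟨Z, hZ, hZ1⟩ := exists_pencil_inverse (constantCoeff_cumulantSeries κ)
  refine pencil_unique ?_ hY1 hZ1 hY hZ hLY (seriesMap_pencil_inverse hL hZ)
  simpa [ncMoment_zero] using hL 0

end resolvent

/-! ### Free cumulants of free sums and of free compressions -/

/-- Free cumulants are additive on free elements. The argument inverts
`C_a + C_b - 1 - w (a + b) = (1 + E_a)⁻¹ + (1 + E_b)⁻¹ - 1`, with centred `E_a`, `E_b`: the inverse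
is `1` plus alternating products of the coefficients of `E_a` and `E_b`. -/
theorem cumulantSeries_add_of_free {A : Type*} [Ring A] [Algebra ℂ A] {φ : A →ₗ[ℂ] ℂ}
    (hφ : φ 1 = 1) {a b : A} (hfree : AreFreeElements φ a b) {κ₁ κ₂ κ : ℕ → ℂ}
    (ha : ∀ n, φ (a ^ n) = ncMoment κ₁ 0 n) (hb : ∀ n, φ (b ^ n) = ncMoment κ₂ 0 n)
    (hab : ∀ n, φ ((a + b) ^ n) = ncMoment κ 0 n) :
    cumulantSeries κ = cumulantSeries κ₁ + cumulantSeries κ₂ - 1 := by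
  obtain ⟨E, hE1, hE2, hE3, hE4, hE5⟩ := exists_centred_resolvent hφ ha 1
  obtain ⟨F, hF1, hF2, hF3, hF4, hF5⟩ := exists_centred_resolvent hφ hb 1
  simp only [map_one, one_mul, rescale_one, RingHom.id_apply] at hE4 hE5 hF4 hF5
  set S : Fin 2 → Subalgebra ℂ A := ![Algebra.adjoin ℂ {a}, Algebra.adjoin ℂ {b}] with hS
  have hEc : ∀ n, coeff n E ∈ centred φ S 0 := fun n => ⟨hE1 n, hE2 n⟩
  have hFc : ∀ n, coeff n F ∈ centred φ S 1 := fun n => ⟨hF1 n, hF2 n⟩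
  set c := cumulantSeries κ₁ + cumulantSeries κ₂ - 1 with hc
  have hc1 : constantCoeff c = 1 := by simp [hc, constantCoeff_cumulantSeries]
  obtain ⟨Y, hY, hY1⟩ := exists_pencil_inverse hc1
  set L : Polynomial ℂ →ₗ[ℂ] ℂ :=
    φ ∘ₗ (Polynomial.aeval (a + b) : Polynomial ℂ →ₐ[ℂ] A).toLinearMap with hLdef
  refine (eq_cumulantSeries (L := L) (by intro n; simp [hLdef, hab]) hY1 hY ?_).symm
  set Z := PowerSeries.map (Polynomial.aeval (a + b) : Polynomial ℂ →ₐ[ℂ] A).toRingHom Y with hZ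
  rw [hLdef, ← seriesMap_map_aeval, ← hZ]
  set Xa := PowerSeries.map (algebraMap ℂ A) (cumulantSeries κ₁) - X * C a with hXa
  set Xb := PowerSeries.map (algebraMap ℂ A) (cumulantSeries κ₂) - X * C b with hXb
  have hK : (Xa + Xb - 1) * Z = 1 := by
    have := congrArg
      (PowerSeries.map (Polynomial.aeval (a + b) : Polynomial ℂ →ₐ[ℂ] A).toRingHom) hY
    rw [map_mul, map_one, map_aeval_pencil, ← hZ] at this
    refine Eq.trans ?_ this
    rw [hc, hXa, hXb]
    simp only [map_add, map_sub, map_one]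
    noncomm_ring
  -- `J = (1 + F)⁻¹ Z` satisfies `J = 1 + E + E F J`.
  set J := Xb * Z with hJ
  have hZJ : Z = (1 + F) * J := by rw [hJ, ← mul_assoc, hF5, one_mul]
  have h1 : Z + (1 + E) * J - (1 + E) * Z = 1 + E := by
    calc Z + (1 + E) * J - (1 + E) * Z = ((1 + E) * Xa) * Z + (1 + E) * J - (1 + E) * Z := by
          rw [hE5, one_mul]
      _ = (1 + E) * ((Xa + Xb - 1) * Z) := by rw [hJ]; noncomm_ring
      _ = 1 + E := by rw [hK, mul_one]
  have h2 : J - 1 = (E + E * F) + E * (F * (J - 1)) := by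
    have h3 : J - E * (F * J) = 1 + E := by
      rw [← h1, hZJ]; noncomm_ring
    have h4 : J = 1 + E + E * (F * J) := by rw [← h3]; abel
    calc J - 1 = (1 + E + E * (F * J)) - 1 := by rw [← h4]
      _ = _ := by noncomm_ring
  have hEF : ∀ n, coeff n (E + E * F) ∈ alternatingSpan φ S 0 := by
    intro n
    rw [map_add]
    exact add_mem (centred_le_alternatingSpan _ _ _ (hEc n))
      (coeff_mul_mem_alternatingSpan (by decide) hEc
        (fun n => centred_le_alternatingSpan _ _ _ (hFc n)) n)
  have hJ1 := coeff_mem_alternatingSpan_of_eq (by decide) hEc hFc (by rw [hE3, zero_mul]) hEF h2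
  have h5 : Z = 1 + (J - 1) + F + F * (J - 1) := by
    rw [hZJ]; noncomm_ring
  rw [h5, seriesMap_add, seriesMap_add, seriesMap_add, seriesMap_one φ hφ,
    seriesMap_eq_zero hfree hJ1,
    seriesMap_eq_zero hfree (fun n => centred_le_alternatingSpan _ _ _ (hFc n)),
    seriesMap_eq_zero hfree (coeff_mul_mem_alternatingSpan (by decide) hFc hJ1)]
  simp

/-- The free cumulants of a compression by a free projection of rank `c`: the `n`-th one is
multiplied by `c ^ (n - 1)`. With `C_a(c w) - c w a = (1 + E)⁻¹`, the corner `V = p Z` of the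
inverse `Z` of the pencil of `p a p` is `(1 + E) J`, where `J = p + c⁻¹ (p - c) E J`, so that it
equals `c` up to alternating products of centred elements. -/
theorem cumulantSeries_compression_of_free {A : Type*} [Ring A] [Algebra ℂ A] {φ : A →ₗ[ℂ] ℂ}
    (hφ : φ 1 = 1) {a p : A} (hp : p * p = p) {c : ℂ} (hc : c ≠ 0) (hpc : φ p = c)
    (hfree : AreFreeElements φ a p) {κ κ' : ℕ → ℂ} (ha : ∀ n, φ (a ^ n) = ncMoment κ 0 n)
    (hpa : ∀ n, c⁻¹ * φ (p * (p * a * p) ^ n) = ncMoment κ' 0 n) :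
    cumulantSeries κ' = 1 + C c⁻¹ * (rescale c (cumulantSeries κ) - 1) := by
  obtain ⟨E, hE1, hE2, hE3, hE4, hE5⟩ := exists_centred_resolvent hφ ha c
  set S : Fin 2 → Subalgebra ℂ A := ![Algebra.adjoin ℂ {a}, Algebra.adjoin ℂ {p}] with hS
  have hEc : ∀ n, coeff n E ∈ centred φ S 0 := fun n => ⟨hE1 n, hE2 n⟩
  set q : A := p - algebraMap ℂ A c with hq
  have hqc : q ∈ centred φ S 1 := by
    refine ⟨sub_mem (Algebra.subset_adjoin (Set.mem_singleton p))
      (Subalgebra.algebraMap_mem _ _), ?_⟩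
    change φ (p - algebraMap ℂ A c) = 0
    rw [map_sub, hpc, Algebra.algebraMap_eq_smul_one, map_smul, hφ]
    simp
  set Q : PowerSeries A := C (c⁻¹ • q) with hQ
  have hQc : ∀ n, coeff n Q ∈ centred φ S 1 := by
    intro n
    rw [hQ, coeff_C]
    split_ifs
    · exact Submodule.smul_mem _ _ hqc
    · exact zero_mem _
  have hqc' : ∀ n, coeff n (C q : PowerSeries A) ∈ centred φ S 1 := by
    intro n
    rw [coeff_C]
    split_ifs
    · exact hqc
    · exact zero_mem _
  set d := 1 + C c⁻¹ * (rescale c (cumulantSeries κ) - 1) with hd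
  have hd1 : constantCoeff d = 1 := by
    rw [hd, map_add, map_mul, map_sub, ← coeff_zero_eq_constantCoeff_apply (rescale c _),
      coeff_rescale, coeff_zero_eq_constantCoeff_apply, constantCoeff_cumulantSeries]
    simp
  obtain ⟨Y, hY, hY1⟩ := exists_pencil_inverse hd1
  set b := p * a * p with hb
  set ψ : A →ₗ[ℂ] ℂ := c⁻¹ • (φ ∘ₗ LinearMap.mulLeft ℂ p) with hψ
  set L : Polynomial ℂ →ₗ[ℂ] ℂ :=
    ψ ∘ₗ (Polynomial.aeval b : Polynomial ℂ →ₐ[ℂ] A).toLinearMap with hLdef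
  refine (eq_cumulantSeries (L := L) (by intro n; simp [hLdef, hψ, hpa]) hY1 hY ?_).symm
  set Z := PowerSeries.map (Polynomial.aeval b : Polynomial ℂ →ₐ[ℂ] A).toRingHom Y with hZ
  rw [hLdef, ← seriesMap_map_aeval, ← hZ]
  set D := PowerSeries.map (algebraMap ℂ A) d with hD
  set K := D - X * C b with hK
  have hKdef :
      PowerSeries.map (Polynomial.aeval b : Polynomial ℂ →ₐ[ℂ] A).toRingHom (pencil d) = K :=
    map_aeval_pencil b d
  have hKZ : K * Z = 1 := by rw [← hKdef, hZ, ← map_mul, hY, map_one]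
  have hZK : Z * K = 1 := by rw [← hKdef, hZ, ← map_mul, mul_comm, hY, map_one]
  set P : PowerSeries A := C p with hP
  have hPP : P * P = P := by rw [hP, ← map_mul, hp]
  have hPb : P * C b = C b := by rw [hP, ← map_mul, hb, ← mul_assoc, ← mul_assoc, hp]
  have hbP : C b * P = C b := by rw [hP, ← map_mul, hb, mul_assoc, hp]
  have hPX : P * X = X * P := X_mul.symm
  have hPD : P * D = D * P := (commute_map_algebraMap d P).symm
  have hPK : P * K = K * P := by
    rw [hK, mul_sub, sub_mul, hPD, ← mul_assoc P X, hPX, mul_assoc X P, hPb, mul_assoc X, hbP]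
  have hPZ : P * Z = Z * P := by
    calc P * Z = Z * K * P * Z := by rw [hZK, one_mul]
      _ = Z * (K * P) * Z := by noncomm_ring
      _ = Z * P * (K * Z) := by rw [← hPK]; noncomm_ring
      _ = Z * P := by rw [hKZ, mul_one]
  -- `p` commutes with `p a p`, and `V` is the inverse of `K` in the corner of `p`.
  set V := P * Z with hV
  have hPV : P * V = V := by rw [hV, ← mul_assoc, hPP]
  have hKV : K * V = P := by rw [hPZ, ← mul_assoc, hKZ, one_mul]
  set κc := PowerSeries.map (algebraMap ℂ A) (rescale c (cumulantSeries κ)) with hκc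
  set Xa := κc - X * C (algebraMap ℂ A c * a) with hXa
  have hcc : algebraMap ℂ A c⁻¹ * algebraMap ℂ A c = 1 := by
    rw [← map_mul, inv_mul_cancel₀ hc, map_one]
  set c' : PowerSeries A := PowerSeries.map (algebraMap ℂ A) (C c) with hc'
  set ci : PowerSeries A := PowerSeries.map (algebraMap ℂ A) (C c⁻¹) with hci
  have hcci : ci * c' = 1 := by rw [hci, hc', ← map_mul, ← map_mul, inv_mul_cancel₀ hc]; simp
  have hcci' : c' * ci = 1 := by rw [hci, hc', ← map_mul, ← map_mul, mul_inv_cancel₀ hc]; simp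
  have hXa' : Xa = κc - c' * (X * C a) := by
    rw [hXa, hc', map_C, ← mul_assoc, ← X_mul, mul_assoc, ← map_mul]
  have hDk : D = 1 + ci * (κc - 1) := by
    rw [hD, hd, hci, hκc]; simp
  have hPc : ∀ f : PowerSeries A, f * c' = c' * f := fun f => (commute_map_algebraMap _ f).symm
  have hPci : ∀ f : PowerSeries A, f * ci = ci * f := fun f => (commute_map_algebraMap _ f).symm
  have hPκ : P * κc = κc * P := (commute_map_algebraMap _ P).symm
  have hbV : C b * V = P * (C a * V) := by
    have : (C b : PowerSeries A) = P * C a * P := by rw [hP, ← map_mul, ← map_mul, hb]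
    rw [this, mul_assoc, mul_assoc, hPV]
  -- The defining equation of `V`, in terms of the centred resolvent of `a`.
  have hV1 : c' * V - V + P * (Xa * V) = c' * P := by
    have e1 : P * (Xa * V) = κc * V - c' * (X * (C b * V)) := by
      rw [hXa', sub_mul, mul_sub, ← mul_assoc P κc, hPκ, mul_assoc κc, hPV, hbV,
        ← mul_assoc X P, ← hPX, mul_assoc P X, ← mul_assoc c' P, ← hPc P]
      noncomm_ring
    have e2 : c' * (K * V) = c' * V + κc * V - V - c' * (X * (C b * V)) := by
      rw [hK, sub_mul, hDk]
      have : c' * ((1 + ci * (κc - 1)) * V - X * C b * V) =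
        c' * V + (c' * ci) * ((κc - 1) * V) - c' * (X * (C b * V)) := by noncomm_ring
      rw [this, hcci']
      noncomm_ring
    rw [e1, ← hKV, e2]
    abel
  set J := Xa * V with hJ
  have hVJ : V = (1 + E) * J := by rw [hJ, ← mul_assoc, hE5, one_mul]
  have hPq : P = C q + c' := by
    rw [hP, hc', map_C, ← map_add, hq]; simp
  have hQq : Q = ci * C q := by
    rw [hQ, hci, map_C, ← map_mul, Algebra.smul_def]
  have hJrec : J = P + Q * (E * J) := by
    have e1 : c' * J = c' * P + C q * (E * J) := by
      have : c' * V - P * V + P * J = c' * P := by rw [hPV]; exact hV1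
      rw [hVJ] at this
      rw [← this, hPq]
      noncomm_ring
    calc J = ci * (c' * J) := by rw [← mul_assoc, hcci, one_mul]
      _ = (ci * c') * P + ci * C q * (E * J) := by rw [e1]; noncomm_ring
      _ = _ := by rw [hcci, one_mul, hQq]
  have hR : J - c' = (C q + C q * E) + Q * (E * (J - c')) := by
    have e2 : Q * (E * c') = C q * E := by
      rw [hPc E, ← mul_assoc, hPc Q, hQq, ← mul_assoc, hcci', one_mul]
    calc J - c' = P + Q * (E * J) - c' := by rw [← hJrec]
      _ = C q + Q * (E * c') + Q * (E * (J - c')) := by rw [hPq]; noncomm_ring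
      _ = _ := by rw [e2]
  have hG : ∀ n, coeff n (C q + C q * E) ∈ alternatingSpan φ S 1 := by
    intro n
    rw [map_add]
    exact add_mem (centred_le_alternatingSpan _ _ _ (hqc' n))
      (coeff_mul_mem_alternatingSpan (by decide) hqc'
        (fun n => centred_le_alternatingSpan _ _ _ (hEc n)) n)
  have hJ1 := coeff_mem_alternatingSpan_of_eq (by decide) hQc hEc (by rw [hE3, mul_zero]) hG hR
  have hV2 : V = c' * 1 + c' * E + (J - c') + E * (J - c') := by
    rw [← hPc E, hVJ]; noncomm_ring
  have hψφ : seriesMap ψ Z = C c⁻¹ * seriesMap φ V := by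
    ext n
    rw [coeff_seriesMap, coeff_C_mul, coeff_seriesMap, hV, hP, coeff_C_mul]
    simp [hψ]
  rw [hψφ, hV2, seriesMap_add, seriesMap_add, seriesMap_add, hc', seriesMap_map_mul,
    seriesMap_map_mul, seriesMap_one φ hφ,
    seriesMap_eq_zero hfree (fun n => centred_le_alternatingSpan _ _ _ (hEc n)),
    seriesMap_eq_zero hfree hJ1,
    seriesMap_eq_zero hfree (coeff_mul_mem_alternatingSpan (by decide) hEc hJ1)]
  simp only [mul_one, mul_zero, add_zero]
  rw [← map_mul, inv_mul_cancel₀ hc, map_one]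

theorem HasMoments.eq_ncMoment {μ : Measure ℝ} {M : ℕ → ℂ} (h : HasMoments μ M) (n : ℕ) :
    M n = ncMoment (fun n => (freeCumulant μ n : ℂ)) 0 n := by
  have hp := h.1.1
  rw [← h.2 n]
  have h0 : ∫ x, x ^ 0 ∂μ = 1 := by simp
  have := moment_eq_ncMoment (M := fun n => ∫ x, x ^ n ∂μ) h0 n
  rw [this]
  exact (map_ncMoment Complex.ofRealHom _ 0 n).symm

theorem IsFreeConv.freeCumulant {μ ν σ : Measure ℝ} (h : IsFreeConv μ ν σ) {n : ℕ} (hn : 1 ≤ n) :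
    freeCumulant σ n = freeCumulant μ n + freeCumulant ν n := by
  obtain ⟨A, _, _, _, _, φ, a, b, hφ, _, _, hfree, hμ, hν, hσ⟩ := h
  have := cumulantSeries_add_of_free hφ.1 hfree hμ.eq_ncMoment hν.eq_ncMoment hσ.eq_ncMoment
  have h2 := congrArg (coeff n) this
  simp only [cumulantSeries, map_add, map_sub, coeff_mk, coeff_one, if_neg (show n ≠ 0 by omega),
    sub_zero] at h2
  exact_mod_cast h2

theorem IsFreeCompression.freeCumulant {c : ℝ} (hc : c ≠ 0) {μ ν : Measure ℝ}
    (h : IsFreeCompression c μ ν) {n : ℕ} (hn : 1 ≤ n) :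
    freeCumulant ν n = c ^ (n - 1) * freeCumulant μ n := by
  obtain ⟨A, _, _, _, _, φ, a, p, hφ, _, hp, hpc, hfree, hμ, hν⟩ := h
  have := cumulantSeries_compression_of_free hφ.1 hp.isIdempotentElem (c := (c : ℂ))
    (by exact_mod_cast hc) hpc hfree hμ.eq_ncMoment hν.eq_ncMoment
  have h2 := congrArg (coeff n) this
  rw [map_add, coeff_C_mul, map_sub, coeff_rescale] at h2
  simp only [cumulantSeries, coeff_mk, coeff_one, if_neg (show n ≠ 0 by omega),
    sub_zero, zero_add] at h2
  obtain ⟨n, rfl⟩ : ∃ k, n = k + 1 := ⟨n - 1, by omega⟩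
  rw [pow_succ', mul_assoc, ← mul_assoc, inv_mul_cancel₀ (by exact_mod_cast hc), one_mul] at h2
  simp only [Nat.add_sub_cancel]
  exact_mod_cast h2

end additivity

/-! ### Spectral measures -/

section spectral

variable {H : Type*} [NormedAddCommGroup H] [InnerProductSpace ℂ H] [CompleteSpace H]

open scoped CompactlySupported in
/-- The spectral measure of a self-adjoint bounded operator at a vector. -/
theorem exists_spectral_measure {T : H →L[ℂ] H} (hT : IsSelfAdjoint T) (x : H) :
    ∃ σ : Measure ℝ, IsFiniteMeasure σ ∧ (∃ K : ℝ, σ (Set.Icc (-K) K)ᶜ = 0) ∧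
      ∀ n : ℕ, ((∫ y, y ^ n ∂σ : ℝ) : ℂ) = inner ℂ x ((T ^ n) x) := by
  set X := spectrum ℝ T with hX
  have hcomp : IsCompact X := by
    rw [isCompact_iff_compactSpace]; infer_instance
  -- The measure represents the positive functional `f ↦ ⟨x, f(T) x⟩`.
  let Λ : C_c(X, ℝ) →ₚ[ℝ] ℝ := PositiveLinearMap.mk₀
    { toFun := fun f => (inner ℂ x (cfcHom hT f.toContinuousMap x)).re
      map_add' := by
        intro f g
        have : (f + g).toContinuousMap = f.toContinuousMap + g.toContinuousMap := rfl
        rw [this, map_add]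
        simp
      map_smul' := by
        intro c f
        have : (c • f).toContinuousMap = c • f.toContinuousMap := rfl
        rw [this, map_smul]
        simp only [smul_apply, RingHom.id_apply, smul_eq_mul]
        rw [← Complex.coe_smul, inner_smul_right, Complex.re_ofReal_mul] }
    (by
      intro f hf
      have h1 : 0 ≤ cfcHom hT f.toContinuousMap := by
        rw [cfcHom_nonneg_iff]
        intro y
        exact hf y
      have h2 := (ContinuousLinearMap.nonneg_iff_isPositive _).1 h1
      exact (Complex.le_def.1 (h2.inner_nonneg_right x)).1)
  set ρ := RealRMK.rieszMeasure Λ with hρ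
  refine ⟨ρ.map Subtype.val, ?_, ?_, ?_⟩
  · have : IsFiniteMeasure ρ := by infer_instance
    infer_instance
  · obtain ⟨K, hK⟩ := hcomp.isBounded.subset_closedBall 0
    refine ⟨K, ?_⟩
    rw [Measure.map_apply measurable_subtype_coe measurableSet_Icc.compl]
    convert measure_empty (μ := ρ)
    ext y
    simp only [Set.mem_preimage, Set.mem_compl_iff, Set.mem_empty_iff_false, iff_false, not_not]
    have := hK y.2
    rw [Metric.mem_closedBall, dist_zero_right, Real.norm_eq_abs, abs_le] at this
    exact this
  · intro n
    have hid : Continuous fun y : X => (y : ℝ) ^ n := by fun_prop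
    let f : C_c(X, ℝ) := ⟨⟨fun y : X => (y : ℝ) ^ n, hid⟩, HasCompactSupport.of_compactSpace _⟩
    have h1 : ∫ y, y ^ n ∂(ρ.map Subtype.val) = ∫ y, f y ∂ρ := by
      rw [integral_map (by fun_prop) (by fun_prop)]
      rfl
    have h2 : Λ f = (inner ℂ x ((T ^ n) x)).re := by
      have : f.toContinuousMap = (ContinuousMap.restrict X (.id ℝ)) ^ n := by
        ext y; simp [f]
      change (inner ℂ x (cfcHom hT f.toContinuousMap x)).re = _
      rw [this, map_pow, cfcHom_id]
    rw [h1, RealRMK.integral_rieszMeasure, h2]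
    have h3 : IsSelfAdjoint (T ^ n) := hT.pow n
    apply Complex.conj_eq_iff_re.1
    rw [inner_conj_symm]
    exact (ContinuousLinearMap.isSelfAdjoint_iff_isSymmetric.1 h3) x x

end spectral

/-! ### Ampliations -/

section ampliation

variable {E : Type*} [NormedAddCommGroup E] [InnerProductSpace ℂ E] {J : Type*}

theorem memlp_apply (T : E →L[ℂ] E) (f : lp (fun _ : J => E) 2) :
    Memℓp (fun j => T (f j)) 2 := by
  have h := (lp.memℓp f).summable (p := 2) (by simp)
  refine memℓp_gen ?_
  simp only [ENNReal.toReal_ofNat, Real.rpow_ofNat] at h ⊢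
  refine Summable.of_nonneg_of_le (fun j => by positivity) (fun j => ?_) (h.mul_left (‖T‖ ^ 2))
  rw [← mul_pow]
  gcongr
  exact T.le_opNorm _

/-- The coordinatewise action of an operator on a Hilbert sum of copies of a Hilbert space. -/
noncomputable def ampliation (J : Type*) (T : E →L[ℂ] E) :
    lp (fun _ : J => E) 2 →L[ℂ] lp (fun _ : J => E) 2 :=
  LinearMap.mkContinuous
    { toFun := fun f => ⟨fun j => T (f j), memlp_apply T f⟩
      map_add' := by intro f g; ext j; exact map_add T _ _
      map_smul' := by intro c f; ext j; simp } ‖T‖ (by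
      intro f
      refine lp.norm_le_of_forall_sum_le (by simp) (by positivity) fun s => ?_
      have h := lp.sum_rpow_le_norm_rpow (p := 2) (by simp) f s
      simp only [ENNReal.toReal_ofNat, Real.rpow_ofNat] at h ⊢
      calc ∑ j ∈ s, ‖T (f j)‖ ^ 2 ≤ ∑ j ∈ s, ‖T‖ ^ 2 * ‖f j‖ ^ 2 := by
            refine Finset.sum_le_sum fun j _ => ?_
            rw [← mul_pow]
            gcongr
            exact T.le_opNorm _
        _ = ‖T‖ ^ 2 * ∑ j ∈ s, ‖f j‖ ^ 2 := by rw [Finset.mul_sum]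
        _ ≤ (‖T‖ * ‖f‖) ^ 2 := by rw [mul_pow]; gcongr)

@[simp]
theorem ampliation_apply (T : E →L[ℂ] E) (f : lp (fun _ : J => E) 2) (j : J) :
    ampliation J T f j = T (f j) := rfl

variable [CompleteSpace E]

/-- Ampliation as a `*`-homomorphism. -/
noncomputable def ampliationHom (E : Type*) [NormedAddCommGroup E] [InnerProductSpace ℂ E]
    [CompleteSpace E] (J : Type*) :
    (E →L[ℂ] E) →⋆ₐ[ℂ] (lp (fun _ : J => E) 2 →L[ℂ] lp (fun _ : J => E) 2) where
  toFun := ampliation J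
  map_one' := by ext f j; simp
  map_mul' := by intro S T; ext f j; simp
  map_zero' := by ext f j; simp
  map_add' := by intro S T; ext f j; rfl
  commutes' := by intro c; ext f j; simp [Algebra.algebraMap_eq_smul_one]
  map_star' := by
    intro T
    rw [ContinuousLinearMap.star_eq_adjoint, ContinuousLinearMap.star_eq_adjoint,
      ContinuousLinearMap.eq_adjoint_iff]
    intro f g
    rw [lp.inner_eq_tsum, lp.inner_eq_tsum]
    refine tsum_congr fun j => ?_
    rw [ampliation_apply, ampliation_apply, ContinuousLinearMap.adjoint_inner_left]

/-- A Hilbert basis of a Hilbert sum of copies of a Hilbert space, with the pairs of a copy and a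
basis vector relabelled along `e`. -/
noncomputable def hilbertSumBasis {M W : Type*} (b : HilbertBasis M ℂ E) (e : W ≃ J × M) :
    HilbertBasis W ℂ (lp (fun _ : J => E) 2) := by
  classical
  refine HilbertBasis.mkOfOrthogonalEqBot
    (v := fun w => lp.single 2 (e w).1 (b (e w).2)) ?_ ?_
  · rw [orthonormal_iff_ite]
    intro w w'
    rw [lp.inner_single_left, lp.single_apply, Pi.single_apply]
    have hb := orthonormal_iff_ite.1 b.orthonormal (e w).2 (e w').2
    by_cases h1 : (e w).1 = (e w').1
    · rw [if_pos h1, hb]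
      congr 1
      rw [← e.injective.eq_iff (a := w), Prod.ext_iff]
      simp [h1]
    · rw [if_neg h1, inner_zero_right, if_neg]
      rintro rfl
      exact h1 rfl
  · rw [Submodule.eq_bot_iff]
    intro f hf
    ext j
    have h : ∀ m, inner ℂ (b m) (f j) = 0 := by
      intro m
      have := (Submodule.mem_orthogonal _ f).1 hf _
        (Submodule.subset_span ⟨e.symm (j, m), rfl⟩)
      rw [lp.inner_single_left] at this
      simpa using this
    apply b.repr.injective
    ext m
    rw [b.repr_apply_apply, h m]
    simp

theorem hilbertSumBasis_repr {M W : Type*} (b : HilbertBasis M ℂ E) (e : W ≃ J × M)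
    (f : lp (fun _ : J => E) 2) (w : W) :
    (hilbertSumBasis b e).repr f w = inner ℂ (b (e w).2) (f (e w).1) := by
  classical
  rw [HilbertBasis.repr_apply_apply, hilbertSumBasis, HilbertBasis.coe_mkOfOrthogonalEqBot,
    lp.inner_single_left]

end ampliation

/-! ### Free products of vector states -/

/-- The state `T ↦ ⟨Ω, T Ω⟩`. -/
noncomputable def vectorState {H : Type*} [NormedAddCommGroup H] [InnerProductSpace ℂ H]
    (Ω : H) : (H →L[ℂ] H) →ₗ[ℂ] ℂ where
  toFun T := inner ℂ Ω (T Ω)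
  map_add' := by intro S T; simp
  map_smul' := by intro c T; simp

theorem vectorState_apply {H : Type*} [NormedAddCommGroup H] [InnerProductSpace ℂ H]
    (Ω : H) (T : H →L[ℂ] H) : vectorState Ω T = inner ℂ Ω (T Ω) := rfl

theorem isStarState_vectorState {H : Type*} [NormedAddCommGroup H] [InnerProductSpace ℂ H]
    [CompleteSpace H] {Ω : H} (hΩ : ‖Ω‖ = 1) : IsStarState (vectorState Ω) := by
  constructor
  · simp [vectorState_apply, hΩ]
  · intro T
    have : vectorState Ω (star T * T) = ((‖T Ω‖ ^ 2 : ℝ) : ℂ) := by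
      rw [vectorState_apply, mul_apply_eq_comp, ContinuousLinearMap.star_eq_adjoint,
        ContinuousLinearMap.adjoint_inner_right, inner_self_eq_norm_sq_to_K]
      simp
    rw [this]
    exact ⟨by rw [Complex.ofReal_re]; positivity, Complex.ofReal_im _⟩

open Classical in
/-- The monoid with unit `e` in which `x * y = x` for `x ≠ e`; it turns the index set of a Hilbert
basis with a distinguished element into a monoid, in order to use the reduced words of Mathlib. -/
noncomputable abbrev leftZeroMonoid {M : Type*} (e : M) : Monoid M where
  mul x y := if x = e then y else x
  one := e
  mul_assoc x y z := by
    change (if (if x = e then y else x) = e then z else (if x = e then y else x)) =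
      if x = e then (if y = e then z else y) else x
    by_cases h : x = e <;> simp [h]
  one_mul x := by
    change (if e = e then x else e) = x
    simp
  mul_one x := by
    change (if x = e then e else x) = x
    split_ifs with h
    · exact h.symm
    · rfl

section freeProduct

open Monoid.CoprodI

theorem fstIdx_empty_ne {M ι : Type*} [Monoid M] (i : ι) :
    (Word.empty : Word (fun _ : ι => M)).fstIdx ≠ some i := by
  simp [Word.fstIdx]

variable {M ι : Type*} [Monoid M] [DecidableEq M] [DecidableEq ι]

/-- Reduced words split into a letter of type `i`, possibly trivial, and a word that does not start
with such a letter. -/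
def wordEquiv (i : ι) :
    Word (fun _ : ι => M) ≃ {w : Word (fun _ : ι => M) // w.fstIdx ≠ some i} × M :=
  (Word.equivPair i).trans
    { toFun := fun p => (⟨p.tail, p.fstIdx_ne⟩, p.head)
      invFun := fun q => ⟨q.2, q.1.1, q.1.2⟩
      left_inv := fun _ => rfl
      right_inv := fun _ => rfl }

theorem wordEquiv_of_ne {i : ι} {w : Word (fun _ : ι => M)} (h : w.fstIdx ≠ some i) :
    wordEquiv i w = (⟨w, h⟩, 1) := by
  rw [wordEquiv, Equiv.trans_apply, Word.equivPair_eq_of_fstIdx_ne h]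
  rfl

variable {E : Type*} [NormedAddCommGroup E] [InnerProductSpace ℂ E] [CompleteSpace E]

/-- The identification of the free product Hilbert space, with basis the reduced words, with a
Hilbert sum of copies of `E` that correspond to the first letter of type `i`. -/
noncomputable def wordUnitary (b : HilbertBasis M ℂ E) (i : ι) :
    lp (fun _ : {w : Word (fun _ : ι => M) // w.fstIdx ≠ some i} => E) 2 ≃ₗᵢ[ℂ]
      lp (fun _ : Word (fun _ : ι => M) => ℂ) 2 :=
  (hilbertSumBasis b (wordEquiv i)).repr

/-- The left action of the operators on the `i`-th copy of `E` on the free product Hilbert space. -/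
noncomputable def wordRep (b : HilbertBasis M ℂ E) (i : ι) :
    (E →L[ℂ] E) →⋆ₐ[ℂ] (lp (fun _ : Word (fun _ : ι => M) => ℂ) 2 →L[ℂ]
      lp (fun _ : Word (fun _ : ι => M) => ℂ) 2) :=
  (wordUnitary b i).conjStarAlgEquiv.toStarAlgHom.comp (ampliationHom E _)

theorem wordRep_apply (b : HilbertBasis M ℂ E) (i : ι) (T : E →L[ℂ] E)
    (x : lp (fun _ : Word (fun _ : ι => M) => ℂ) 2) (w : Word (fun _ : ι => M)) :
    wordRep b i T x w = inner ℂ (b (wordEquiv i w).2)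
      (T ((wordUnitary b i).symm x (wordEquiv i w).1)) := by
  change (hilbertSumBasis b (wordEquiv i)).repr (ampliation _ T ((wordUnitary b i).symm x)) w = _
  rw [hilbertSumBasis_repr, ampliation_apply]

theorem inner_wordUnitary_symm (b : HilbertBasis M ℂ E) (i : ι)
    (x : lp (fun _ : Word (fun _ : ι => M) => ℂ) 2) (w : Word (fun _ : ι => M)) :
    inner ℂ (b (wordEquiv i w).2) ((wordUnitary b i).symm x (wordEquiv i w).1) = x w := by
  rw [← hilbertSumBasis_repr]
  exact congrArg (fun y : lp (fun _ : Word (fun _ : ι => M) => ℂ) 2 => y w)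
    ((wordUnitary b i).apply_symm_apply x)

/-- `x` is supported on the words that do not start with a letter of type `i`. -/
def StartsOutside (i : ι) (x : lp (fun _ : Word (fun _ : ι => M) => ℂ) 2) : Prop :=
  ∀ w, (wordEquiv i w).2 ≠ 1 → x w = 0

/-- `x` is supported on the words that start with a letter of type `i`. -/
def StartsInside (i : ι) (x : lp (fun _ : Word (fun _ : ι => M) => ℂ) 2) : Prop :=
  ∀ w, (wordEquiv i w).2 = 1 → x w = 0

theorem StartsInside.startsOutside {i j : ι} (hij : i ≠ j)
    {x : lp (fun _ : Word (fun _ : ι => M) => ℂ) 2} (h : StartsInside i x) :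
    StartsOutside j x := by
  intro w hw
  refine h w ?_
  by_cases h1 : w.fstIdx = some j
  · rw [wordEquiv_of_ne (by rw [h1]; simpa using hij.symm)]
  · exact absurd (by rw [wordEquiv_of_ne h1]) hw

/-- On a vector supported on words that do not start with a letter of type `i`, all the components
in `E` are multiples of the distinguished vector. -/
theorem StartsOutside.wordUnitary_symm {b : HilbertBasis M ℂ E} {i : ι}
    {x : lp (fun _ : Word (fun _ : ι => M) => ℂ) 2} (h : StartsOutside i x)
    (n : {w : Word (fun _ : ι => M) // w.fstIdx ≠ some i}) :
    (wordUnitary b i).symm x n = x n.1 • b 1 := by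
  apply b.repr.injective
  ext m
  rw [b.repr_apply_apply, b.repr_apply_apply, inner_smul_right]
  have h1 := inner_wordUnitary_symm b i x ((wordEquiv i).symm (n, m))
  rw [Equiv.apply_symm_apply] at h1
  simp only at h1
  rw [h1, orthonormal_iff_ite.1 b.orthonormal]
  split_ifs with hm
  · subst hm
    rw [mul_one, ← wordEquiv_of_ne n.2, Equiv.symm_apply_apply]
  · rw [mul_zero]
    exact h _ (by rwa [Equiv.apply_symm_apply])

/-- A centred operator on the `i`-th copy prepends a nontrivial letter of type `i`. -/
theorem StartsOutside.wordRep {b : HilbertBasis M ℂ E} {i : ι}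
    {x : lp (fun _ : Word (fun _ : ι => M) => ℂ) 2} (h : StartsOutside i x) {T : E →L[ℂ] E}
    (hT : inner ℂ (b 1) (T (b 1)) = 0) : StartsInside i (wordRep b i T x) := by
  intro w hw
  rw [wordRep_apply, h.wordUnitary_symm, hw, map_smul, inner_smul_right, hT, mul_zero]

/-- The basis vector of the empty word. -/
noncomputable def emptyWordVector (M ι : Type*) [Monoid M] [DecidableEq M] [DecidableEq ι] :
    lp (fun _ : Word (fun _ : ι => M) => ℂ) 2 :=
  lp.single 2 Word.empty 1

theorem norm_emptyWordVector : ‖emptyWordVector M ι‖ = 1 := by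
  rw [emptyWordVector, lp.norm_single (by simp), norm_one]

theorem inner_emptyWordVector (x : lp (fun _ : Word (fun _ : ι => M) => ℂ) 2) :
    inner ℂ (emptyWordVector M ι) x = x Word.empty := by
  rw [emptyWordVector, lp.inner_single_left]
  simp

theorem startsOutside_emptyWordVector (i : ι) : StartsOutside i (emptyWordVector M ι) := by
  intro w hw
  rw [emptyWordVector, lp.single_apply, Pi.single_eq_of_ne]
  rintro rfl
  exact hw (by rw [wordEquiv_of_ne (fstIdx_empty_ne i)])

theorem StartsInside.apply_empty {i : ι} {x : lp (fun _ : Word (fun _ : ι => M) => ℂ) 2}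
    (h : StartsInside i x) : x Word.empty = 0 :=
  h _ (by rw [wordEquiv_of_ne (fstIdx_empty_ne i)])

theorem vectorState_wordRep (b : HilbertBasis M ℂ E) (i : ι) (T : E →L[ℂ] E) :
    vectorState (emptyWordVector M ι) (wordRep b i T) = inner ℂ (b 1) (T (b 1)) := by
  rw [vectorState_apply, inner_emptyWordVector, wordRep_apply,
    (startsOutside_emptyWordVector i).wordUnitary_symm, wordEquiv_of_ne (fstIdx_empty_ne i)]
  simp [emptyWordVector]

/-- Applied to the empty word, an alternating product of centred operators gives a vector supported
on the words that start with a letter of the type of its first factor. -/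
theorem areFree_wordRep (b : HilbertBasis M ℂ E) :
    AreFree (vectorState (emptyWordVector M ι))
      (fun i => (wordRep b i).toAlgHom.range) := by
  have key : ∀ (l : List (ι × _)) (p : ι × _),
      (p :: l).IsChain (fun x y => x.1 ≠ y.1) →
      (∀ x ∈ p :: l, x.2 ∈ (wordRep b x.1).toAlgHom.range ∧
        vectorState (emptyWordVector M ι) x.2 = 0) →
      StartsInside p.1 (((p :: l).map Prod.snd).prod (emptyWordVector M ι)) := by
    intro l
    induction l with
    | nil =>
      intro p _ hl
      obtain ⟨⟨T, hT⟩, h0⟩ := hl p (by simp)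
      have hT' : wordRep b p.1 T = p.2 := hT
      rw [← hT', vectorState_wordRep] at h0
      simp only [List.map_cons, List.map_nil, List.prod_cons, List.prod_nil, mul_one, ← hT']
      exact (startsOutside_emptyWordVector p.1).wordRep h0
    | cons q l ih =>
      intro p hc hl
      obtain ⟨⟨T, hT⟩, h0⟩ := hl p (by simp)
      have hT' : wordRep b p.1 T = p.2 := hT
      rw [← hT', vectorState_wordRep] at h0
      rw [List.isChain_cons_cons] at hc
      have h1 := ih q hc.2 (fun x hx => hl x (List.mem_cons_of_mem _ hx))
      rw [List.map_cons, List.prod_cons, mul_apply_eq_comp, ← hT']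
      exact (h1.startsOutside hc.1.symm).wordRep h0
  intro l hl hc hall
  cases l with
  | nil => exact absurd rfl hl
  | cons p l =>
    rw [vectorState_apply, inner_emptyWordVector]
    exact (key l p hc hall).apply_empty

end freeProduct

/-- The free product of two copies of a vector state on bounded operators. -/
theorem exists_free_representation {E : Type} [NormedAddCommGroup E] [InnerProductSpace ℂ E]
    [CompleteSpace E] {ξ : E} (hξ : ‖ξ‖ = 1) :
    ∃ (H : Type) (_ : NormedAddCommGroup H) (_ : InnerProductSpace ℂ H) (_ : CompleteSpace H)
      (Ω : H) (π : Fin 2 → (E →L[ℂ] E) →⋆ₐ[ℂ] (H →L[ℂ] H)), ‖Ω‖ = 1 ∧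
      (∀ i T, vectorState Ω (π i T) = inner ℂ ξ (T ξ)) ∧
      ∀ S T, AreFreeElements (vectorState Ω) (π 0 S) (π 1 T) := by
  classical
  have hs : Orthonormal ℂ ((↑) : ({ξ} : Set E) → E) := by
    rw [orthonormal_iff_ite]
    rintro ⟨x, rfl⟩ ⟨y, rfl⟩
    simp [hξ]
  -- A Hilbert basis containing `ξ`, made into a monoid with unit `ξ`.
  obtain ⟨w, b, hw, hb⟩ := hs.exists_hilbertBasis_extension
  let e : w := ⟨ξ, hw rfl⟩
  let _ : Monoid w := leftZeroMonoid e
  have h1 : b 1 = ξ := by rw [hb]; rfl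
  refine ⟨lp (fun _ : Monoid.CoprodI.Word (fun _ : Fin 2 => w) => ℂ) 2, inferInstance,
    inferInstance, inferInstance, emptyWordVector w (Fin 2), wordRep b, norm_emptyWordVector,
    fun i T => by rw [vectorState_wordRep, h1], ?_⟩
  intro S T
  have hfree := areFree_wordRep (ι := Fin 2) b
  have hle : ∀ i, (![Algebra.adjoin ℂ {wordRep b 0 S}, Algebra.adjoin ℂ {wordRep b 1 T}] :
      Fin 2 → Subalgebra ℂ _) i ≤ (wordRep b i).toAlgHom.range := by
    intro i
    fin_cases i
    · exact Algebra.adjoin_le (by rintro _ rfl; exact ⟨S, rfl⟩)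
    · exact Algebra.adjoin_le (by rintro _ rfl; exact ⟨T, rfl⟩)
  intro l hl hc hall
  exact hfree l hl hc fun x hx => ⟨hle _ (hall x hx).1, (hall x hx).2⟩

/-! ### Existence of free convolutions and free compressions -/

theorem exists_multiplication_operator {X : Type*} [MeasurableSpace X] (ρ : Measure X)
    [IsProbabilityMeasure ρ] {f : X → ℝ} (hf : Measurable f) {K : ℝ} (hK : ∀ x, |f x| ≤ K) :
    ∃ T : Lp ℂ 2 ρ →L[ℂ] Lp ℂ 2 ρ, ∀ g, T g =ᵐ[ρ] fun x => (f x : ℂ) * g x := by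
  have h : MemLp (fun x => (f x : ℂ)) ⊤ ρ :=
    memLp_top_of_bound (by fun_prop) K (Filter.Eventually.of_forall fun x => by
      simpa using hK x)
  refine ⟨(ContinuousLinearMap.mul ℂ ℂ).holderL ρ ⊤ 2 2 (h.toLp _), fun g => ?_⟩
  filter_upwards [(ContinuousLinearMap.mul ℂ ℂ).coeFn_holder (r := 2) (h.toLp _) g, h.coeFn_toLp]
    with x hx hx2
  change ((ContinuousLinearMap.mul ℂ ℂ).holder 2 (h.toLp _) g) x = _
  rw [hx, hx2]
  rfl

section multiplication

variable {X : Type*} [MeasurableSpace X] {ρ : Measure X} {f : X → ℝ}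
  {T : Lp ℂ 2 ρ →L[ℂ] Lp ℂ 2 ρ}

theorem isSelfAdjoint_of_multiplication (hT : ∀ g, T g =ᵐ[ρ] fun x => (f x : ℂ) * g x) :
    IsSelfAdjoint T := by
  rw [ContinuousLinearMap.isSelfAdjoint_iff_isSymmetric]
  intro g h
  change inner ℂ (T g) h = inner ℂ g (T h)
  rw [L2.inner_def, L2.inner_def]
  refine integral_congr_ae ?_
  filter_upwards [hT g, hT h] with x h1 h2
  simp only [h1, h2, RCLike.inner_apply, map_mul, Complex.conj_ofReal]
  ring

theorem mul_self_of_multiplication (hT : ∀ g, T g =ᵐ[ρ] fun x => (f x : ℂ) * g x)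
    (hf : ∀ x, f x * f x = f x) : T * T = T := by
  ext1 g
  apply Lp.ext
  rw [mul_apply_eq_comp]
  filter_upwards [hT (T g), hT g] with x h1 h2
  rw [h1, h2, ← mul_assoc, ← Complex.ofReal_mul, hf]

/-- The constant function `1` as a vector of `L²`. -/
noncomputable def oneVector (ρ : Measure X) [IsProbabilityMeasure ρ] : Lp ℂ 2 ρ :=
  (memLp_const (1 : ℂ)).toLp _

theorem inner_oneVector_pow [IsProbabilityMeasure ρ]
    (hT : ∀ g, T g =ᵐ[ρ] fun x => (f x : ℂ) * g x) (n : ℕ) :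
    inner ℂ (oneVector ρ) ((T ^ n) (oneVector ρ)) = ((∫ x, f x ^ n ∂ρ : ℝ) : ℂ) := by
  have h1 : ∀ n : ℕ, (T ^ n) (oneVector ρ) =ᵐ[ρ] fun x => (f x : ℂ) ^ n := by
    intro n
    induction n with
    | zero =>
      filter_upwards [(memLp_const (μ := ρ) (p := 2) (1 : ℂ)).coeFn_toLp] with x hx
      rw [pow_zero, pow_zero]
      exact hx
    | succ n ih =>
      rw [pow_succ', mul_apply_eq_comp]
      filter_upwards [hT ((T ^ n) (oneVector ρ)), ih] with x hx hx2
      rw [hx, hx2, pow_succ']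
  rw [L2.inner_def, ← integral_complex_ofReal]
  refine integral_congr_ae ?_
  filter_upwards [h1 n, (memLp_const (μ := ρ) (p := 2) (1 : ℂ)).coeFn_toLp] with x h1 h2
  have h3 : oneVector ρ x = 1 := h2
  rw [h1, h3]
  simp

theorem norm_oneVector [IsProbabilityMeasure ρ] : ‖oneVector ρ‖ = 1 := by
  rw [oneVector, Lp.norm_toLp, eLpNorm_const _ (by simp) (NeZero.ne ρ)]
  simp

end multiplication

/-- Two bounded random variables have free copies on a Hilbert space; a random variable with values
in `{0, 1}` becomes a projection. -/
theorem exists_free_copies {X : Type} [MeasurableSpace X] (ρ : Measure X) [IsProbabilityMeasure ρ]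
    {f g : X → ℝ} (hf : Measurable f) (hg : Measurable g) {K : ℝ} (hfK : ∀ x, |f x| ≤ K)
    (hgK : ∀ x, |g x| ≤ K) :
    ∃ (H : Type) (_ : NormedAddCommGroup H) (_ : InnerProductSpace ℂ H) (_ : CompleteSpace H)
      (Ω : H) (a b : H →L[ℂ] H), ‖Ω‖ = 1 ∧ IsSelfAdjoint a ∧ IsSelfAdjoint b ∧
      AreFreeElements (vectorState Ω) a b ∧
      (∀ n : ℕ, vectorState Ω (a ^ n) = ((∫ x, f x ^ n ∂ρ : ℝ) : ℂ)) ∧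
      (∀ n : ℕ, vectorState Ω (b ^ n) = ((∫ x, g x ^ n ∂ρ : ℝ) : ℂ)) ∧
      ((∀ x, g x * g x = g x) → b * b = b) := by
  obtain ⟨S, hS⟩ := exists_multiplication_operator ρ hf hfK
  obtain ⟨T, hT⟩ := exists_multiplication_operator ρ hg hgK
  obtain ⟨H, _, _, _, Ω, π, hΩ, hπ, hfree⟩ := exists_free_representation (norm_oneVector (ρ := ρ))
  refine ⟨H, inferInstance, inferInstance, inferInstance, Ω, π 0 S, π 1 T, hΩ,
    (isSelfAdjoint_of_multiplication hS).map _, (isSelfAdjoint_of_multiplication hT).map _,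
    hfree S T, fun n => ?_, fun n => ?_, fun h => ?_⟩
  · rw [← map_pow, hπ, inner_oneVector_pow hS]
  · rw [← map_pow, hπ, inner_oneVector_pow hT]
  · rw [← map_mul, mul_self_of_multiplication hT h]

/-- The truncation of `x` to `[-K, K]`. It makes the coordinate bounded everywhere, and not only
almost everywhere, without changing its law. -/
noncomputable def clamp (K x : ℝ) : ℝ := max (-K) (min K x)

theorem abs_clamp_le {K : ℝ} (hK : 0 ≤ K) (x : ℝ) : |clamp K x| ≤ K := by
  rw [abs_le, clamp]
  exact ⟨le_max_left _ _, max_le (by linarith) (min_le_left _ _)⟩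

theorem measurable_clamp (K : ℝ) : Measurable (clamp K) := by
  unfold clamp; fun_prop

theorem clamp_eq {K x : ℝ} (hx : x ∈ Set.Icc (-K) K) : clamp K x = x := by
  rw [clamp, min_eq_right hx.2, max_eq_right hx.1]

theorem IsCompactProb.exists_bound {μ : Measure ℝ} (h : IsCompactProb μ) :
    ∃ K : ℝ, 0 < K ∧ ∀ K', K ≤ K' → ∀ᵐ x ∂μ, x ∈ Set.Icc (-K') K' := by
  obtain ⟨_, K, hK⟩ := h
  refine ⟨max K 1, lt_max_of_lt_right one_pos, fun K' hK' => ?_⟩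
  have : ∀ᵐ x ∂μ, x ∈ Set.Icc (-K) K := by
    rw [ae_iff]; exact hK
  filter_upwards [this] with x hx
  have h1 := (le_max_left K 1).trans hK'
  exact ⟨by linarith [hx.1], hx.2.trans h1⟩

theorem integral_clamp_pow {μ : Measure ℝ} {K : ℝ} (h : ∀ᵐ x ∂μ, x ∈ Set.Icc (-K) K) (n : ℕ) :
    ∫ x, clamp K x ^ n ∂μ = ∫ x, x ^ n ∂μ := by
  refine integral_congr_ae ?_
  filter_upwards [h] with x hx
  rw [clamp_eq hx]

/-- A self-adjoint bounded operator has a compactly supported distribution in a vector state. -/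
theorem exists_hasMoments {H : Type*} [NormedAddCommGroup H] [InnerProductSpace ℂ H]
    [CompleteSpace H] {T : H →L[ℂ] H} (hT : IsSelfAdjoint T) {x : H} (hx : ‖x‖ = 1) :
    ∃ σ : Measure ℝ, HasMoments σ fun n => inner ℂ x ((T ^ n) x) := by
  obtain ⟨σ, hfin, hK, hσ⟩ := exists_spectral_measure hT x
  refine ⟨σ, ⟨⟨?_⟩, hK⟩, hσ⟩
  have h0 := hσ 0
  simp only [pow_zero, integral_const, smul_eq_mul, mul_one, one_apply_eq_self,
    inner_self_eq_norm_sq_to_K, hx] at h0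
  have h1 : σ.real Set.univ = 1 := by
    have : ((σ.real Set.univ : ℝ) : ℂ) = 1 := by rw [h0]; simp
    exact_mod_cast this
  rw [Measure.real] at h1
  rw [← ENNReal.ofReal_toReal (measure_ne_top σ Set.univ), h1, ENNReal.ofReal_one]

theorem exists_isFreeConv {μ ν : Measure ℝ} (hμ : IsCompactProb μ) (hν : IsCompactProb ν) :
    ∃ σ, IsFreeConv μ ν σ := by
  have hμ1 := hμ.1
  have hν1 := hν.1
  obtain ⟨K₁, hK₁, hb₁⟩ := hμ.exists_bound
  obtain ⟨K₂, hK₂, hb₂⟩ := hν.exists_bound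
  set K := max K₁ K₂ with hK
  have hK0 : 0 ≤ K := hK₁.le.trans (le_max_left _ _)
  obtain ⟨H, _, _, _, Ω, a, b, hΩ, ha, hb, hfree, hma, hmb, -⟩ :=
    exists_free_copies (μ.prod ν) (f := fun z => clamp K z.1) (g := fun z => clamp K z.2)
      ((measurable_clamp K).comp measurable_fst) ((measurable_clamp K).comp measurable_snd)
      (fun z => abs_clamp_le hK0 _) (fun z => abs_clamp_le hK0 _)
  obtain ⟨σ, hσ⟩ := exists_hasMoments (ha.add hb) hΩ
  refine ⟨σ, H →L[ℂ] H, inferInstance, inferInstance, inferInstance, inferInstance,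
    vectorState Ω, a, b, isStarState_vectorState hΩ, ha, hb, hfree, ⟨hμ, fun n => ?_⟩,
    ⟨hν, fun n => ?_⟩, hσ⟩
  · change _ = vectorState Ω (a ^ n)
    rw [hma, ← integral_clamp_pow (hb₁ K (le_max_left _ _)) n,
      integral_fun_fst (fun x => clamp K x ^ n)]
    simp
  · change _ = vectorState Ω (b ^ n)
    rw [hmb, ← integral_clamp_pow (hb₂ K (le_max_right _ _)) n,
      integral_fun_snd (fun x => clamp K x ^ n)]
    simp

theorem exists_isFreeCompression {μ : Measure ℝ} (hμ : IsCompactProb μ) {c : ℝ} (hc : 0 < c)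
    (hc1 : c ≤ 1) : ∃ ν, IsFreeCompression c μ ν := by
  have hμ1 := hμ.1
  obtain ⟨K₁, hK₁, hb₁⟩ := hμ.exists_bound
  set K := max K₁ 1 with hK
  have hK0 : 0 ≤ K := hK₁.le.trans (le_max_left _ _)
  -- The projection is modelled on a Bernoulli variable of parameter `c`.
  set β : Measure Bool := ENNReal.ofReal c • Measure.dirac true +
    ENNReal.ofReal (1 - c) • Measure.dirac false with hβ
  have hβ1 : IsProbabilityMeasure β := by
    constructor
    simp only [hβ, Measure.coe_add, Measure.coe_smul, Pi.add_apply, Pi.smul_apply, measure_univ,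
      smul_eq_mul, mul_one]
    rw [← ENNReal.ofReal_add hc.le (by linarith)]
    simp
  set g : Bool → ℝ := fun z => if z then 1 else 0 with hg
  obtain ⟨H, _, _, _, Ω, a, p, hΩ, ha, hp, hfree, hma, hmp, hpp⟩ :=
    exists_free_copies (μ.prod β) (f := fun z => clamp K z.1) (g := fun z => g z.2)
      ((measurable_clamp K).comp measurable_fst) (by fun_prop)
      (fun z => abs_clamp_le hK0 _)
      (fun z => by
        simp only [hg]
        split_ifs
        · rw [abs_one]; exact le_max_right K₁ 1
        · simpa using hK0)
  have hpp' : p * p = p := hpp fun z => by simp only [hg]; split_ifs <;> simp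
  have hφp : vectorState Ω p = (c : ℂ) := by
    have := hmp 1
    rw [pow_one] at this
    rw [this]
    congr 1
    simp only [pow_one]
    rw [integral_fun_snd (fun x => g x), hβ, integral_add_measure, integral_smul_measure,
      integral_smul_measure, integral_dirac, integral_dirac]
    · simp [hg, hc.le]
    · exact Integrable.of_finite.smul_measure (by simp)
    · exact Integrable.of_finite.smul_measure (by simp)
  have hadj : ∀ x y : H, inner ℂ (p x) y = inner ℂ x (p y) := fun x y =>
    (ContinuousLinearMap.isSelfAdjoint_iff_isSymmetric.1 hp) x y
  have hppx : ∀ x : H, p (p x) = p x := fun x => by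
    rw [← mul_apply_eq_comp, hpp']
  have hnorm : ‖p Ω‖ ^ 2 = c := by
    have h1 : inner ℂ (p Ω) (p Ω) = (c : ℂ) := by
      rw [hadj, hppx, ← hφp]; rfl
    rw [inner_self_eq_norm_sq_to_K] at h1
    apply Complex.ofReal_injective
    rw [← h1]
    simp
  -- The distribution in the compressed space is the one in the vector state of `p Ω / √c`.
  set x : H := ((Real.sqrt c)⁻¹ : ℂ) • p Ω with hx
  have hsq : (Real.sqrt c) ^ 2 = c := Real.sq_sqrt hc.le
  have hs0 : Real.sqrt c ≠ 0 := (Real.sqrt_pos.2 hc).ne'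
  have hx1 : ‖x‖ = 1 := by
    have h2 : ‖p Ω‖ = Real.sqrt c := by
      rw [← hnorm, Real.sqrt_sq (norm_nonneg _)]
    rw [hx, norm_smul, h2, norm_inv, Complex.norm_real, Real.norm_of_nonneg (Real.sqrt_nonneg _)]
    exact inv_mul_cancel₀ hs0
  have hT : IsSelfAdjoint (p * a * p) := by
    rw [IsSelfAdjoint, star_mul, star_mul, hp.star_eq, ha.star_eq, mul_assoc]
  obtain ⟨σ, hσ⟩ := exists_hasMoments hT hx1
  refine ⟨σ, H →L[ℂ] H, inferInstance, inferInstance, inferInstance, inferInstance,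
    vectorState Ω, a, p, isStarState_vectorState hΩ, ha, ⟨hpp', hp⟩, hφp, hfree,
    ⟨hμ, fun n => ?_⟩, hσ.1, fun n => ?_⟩
  · change _ = vectorState Ω (a ^ n)
    rw [hma, ← integral_clamp_pow (hb₁ K (le_max_left _ _)) n,
      integral_fun_fst (fun x => clamp K x ^ n), probReal_univ, one_smul]
  · rw [hσ.2 n]
    change inner ℂ x (((p * a * p) ^ n) x) = (c : ℂ)⁻¹ * vectorState Ω (p * (p * a * p) ^ n)
    have hcomm : p * (p * a * p) ^ n = p * (p * a * p) ^ n * p := by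
      have : Commute p (p * a * p) := by
        rw [Commute, SemiconjBy, mul_assoc (p * a) p p, hpp', ← mul_assoc, ← mul_assoc, hpp']
      rw [(this.pow_right n).eq, mul_assoc ((p * a * p) ^ n) p p, hpp']
    rw [hx, map_smul, inner_smul_left, inner_smul_right, hadj, vectorState_apply, hcomm]
    simp only [mul_apply_eq_comp, map_inv₀, Complex.conj_ofReal]
    rw [← mul_assoc, ← mul_inv, ← sq]
    congr 2
    exact_mod_cast hsq

/-! ### The semicircle distribution -/

/-- The sequence of free cumulants of the semicircle distribution. -/
def semicircleCumulant {R : Type*} [Zero R] (v : R) (n : ℕ) : R := if n = 2 then v else 0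

section

variable {R : Type*} [CommRing R] (v : R)

theorem ncMoment_semicircle_two (j n : ℕ) :
    ncMoment (semicircleCumulant v) (j + 2) (n + 1) = 0 := by
  induction n using Nat.strong_induction_on generalizing j with
  | _ n ih =>
    rw [ncMoment_succ, semicircleCumulant, if_neg (by omega), zero_mul, zero_add]
    refine Finset.sum_eq_zero fun i hi => ?_
    have hi' : i < n := by simpa using hi
    obtain ⟨k, hk⟩ : ∃ k, n - i = k + 1 := ⟨n - i - 1, by omega⟩
    rw [hk, show j + 2 + 1 = (j + 1) + 2 by ring, ih k (by omega), mul_zero]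

theorem ncMoment_semicircle_one (n : ℕ) :
    ncMoment (semicircleCumulant v) 1 (n + 1) = v * ncMoment (semicircleCumulant v) 0 n := by
  rw [ncMoment_succ, semicircleCumulant, if_pos rfl, Finset.sum_eq_zero, add_zero]
  intro i hi
  have hi' : i < n := by simpa using hi
  obtain ⟨k, hk⟩ : ∃ k, n - i = k + 1 := ⟨n - i - 1, by omega⟩
  rw [hk, ncMoment_semicircle_two v 0, mul_zero]

theorem ncMoment_semicircle_add_two (n : ℕ) :
    ncMoment (semicircleCumulant v) 0 (n + 2) = v * ∑ i ∈ Finset.range (n + 1),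
      ncMoment (semicircleCumulant v) 0 i * ncMoment (semicircleCumulant v) 0 (n - i) := by
  rw [ncMoment_succ, semicircleCumulant, if_neg (by omega), zero_mul, zero_add, Finset.mul_sum]
  refine Finset.sum_congr rfl fun i hi => ?_
  have hi' : i < n + 1 := by simpa using hi
  rw [show n + 1 - i = (n - i) + 1 by omega, zero_add, ncMoment_semicircle_one]
  ring

/-- The moments with cumulants `(0, v, 0, …)`: the recursion becomes that of the Catalan numbers. -/
theorem ncMoment_semicircle (k : ℕ) :
    ncMoment (semicircleCumulant v) 0 (2 * k) = catalan k * v ^ k ∧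
      ncMoment (semicircleCumulant v) 0 (2 * k + 1) = 0 := by
  induction k using Nat.strong_induction_on with
  | _ k ih =>
    cases k with
    | zero =>
      constructor
      · simp [ncMoment_zero]
      · rw [Nat.mul_zero, ncMoment_succ, semicircleCumulant]
        simp
    | succ k =>
      constructor
      · have hsum : ∀ (f : ℕ → R) (k : ℕ), ∑ i ∈ Finset.range (2 * k + 1), f i =
            ∑ j ∈ Finset.range (k + 1), f (2 * j) + ∑ j ∈ Finset.range k, f (2 * j + 1) := by
          intro f k
          induction k with
          | zero => simp
          | succ k ih =>
            rw [show 2 * (k + 1) + 1 = 2 * k + 1 + 1 + 1 by ring, Finset.sum_range_succ,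
              Finset.sum_range_succ, ih, Finset.sum_range_succ (fun j => f (2 * j)) (k + 1),
              Finset.sum_range_succ (fun j => f (2 * j + 1)) k,
              show 2 * (k + 1) = 2 * k + 1 + 1 by ring]
            ring
        rw [show 2 * (k + 1) = 2 * k + 2 by ring, ncMoment_semicircle_add_two, hsum]
        have h2 : ∑ j ∈ Finset.range k, ncMoment (semicircleCumulant v) 0 (2 * j + 1) *
            ncMoment (semicircleCumulant v) 0 (2 * k - (2 * j + 1)) = 0 := by
          refine Finset.sum_eq_zero fun j hj => ?_
          have hj' : j < k := by simpa using hj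
          rw [(ih j (by omega)).2, zero_mul]
        rw [h2, add_zero, catalan_succ', Finset.Nat.sum_antidiagonal_eq_sum_range_succ
          (fun i k => catalan i * catalan k), Finset.mul_sum, Nat.cast_sum, Finset.sum_mul]
        refine Finset.sum_congr rfl fun j hj => ?_
        have hj' : j < k + 1 := by simpa using hj
        rw [show 2 * k - 2 * j = 2 * (k - j) by omega, (ih j (by omega)).1,
          (ih (k - j) (by omega)).1]
        push_cast
        have : v ^ (k + 1) = v * (v ^ j * v ^ (k - j)) := by
          rw [← pow_add, ← pow_succ']; congr 1; omega
        rw [this]; ring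
      · rw [show 2 * (k + 1) + 1 = (2 * k + 1) + 2 by ring, ncMoment_semicircle_add_two,
          Finset.sum_eq_zero, mul_zero]
        intro i hi
        have hi' : i < 2 * k + 1 + 1 := by simpa using hi
        rcases Nat.even_or_odd' i with ⟨j, rfl | rfl⟩
        · rw [show 2 * k + 1 - 2 * j = 2 * (k - j) + 1 by omega, (ih (k - j) (by omega)).2,
            mul_zero]
        · rw [(ih j (by omega)).2, zero_mul]

end

theorem ncMoment_injective {κ₁ κ₂ : ℕ → ℂ} (h : ∀ n, ncMoment κ₁ 0 n = ncMoment κ₂ 0 n) {n : ℕ}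
    (hn : 1 ≤ n) : κ₁ n = κ₂ n := by
  have hN : momentSeries κ₁ = momentSeries κ₂ := by
    ext n; simp [momentSeries, h]
  have h1 : cumulantSeries κ₁ = cumulantSeries κ₂ := by
    refine eq_of_subst_eq (T := PowerSeries.X * momentSeries κ₁) (by simp)
      (coeff_one_X_mul_momentSeries κ₁) ?_
    rw [cumulantSeries_subst, hN, cumulantSeries_subst]
  have h2 := congrArg (PowerSeries.coeff n) h1
  simpa [cumulantSeries, show n ≠ 0 by omega] using h2

/-- The free cumulants are characterized by the free moment-cumulant formula. -/
theorem freeCumulant_eq_of_moments {μ : Measure ℝ} [IsProbabilityMeasure μ] {κ : ℕ → ℝ}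
    (h : ∀ n, ∫ x, x ^ n ∂μ = ncMoment κ 0 n) {n : ℕ} (hn : 1 ≤ n) : freeCumulant μ n = κ n := by
  have h1 : ((freeCumulant μ n : ℝ) : ℂ) = (κ n : ℂ) := by
    refine ncMoment_injective (κ₁ := fun n => (freeCumulant μ n : ℂ))
      (κ₂ := fun n => (κ n : ℂ)) ?_ hn
    intro n
    have e1 := map_ncMoment Complex.ofRealHom (freeCumulant μ) 0 n
    have e2 := map_ncMoment Complex.ofRealHom κ 0 n
    simp only [Complex.ofRealHom_eq_coe] at e1 e2
    rw [e1, e2, ← h n]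
    have := moment_eq_ncMoment (M := fun n => ∫ x, x ^ n ∂μ) (by simp) n
    rw [this]
    rfl
  exact_mod_cast h1

/-- The integrals `∫ x ^ n √(r² - x²) dx` over `[-r, r]`. -/
noncomputable def semicircleIntegral (r : ℝ) (n : ℕ) : ℝ :=
  ∫ x in (-r)..r, x ^ n * √(r ^ 2 - x ^ 2)

theorem semicircleIntegral_zero {r : ℝ} (hr : 0 < r) :
    semicircleIntegral r 0 = Real.pi * r ^ 2 / 2 := by
  have h1 := intervalIntegral.integral_comp_mul_left (a := -1) (b := 1)
    (fun x => √(r ^ 2 - x ^ 2)) hr.ne'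
  have h2 : ∀ x : ℝ, √(r ^ 2 - (r * x) ^ 2) = r * √(1 - x ^ 2) := by
    intro x
    rw [show r ^ 2 - (r * x) ^ 2 = r ^ 2 * (1 - x ^ 2) by ring, Real.sqrt_mul (sq_nonneg r),
      Real.sqrt_sq hr.le]
  simp only [h2] at h1
  rw [intervalIntegral.integral_const_mul, integral_sqrt_one_sub_sq] at h1
  simp only [semicircleIntegral, pow_zero, one_mul]
  rw [mul_neg, mul_one, smul_eq_mul] at h1
  field_simp at h1
  linarith

theorem semicircleIntegral_odd (r : ℝ) (k : ℕ) : semicircleIntegral r (2 * k + 1) = 0 := by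
  have h := intervalIntegral.integral_comp_neg (a := -r) (b := r)
    (fun x => x ^ (2 * k + 1) * √(r ^ 2 - x ^ 2))
  simp only [neg_sq, neg_neg, Odd.neg_pow (odd_two_mul_add_one k), neg_mul,
    intervalIntegral.integral_neg] at h
  rw [semicircleIntegral]
  linarith

/-- Integration of the derivative of `x ^ (n + 1) (r² - x²) ^ (3 / 2)`. -/
theorem semicircleIntegral_add_two {r : ℝ} (hr : 0 < r) (n : ℕ) :
    (n + 4) * semicircleIntegral r (n + 2) = (n + 1) * r ^ 2 * semicircleIntegral r n := by
  have h := intervalIntegral.integral_eq_sub_of_hasDerivAt_of_le (a := -r) (b := r)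
    (f := fun x => x ^ (n + 1) * ((r ^ 2 - x ^ 2) * √(r ^ 2 - x ^ 2)))
    (f' := fun x => (n + 1) * r ^ 2 * (x ^ n * √(r ^ 2 - x ^ 2)) -
      (n + 4) * (x ^ (n + 2) * √(r ^ 2 - x ^ 2))) (by linarith) (by fun_prop) (by
      intro x hx
      have hpos : 0 < r ^ 2 - x ^ 2 := by nlinarith [hx.1, hx.2]
      have h1 : HasDerivAt (fun x : ℝ => r ^ 2 - x ^ 2) (-(2 * x)) x := by
        simpa using ((hasDerivAt_pow 2 x).const_sub (r ^ 2))
      have h2 := (hasDerivAt_pow (n + 1) x).mul (h1.mul (h1.sqrt hpos.ne'))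
      refine h2.congr_deriv ?_
      have hs : √(r ^ 2 - x ^ 2) ^ 2 = r ^ 2 - x ^ 2 := Real.sq_sqrt hpos.le
      have hs0 : √(r ^ 2 - x ^ 2) ≠ 0 := (Real.sqrt_pos.2 hpos).ne'
      set s := √(r ^ 2 - x ^ 2) with hsdef
      have h3 : (r ^ 2 - x ^ 2) * (-(2 * x) / (2 * s)) = - x * s := by
        rw [← hs]; field_simp
      rw [h3]
      simp only [Pi.mul_apply, ← hsdef, Nat.add_sub_cancel]
      push_cast
      ring) (by
      apply Continuous.intervalIntegrable
      fun_prop)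
  rw [intervalIntegral.integral_sub, intervalIntegral.integral_const_mul,
    intervalIntegral.integral_const_mul] at h
  · simp only [neg_sq, sub_self, zero_mul, mul_zero] at h
    simp only [semicircleIntegral]
    linarith
  · apply Continuous.intervalIntegrable; fun_prop
  · apply Continuous.intervalIntegrable; fun_prop

theorem semicircleIntegral_even {r : ℝ} (hr : 0 < r) (k : ℕ) :
    semicircleIntegral r (2 * k) = catalan k * (r ^ 2 / 4) ^ k * (Real.pi * r ^ 2 / 2) := by
  induction k with
  | zero => simp [semicircleIntegral_zero hr]
  | succ k ih =>
    have h1 := semicircleIntegral_add_two hr (2 * k)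
    rw [ih] at h1
    have h2 : ((k : ℝ) + 2) * catalan (k + 1) = 2 * (2 * k + 1) * catalan k := by
      have e1 := Nat.succ_mul_centralBinom_succ k
      have e2 := succ_mul_catalan_eq_centralBinom k
      have e3 := succ_mul_catalan_eq_centralBinom (k + 1)
      rw [← e2, ← e3] at e1
      have e4 : (k + 1) * ((k + 2) * catalan (k + 1)) =
          (k + 1) * (2 * (2 * k + 1) * catalan k) := by
        rw [show k + 2 = k + 1 + 1 by ring, e1]; ring
      have e5 := Nat.eq_of_mul_eq_mul_left (Nat.succ_pos k) e4
      exact_mod_cast e5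
    rw [show 2 * (k + 1) = 2 * k + 2 by ring]
    push_cast at h1
    have h3 : (2 * (k : ℝ) + 4) ≠ 0 := by positivity
    apply mul_left_cancel₀ h3
    rw [h1, pow_succ]
    linear_combination (-(2 : ℝ)) * (r ^ 2 / 4) ^ k * (r ^ 2 / 4) * (Real.pi * r ^ 2 / 2) * h2

section semicircle

variable {v : ℝ}

theorem semicircle_density_eq_zero (hv : 0 < v) {x : ℝ} (hx : x ∉ Set.Ioc (-(2 * √v)) (2 * √v)) :
    √(4 * v - x ^ 2) / (2 * Real.pi * v) = 0 := by
  have hs : √v ^ 2 = v := Real.sq_sqrt hv.le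
  have hs0 := Real.sqrt_nonneg v
  rw [Real.sqrt_eq_zero_of_nonpos, zero_div]
  rw [Set.mem_Ioc, not_and_or, not_lt, not_le] at hx
  rcases hx with hx | hx <;> nlinarith

theorem integral_semicircle_density (hv : 0 < v) (n : ℕ) :
    ∫ x, (√(4 * v - x ^ 2) / (2 * Real.pi * v)) * x ^ n = ncMoment (semicircleCumulant v) 0 n := by
  have hs : √v ^ 2 = v := Real.sq_sqrt hv.le
  have hs0 := Real.sqrt_pos.2 hv
  have h1 : ∫ x, (√(4 * v - x ^ 2) / (2 * Real.pi * v)) * x ^ n =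
      (2 * Real.pi * v)⁻¹ * semicircleIntegral (2 * √v) n := by
    rw [← setIntegral_eq_integral_of_forall_compl_eq_zero
      (s := Set.Ioc (-(2 * √v)) (2 * √v)) (fun x hx => by
        rw [semicircle_density_eq_zero hv hx, zero_mul]),
      ← intervalIntegral.integral_of_le (by linarith), semicircleIntegral,
      ← intervalIntegral.integral_const_mul]
    congr 1
    ext x
    rw [mul_pow, hs]
    norm_num
    ring
  rw [h1]
  have h4 : (2 * √v) ^ 2 = 4 * v := by rw [mul_pow, hs]; norm_num
  rcases Nat.even_or_odd' n with ⟨k, rfl | rfl⟩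
  · rw [(ncMoment_semicircle v k).1, semicircleIntegral_even (by positivity), h4]
    have := Real.pi_pos.ne'
    field_simp
    norm_num
    ring
  · rw [(ncMoment_semicircle v k).2, semicircleIntegral_odd, mul_zero]

theorem integral_semicircle (hv : 0 < v) (n : ℕ) :
    ∫ x, x ^ n ∂(semicircle v) = ncMoment (semicircleCumulant v) 0 n := by
  rw [← integral_semicircle_density hv, semicircle, integral_withDensity_eq_integral_toReal_smul]
  · refine integral_congr_ae (Filter.Eventually.of_forall fun x => ?_)
    simp only [smul_eq_mul]
    rw [ENNReal.toReal_ofReal]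
    have := Real.pi_pos
    positivity
  · fun_prop
  · simp

theorem isCompactProb_semicircle (hv : 0 < v) : IsCompactProb (semicircle v) := by
  have hint : Integrable fun x : ℝ => √(4 * v - x ^ 2) / (2 * Real.pi * v) := by
    apply Continuous.integrable_of_hasCompactSupport (by fun_prop)
    refine HasCompactSupport.intro (isCompact_Icc (a := -(2 * √v)) (b := 2 * √v)) fun x hx => ?_
    exact semicircle_density_eq_zero hv fun h => hx (Set.Ioc_subset_Icc_self h)
  constructor
  · constructor
    have h0 := integral_semicircle_density hv 0
    simp only [pow_zero, mul_one, ncMoment_zero] at h0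
    rw [semicircle, withDensity_apply _ MeasurableSet.univ, setLIntegral_univ,
      ← ofReal_integral_eq_lintegral_ofReal hint, h0, ENNReal.ofReal_one]
    have := Real.pi_pos
    exact Filter.Eventually.of_forall fun x => by positivity
  · refine ⟨2 * √v, ?_⟩
    rw [semicircle, withDensity_apply _ measurableSet_Icc.compl]
    refine (setLIntegral_congr_fun measurableSet_Icc.compl (g := fun _ => 0) fun x hx => ?_).trans
      (by simp)
    rw [semicircle_density_eq_zero hv fun h => hx (Set.Ioc_subset_Icc_self h)]
    simp

theorem freeCumulant_semicircle (hv : 0 < v) {n : ℕ} (hn : 1 ≤ n) :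
    freeCumulant (semicircle v) n = semicircleCumulant v n := by
  have := (isCompactProb_semicircle hv).1
  exact freeCumulant_eq_of_moments (integral_semicircle hv) hn

end semicircle

/-! ### Taylor series of analytic functions -/

section taylor

open PowerSeries Filter Topology

/-- The Taylor series at `0` of a function of a complex variable. -/
noncomputable def taylorSeries (f : ℂ → ℂ) : ℂ⟦X⟧ :=
  PowerSeries.mk fun n => iteratedDeriv n f 0 / n.factorial

theorem taylorSeries_congr {f g : ℂ → ℂ} (h : f =ᶠ[𝓝 0] g) : taylorSeries f = taylorSeries g := by
  ext n
  simp only [taylorSeries, coeff_mk, h.iteratedDeriv_eq n]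

theorem taylorSeries_mul {f g : ℂ → ℂ} (hf : AnalyticAt ℂ f 0) (hg : AnalyticAt ℂ g 0) :
    taylorSeries (fun z => f z * g z) = taylorSeries f * taylorSeries g := by
  ext n
  simp only [taylorSeries, coeff_mk, coeff_mul, iteratedDeriv_fun_mul hf.contDiffAt hg.contDiffAt,
    Finset.Nat.sum_antidiagonal_eq_sum_range_succ_mk, Nat.succ_eq_add_one, Finset.sum_div]
  refine Finset.sum_congr rfl fun i hi ↦ ?_
  rw [Nat.cast_choose _ (Nat.lt_succ_iff.1 (Finset.mem_range.1 hi))]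
  field_simp [Nat.factorial_ne_zero]

theorem taylorSeries_add {f g : ℂ → ℂ} (hf : AnalyticAt ℂ f 0) (hg : AnalyticAt ℂ g 0) :
    taylorSeries (fun z => f z + g z) = taylorSeries f + taylorSeries g := by
  ext n
  simp only [taylorSeries, coeff_mk, map_add, iteratedDeriv_fun_add hf.contDiffAt hg.contDiffAt,
    add_div]

theorem analyticAt_fun_id (z : ℂ) : AnalyticAt ℂ (fun z : ℂ => z) z := analyticAt_id

theorem taylorSeries_const (c : ℂ) : taylorSeries (fun _ => c) = C c := by
  ext n
  simp only [taylorSeries, coeff_mk, coeff_C, iteratedDeriv_const]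
  split_ifs with h <;> simp [h]

theorem taylorSeries_id : taylorSeries (fun z => z) = X := by
  ext n
  simp only [taylorSeries, coeff_mk, coeff_X, iteratedDeriv_fun_id_zero]
  split_ifs with h <;> simp [h]

theorem constantCoeff_taylorSeries (f : ℂ → ℂ) : constantCoeff (taylorSeries f) = f 0 := by
  rw [← coeff_zero_eq_constantCoeff_apply]
  simp [taylorSeries]

theorem eventually_hasSum_taylorSeries {f : ℂ → ℂ} (hf : AnalyticAt ℂ f 0) :
    ∀ᶠ w in 𝓝 0, HasSum (fun n => coeff n (taylorSeries f) * w ^ n) (f w) := by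
  filter_upwards [hf.hasFPowerSeriesAt.eventually_hasSum] with w hw
  rw [zero_add] at hw
  have e : (fun n => coeff n (taylorSeries f) * w ^ n) = fun n =>
      (FormalMultilinearSeries.ofScalars ℂ (fun n => iteratedDeriv n f 0 / n.factorial) n)
        fun _ => w := by
    ext n
    rw [FormalMultilinearSeries.ofScalars_apply_eq]
    simp [taylorSeries]
  rw [e]
  exact hw

theorem exists_norm_coeff_taylorSeries_le {f : ℂ → ℂ} (hf : AnalyticAt ℂ f 0) :
    ∃ D : ℝ, 0 < D ∧ ∀ n, 1 ≤ n → ‖coeff n (taylorSeries f)‖ ≤ D ^ n := by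
  obtain ⟨A, r, hA, hr, h⟩ :=
    FormalMultilinearSeries.le_mul_pow_of_radius_pos _ hf.hasFPowerSeriesAt.radius_pos
  refine ⟨max A 1 * r, by positivity, fun n hn => ?_⟩
  have h1 := h n
  rw [FormalMultilinearSeries.ofScalars_norm] at h1
  simp only [taylorSeries, coeff_mk]
  refine h1.trans ?_
  rw [mul_pow]
  gcongr
  exact (le_max_left A 1).trans (le_self_pow₀ (le_max_right A 1) (by omega))

/-- A function that is the sum of a power series on a disc is analytic, with that Taylor series. -/
theorem analyticAt_of_hasSum {f : ℂ → ℂ} {a : ℕ → ℂ} {r : ℝ} (hr : 0 < r)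
    (h : ∀ u, ‖u‖ < r → HasSum (fun n => a n * u ^ n) (f u)) :
    AnalyticAt ℂ f 0 ∧ taylorSeries f = PowerSeries.mk a := by
  have hp : HasFPowerSeriesAt f (FormalMultilinearSeries.ofScalars ℂ a) 0 := by
    have hr2 : ‖((r / 2 : ℝ) : ℂ)‖ = r / 2 := by
      rw [Complex.norm_real, Real.norm_of_nonneg (by positivity)]
    have hrad : ENNReal.ofReal (r / 2) ≤ (FormalMultilinearSeries.ofScalars ℂ a).radius := by
      have h1 := (h ((r / 2 : ℝ) : ℂ) (by rw [hr2]; linarith)).summable.norm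
      refine FormalMultilinearSeries.le_radius_of_summable _ ?_
      simpa [FormalMultilinearSeries.ofScalars_norm, norm_mul, norm_pow, abs_of_pos hr,
        Real.coe_toNNReal _ (show (0 : ℝ) ≤ r / 2 by positivity)] using h1
    refine ⟨ENNReal.ofReal (r / 2), hrad, by simpa using hr, fun {y} hy => ?_⟩
    have hy' : ‖y‖ < r := by
      rw [Metric.eball_ofReal, Metric.mem_ball, dist_zero_right] at hy
      linarith
    rw [zero_add]
    have e : (fun n => (FormalMultilinearSeries.ofScalars ℂ a n) fun _ => y) =
        fun n => a n * y ^ n := by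
      ext n
      rw [FormalMultilinearSeries.ofScalars_apply_eq]
      simp
    rw [e]
    exact h y hy'
  have ha : AnalyticAt ℂ f 0 := ⟨_, hp⟩
  refine ⟨ha, ?_⟩
  have := FormalMultilinearSeries.ofScalars_series_injective ℂ ℂ
    (ha.hasFPowerSeriesAt.eq_formalMultilinearSeries hp)
  ext n
  simp only [taylorSeries, coeff_mk]
  exact congrFun this n

/-- Write `f(z) = f(0) + z f₁(z)`. Both sides are `f(0)` plus the Taylor series of `g`, which has no
constant term, times the corresponding side for `f₁`; so the coefficients agree by induction. -/
theorem taylorSeries_comp {f g : ℂ → ℂ} (hf : AnalyticAt ℂ f 0) (hg : AnalyticAt ℂ g 0)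
    (hg0 : g 0 = 0) :
    taylorSeries (fun z => f (g z)) = (taylorSeries f).subst (taylorSeries g) := by
  have hT0 : constantCoeff (taylorSeries g) = 0 := by rw [constantCoeff_taylorSeries, hg0]
  have hT : HasSubst (taylorSeries g) := HasSubst.of_constantCoeff_zero' hT0
  obtain ⟨T, hTT⟩ : ∃ T, taylorSeries g = X * T := X_dvd_iff.2 hT0
  have hslope : ∀ f : ℂ → ℂ, AnalyticAt ℂ f 0 → AnalyticAt ℂ (dslope f 0) 0 := fun f hf =>
    ⟨_, hf.hasFPowerSeriesAt.has_fpower_series_dslope_fslope⟩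
  have hdec : ∀ (f : ℂ → ℂ) (z : ℂ), f z = f 0 + z * dslope f 0 z := fun f z => by
    have := sub_smul_dslope f 0 z
    rw [sub_zero, smul_eq_mul] at this
    rw [this]; ring
  have hcomp : ∀ f : ℂ → ℂ, AnalyticAt ℂ f 0 → AnalyticAt ℂ (fun z => f (g z)) 0 := fun f hf =>
    AnalyticAt.comp (by rwa [hg0]) hg
  ext n
  induction n using Nat.strong_induction_on generalizing f with
  | _ n ih =>
    have h1 : taylorSeries (fun z => f (g z)) =
        C (f 0) + taylorSeries g * taylorSeries (fun z => dslope f 0 (g z)) := by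
      conv_lhs => rw [funext fun z => hdec f (g z)]
      rw [taylorSeries_add analyticAt_const (hg.fun_mul (hcomp _ (hslope f hf))),
        taylorSeries_mul hg (hcomp _ (hslope f hf)), taylorSeries_const]
    have h2 : (taylorSeries f).subst (taylorSeries g) =
        C (f 0) + taylorSeries g * (taylorSeries (dslope f 0)).subst (taylorSeries g) := by
      have : taylorSeries f = C (f 0) + X * taylorSeries (dslope f 0) := by
        conv_lhs => rw [funext fun z => hdec f z]
        rw [taylorSeries_add analyticAt_const ((analyticAt_fun_id 0).fun_mul (hslope f hf)),
          taylorSeries_mul (analyticAt_fun_id 0) (hslope f hf), taylorSeries_const, taylorSeries_id]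
      rw [this, subst_add hT, subst_mul hT, subst_X hT, subst_C]
      rfl
    rw [h1, h2, map_add, map_add]
    congr 1
    rw [hTT, mul_assoc, mul_assoc]
    cases n with
    | zero => simp
    | succ n =>
      rw [coeff_succ_X_mul, coeff_succ_X_mul, coeff_mul, coeff_mul]
      refine Finset.sum_congr rfl fun p hp => ?_
      rw [Finset.HasAntidiagonal.mem_antidiagonal] at hp
      rw [ih p.2 (by omega) (hslope f hf), hTT]

end taylor

/-! ### The analytic cumulant function -/

section stieltjes

open Filter Topology PowerSeries

variable {μ : Measure ℝ}

/-- The generating function `∑ u ^ n ∫ x ^ n μ(dx)` of the moments, as an integral. -/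
noncomputable def momentFunction (μ : Measure ℝ) (u : ℂ) : ℂ := ∫ x : ℝ, (1 - u * x)⁻¹ ∂μ

theorem stieltjesTransform_inv (μ : Measure ℝ) {u : ℂ} (hu : u ≠ 0) :
    stieltjesTransform μ u⁻¹ = u * momentFunction μ u := by
  rw [stieltjesTransform, momentFunction, ← integral_const_mul]
  congr 1
  ext x
  have : u⁻¹ - (x : ℂ) = u⁻¹ * (1 - u * x) := by field_simp
  rw [this, mul_inv, inv_inv]

theorem hasSum_momentFunction [IsProbabilityMeasure μ] {K : ℝ} (hK : 0 < K)
    (hμ : ∀ᵐ x ∂μ, x ∈ Set.Icc (-K) K) {u : ℂ} (hu : ‖u‖ < K⁻¹) :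
    HasSum (fun n => ((∫ x, x ^ n ∂μ : ℝ) : ℂ) * u ^ n) (momentFunction μ u) := by
  have h1 : ‖u‖ * K < 1 := by
    rwa [← lt_div_iff₀ hK, one_div]
  have h0 : 0 ≤ ‖u‖ * K := by positivity
  have h := hasSum_integral_of_dominated_convergence (μ := μ)
    (F := fun n (x : ℝ) => (u * x) ^ n) (f := fun x : ℝ => (1 - u * x)⁻¹)
    (fun n _ => (‖u‖ * K) ^ n) (fun n => by fun_prop) (fun n => ?_) ?_ ?_ ?_
  · have e : (fun n => ((∫ x, x ^ n ∂μ : ℝ) : ℂ) * u ^ n) =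
        fun n => ∫ x : ℝ, (u * x) ^ n ∂μ := by
      ext n
      simp only [mul_pow]
      rw [integral_const_mul, mul_comm, ← integral_complex_ofReal]
      simp
    rw [e]
    exact h
  · filter_upwards [hμ] with x hx
    rw [norm_pow, norm_mul, Complex.norm_real]
    gcongr
    exact abs_le.2 hx
  · exact Eventually.of_forall fun _ => summable_geometric_of_lt_one h0 h1
  · exact integrable_const _
  · filter_upwards [hμ] with x hx
    refine hasSum_geometric_of_norm_lt_one ?_
    rw [norm_mul, Complex.norm_real]
    refine lt_of_le_of_lt ?_ h1
    gcongr
    exact abs_le.2 hx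

/-- The cumulant series `C` is the Taylor series of `M ∘ h`, where `h` is the local inverse of
`u ↦ u M(u) = G(u⁻¹)`. Hence `C(w) / w` inverts the Stieltjes transform `G` near infinity; the
variable `u = z⁻¹` is used for points `z` near infinity. -/
theorem exists_cumulantFunction (hμ : IsCompactProb μ) :
    ∃ C : ℂ → ℂ, AnalyticAt ℂ C 0 ∧
      taylorSeries C = cumulantSeries (fun n => (freeCumulant μ n : ℂ)) ∧
      (∀ᶠ w in 𝓝[≠] 0, stieltjesTransform μ (C w / w) = w) ∧
      (∀ᶠ u in 𝓝[≠] 0, C (stieltjesTransform μ u⁻¹) = u⁻¹ * stieltjesTransform μ u⁻¹) ∧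
      Tendsto (fun u => stieltjesTransform μ u⁻¹) (𝓝[≠] 0) (𝓝[≠] 0) := by
  have := hμ.1
  obtain ⟨K, hK, hKμ⟩ := hμ.exists_bound
  obtain ⟨hM, hMT⟩ := analyticAt_of_hasSum (inv_pos.2 hK)
    (fun u hu => hasSum_momentFunction hK (hKμ K le_rfl) hu)
  set M := momentFunction μ with hMdef
  have hM0 : M 0 = 1 := by simp [hMdef, momentFunction]
  have hg : AnalyticAt ℂ (fun u => u * M u) 0 := analyticAt_id.mul hM
  set g : ℂ → ℂ := fun u => u * M u with hgdef
  have hg0 : g 0 = 0 := by simp [hgdef]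
  have hd : HasDerivAt g 1 0 := by
    refine ((hasDerivAt_id (0 : ℂ)).fun_mul hM.differentiableAt.hasDerivAt).congr_deriv ?_
    simp [hM0]
  have hd0 : deriv g 0 ≠ 0 := by rw [hd.deriv]; exact one_ne_zero
  have hh := hg.analyticAt_localInverse hd0
  have hgh := hg.hasStrictDerivAt.eventually_right_inverse hd0
  have hhg := HasStrictFDerivAt.eventually_left_inverse
    (hg.hasStrictDerivAt.hasStrictFDerivAt_equiv hd0)
  set h : ℂ → ℂ := hg.hasStrictDerivAt.localInverse _ _ _ hd0 with hhdef
  rw [hg0] at hh hgh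
  replace hhg : ∀ᶠ u in 𝓝 0, h (g u) = u := hhg
  have hh0 : h 0 = 0 := by simpa [hg0] using hhg.self_of_nhds
  have hC : AnalyticAt ℂ (fun w => M (h w)) 0 :=
    AnalyticAt.comp (g := M) (by rwa [hh0]) hh
  have hgne : ∀ᶠ u in 𝓝[≠] (0 : ℂ), g u ≠ 0 := by
    filter_upwards [self_mem_nhdsWithin, nhdsWithin_le_nhds hhg] with u hu hu' hgu
    rw [hgu, hh0] at hu'
    exact hu hu'.symm
  have hgt : Tendsto g (𝓝[≠] 0) (𝓝[≠] 0) := by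
    refine tendsto_nhdsWithin_iff.2 ⟨?_, hgne⟩
    have := hg.continuousAt.tendsto
    rw [hg0] at this
    exact this.mono_left nhdsWithin_le_nhds
  have hGg : (fun u => stieltjesTransform μ u⁻¹) =ᶠ[𝓝[≠] 0] g := by
    filter_upwards [self_mem_nhdsWithin] with u hu
    exact stieltjesTransform_inv μ hu
  refine ⟨fun w => M (h w), hC, ?_, ?_, ?_, hgt.congr' hGg.symm⟩
  · have hN : taylorSeries M = momentSeries (fun n => (freeCumulant μ n : ℂ)) := by
      rw [hMT]
      ext n
      simp only [momentSeries, coeff_mk]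
      have e1 := map_ncMoment Complex.ofRealHom (freeCumulant μ) 0 n
      simp only [Complex.ofRealHom_eq_coe] at e1
      rw [e1, moment_eq_ncMoment (M := fun n => ∫ x, x ^ n ∂μ) (by simp) n]
      rfl
    have hTg : taylorSeries g = X * momentSeries (fun n => (freeCumulant μ n : ℂ)) := by
      rw [← hN, hgdef, taylorSeries_mul (analyticAt_fun_id 0) hM, taylorSeries_id]
    refine eq_of_subst_eq (T := taylorSeries g) ?_ ?_ ?_
    · rw [constantCoeff_taylorSeries, hg0]
    · rw [hTg, coeff_one_X_mul_momentSeries]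
    · rw [← taylorSeries_comp hC hg hg0, hTg, cumulantSeries_subst, ← hN]
      refine taylorSeries_congr ?_
      filter_upwards [hhg] with u hu
      rw [hu]
  · filter_upwards [nhdsWithin_le_nhds hgh, self_mem_nhdsWithin] with w hw hw0
    have hhw : h w ≠ 0 := fun h0 => by
      rw [h0, hg0] at hw
      exact hw0 hw.symm
    have hMw : M (h w) / w = (h w)⁻¹ := by
      have : h w * M (h w) = w := hw
      rwa [div_eq_iff hw0, eq_inv_mul_iff_mul_eq₀ hhw]
    rw [hMw, stieltjesTransform_inv μ hhw]
    exact hw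
  · filter_upwards [nhdsWithin_le_nhds hhg, self_mem_nhdsWithin, hGg] with u hu hu0 hGu
    rw [hGu]
    simp only [hu]
    have : u ≠ 0 := hu0
    simp only [hgdef]
    field_simp

end stieltjes

/-! ### The free cumulants of the evolved law -/

/-- The free cumulants of a compactly supported law grow at most geometrically. -/
theorem IsCompactProb.exists_abs_freeCumulant_le {μ : Measure ℝ} (hμ : IsCompactProb μ) :
    ∃ D : ℝ, 0 < D ∧ ∀ n, 1 ≤ n → |freeCumulant μ n| ≤ D ^ n := by
  obtain ⟨C, hC, hCT, -⟩ := exists_cumulantFunction hμ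
  obtain ⟨D, hD, h⟩ := exists_norm_coeff_taylorSeries_le hC
  refine ⟨D, hD, fun n hn => ?_⟩
  have := h n hn
  rwa [hCT, cumulantSeries, PowerSeries.coeff_mk, if_neg (by omega), Complex.norm_real,
    Real.norm_eq_abs] at this

theorem isCompactProb_dirac_zero : IsCompactProb (Measure.dirac (0 : ℝ)) :=
  ⟨inferInstance, 0, by simp⟩

theorem freeCumulant_dirac_zero {n : ℕ} (hn : 1 ≤ n) :
    freeCumulant (Measure.dirac (0 : ℝ)) n = 0 := by
  rw [freeCumulant_eq_of_moments (κ := semicircleCumulant 0) _ hn]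
  · simp [semicircleCumulant]
  · intro n
    rw [integral_dirac]
    rcases Nat.even_or_odd' n with ⟨k, rfl | rfl⟩
    · rw [(ncMoment_semicircle (0 : ℝ) k).1]
      cases k <;> simp
    · rw [(ncMoment_semicircle (0 : ℝ) k).2]
      simp

theorem isFreeConv_freeConv {μ ν : Measure ℝ} (hμ : IsCompactProb μ) (hν : IsCompactProb ν) :
    IsFreeConv μ ν (freeConv μ ν) := by
  have h := exists_isFreeConv hμ hν
  rw [freeConv, dif_pos h]
  exact h.choose_spec

theorem isFreeCompression_freeCompression {μ : Measure ℝ} (hμ : IsCompactProb μ) {c : ℝ}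
    (hc : 0 < c) (hc1 : c ≤ 1) : IsFreeCompression c μ (freeCompression μ c) := by
  have h := exists_isFreeCompression hμ hc hc1
  rw [freeCompression, if_neg hc.ne', dif_pos h]
  exact h.choose_spec

theorem IsFreeConv.isCompactProb {μ ν σ : Measure ℝ} (h : IsFreeConv μ ν σ) : IsCompactProb σ := by
  obtain ⟨A, _, _, _, _, φ, a, b, -, -, -, -, -, -, hσ⟩ := h
  exact hσ.1

theorem IsFreeCompression.isCompactProb {μ ν : Measure ℝ} {c : ℝ} (h : IsFreeCompression c μ ν) :
    IsCompactProb ν := by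
  obtain ⟨A, _, _, _, _, φ, a, p, -, -, -, -, -, -, hν⟩ := h
  exact hν.1

/-- For `c = 0` the compression is by definition the point mass at the mean, which is `0`. -/
theorem freeCompression_semicircle {v : ℝ} (hv : 0 < v) {c : ℝ} (hc : 0 ≤ c) (hc1 : c ≤ 1) :
    IsCompactProb (freeCompression (semicircle v) c) ∧ ∀ n, 1 ≤ n →
      freeCumulant (freeCompression (semicircle v) c) n = c ^ (n - 1) * semicircleCumulant v n := by
  rcases hc.eq_or_lt with rfl | hc
  · have h0 : ∫ x, x ∂(semicircle v) = 0 := by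
      have := integral_semicircle hv 1
      rw [show (1 : ℕ) = 2 * 0 + 1 by norm_num, (ncMoment_semicircle v 0).2] at this
      simpa using this
    rw [freeCompression, if_pos rfl, h0]
    refine ⟨isCompactProb_dirac_zero, fun n hn => ?_⟩
    rw [freeCumulant_dirac_zero hn, semicircleCumulant]
    split_ifs with h <;> simp [h]
  · have h := isFreeCompression_freeCompression (isCompactProb_semicircle hv) hc hc1
    exact ⟨h.isCompactProb, fun n hn => by rw [h.freeCumulant hc.ne' hn,
      freeCumulant_semicircle hv hn]⟩

/-- The law `μ_s ⊞ γ_{1 - s}`, where `γ` is the semicircle distribution of variance `v`; the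
parameter is `s = e^{-t/m}`. -/
noncomputable def interpolatedLaw (v : ℝ) (μ : Measure ℝ) (s : ℝ) : Measure ℝ :=
  freeConv (freeCompression μ s) (freeCompression (semicircle v) (1 - s))

section interpolatedLaw

variable {μ : Measure ℝ} {v s : ℝ}

theorem isCompactProb_interpolatedLaw (hμ : IsCompactProb μ) (hv : 0 < v) (hs : s ∈ Set.Ioc 0 1) :
    IsCompactProb (interpolatedLaw v μ s) :=
  (isFreeConv_freeConv (isFreeCompression_freeCompression hμ hs.1 hs.2).isCompactProb
    (freeCompression_semicircle hv (c := 1 - s) (by linarith [hs.2])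
      (by linarith [hs.1])).1).isCompactProb

theorem freeCumulant_interpolatedLaw (hμ : IsCompactProb μ) (hv : 0 < v) (hs : s ∈ Set.Ioc 0 1)
    {n : ℕ} (hn : 1 ≤ n) : freeCumulant (interpolatedLaw v μ s) n =
      s ^ (n - 1) * freeCumulant μ n + (1 - s) * semicircleCumulant v n := by
  have h1 := isFreeCompression_freeCompression hμ hs.1 hs.2
  have h2 := freeCompression_semicircle hv (c := 1 - s) (by linarith [hs.2]) (by linarith [hs.1])
  rw [interpolatedLaw, (isFreeConv_freeConv h1.isCompactProb h2.1).freeCumulant hn,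
    h1.freeCumulant hs.1.ne' hn, h2.2 n hn, semicircleCumulant]
  split_ifs with h
  · rw [h]; norm_num
  · simp

/-- The free cumulants of the laws `μ_s ⊞ γ_{1 - s}` grow geometrically, uniformly in `s`. -/
theorem exists_abs_freeCumulant_interpolatedLaw_le (hμ : IsCompactProb μ) (hv : 0 < v) :
    ∃ D : ℝ, 0 < D ∧ (∀ n, 1 ≤ n → |freeCumulant μ n| ≤ D ^ n) ∧ ∀ s ∈ Set.Ioc (0 : ℝ) 1, ∀ n,
      1 ≤ n → |freeCumulant (interpolatedLaw v μ s) n| ≤ D ^ n := by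
  obtain ⟨D, hD, h⟩ := hμ.exists_abs_freeCumulant_le
  have hle : ∀ n, D ^ n ≤ (D + v + 1) ^ n := fun n => by gcongr; linarith
  refine ⟨D + v + 1, by positivity, fun n hn => (h n hn).trans (hle n), fun s hs n hn => ?_⟩
  rw [freeCumulant_interpolatedLaw hμ hv hs hn]
  have h1 : |s ^ (n - 1) * freeCumulant μ n| ≤ D ^ n := by
    rw [abs_mul, abs_of_nonneg (pow_nonneg hs.1.le _)]
    exact (mul_le_of_le_one_left (abs_nonneg _) (pow_le_one₀ hs.1.le hs.2)).trans (h n hn)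
  refine (abs_add_le _ _).trans ?_
  by_cases hn2 : n = 2
  · subst hn2
    have h2 : |(1 - s) * semicircleCumulant v 2| ≤ v := by
      rw [semicircleCumulant, if_pos rfl, abs_of_nonneg (by nlinarith [hs.2])]
      nlinarith [hs.1]
    nlinarith
  · rw [semicircleCumulant, if_neg hn2, mul_zero, abs_zero, add_zero]
    exact h1.trans (hle n)

theorem summable_freeCumulant_mul_pow {ν : Measure ℝ} {D : ℝ} (hD : 0 < D)
    (h : ∀ n, 1 ≤ n → |freeCumulant ν n| ≤ D ^ n) {w : ℂ} (hw : ‖w‖ < D⁻¹) :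
    Summable fun k : ℕ => (freeCumulant ν (k + 1) : ℂ) * w ^ k := by
  have h1 : D * ‖w‖ < 1 := by
    rwa [mul_comm, ← lt_div_iff₀ hD, one_div]
  refine Summable.of_norm_bounded
    ((summable_geometric_of_lt_one (by positivity) h1).mul_left D) fun k => ?_
  rw [norm_mul, norm_pow, Complex.norm_real, Real.norm_eq_abs]
  calc |freeCumulant ν (k + 1)| * ‖w‖ ^ k ≤ D ^ (k + 1) * ‖w‖ ^ k := by
        gcongr; exact h _ (by omega)
    _ = D * (D * ‖w‖) ^ k := by rw [mul_pow]; ring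

theorem rTransform_interpolatedLaw (hμ : IsCompactProb μ) (hv : 0 < v) (hs : s ∈ Set.Ioc 0 1)
    {w : ℂ} (hw : Summable fun k : ℕ => (freeCumulant μ (k + 1) : ℂ) * (s * w) ^ k) :
    rTransform (interpolatedLaw v μ s) w =
      ((1 - s : ℝ) : ℂ) * (v : ℂ) * w + rTransform μ (s * w) := by
  have h1 : HasSum (fun k : ℕ => if k = 1 then ((1 - s : ℝ) : ℂ) * (v : ℂ) * w else 0)
      (((1 - s : ℝ) : ℂ) * (v : ℂ) * w) := hasSum_ite_eq 1 _
  rw [rTransform, rTransform]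
  refine ((h1.add hw.hasSum).congr_fun ?_).tsum_eq
  intro k
  rw [freeCumulant_interpolatedLaw hμ hv hs (by omega), semicircleCumulant, Nat.add_sub_cancel]
  by_cases hk : k = 1
  · subst hk
    simp
    ring
  · simp [hk]
    ring

end interpolatedLaw

/-! ### The Stieltjes transform on the upper half-plane -/

section halfPlane

variable {μ : Measure ℝ} {z : ℂ}

theorem im_le_norm_sub_ofReal (z : ℂ) (x : ℝ) : z.im ≤ ‖z - x‖ := by
  have h := Complex.abs_im_le_norm (z - x)
  rw [Complex.sub_im, Complex.ofReal_im, sub_zero] at h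
  exact (le_abs_self _).trans h

theorem sub_ofReal_ne_zero (hz : 0 < z.im) (x : ℝ) : z - x ≠ 0 :=
  norm_pos_iff.1 (hz.trans_le (im_le_norm_sub_ofReal z x))

theorem continuous_inv_sub_ofReal (hz : 0 < z.im) : Continuous fun x : ℝ => (z - x)⁻¹ :=
  (by fun_prop : Continuous fun x : ℝ => z - x).inv₀ (sub_ofReal_ne_zero hz)

theorem integrable_inv_sub_ofReal [IsFiniteMeasure μ] (hz : 0 < z.im) :
    Integrable (fun x : ℝ => (z - x)⁻¹) μ := by
  refine Integrable.of_bound (continuous_inv_sub_ofReal hz).aestronglyMeasurable z.im⁻¹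
    (Filter.Eventually.of_forall fun x => ?_)
  rw [norm_inv]
  exact inv_anti₀ hz (im_le_norm_sub_ofReal z x)

theorem differentiableAt_stieltjesTransform [IsFiniteMeasure μ] (hz : 0 < z.im) :
    DifferentiableAt ℂ (stieltjesTransform μ) z := by
  have hU : {w : ℂ | z.im / 2 < w.im} ∈ nhds z :=
    (isOpen_lt continuous_const Complex.continuous_im).mem_nhds (by
      simp only [Set.mem_ofPred_eq]; linarith)
  refine (hasDerivAt_integral_of_dominated_loc_of_deriv_le (μ := μ)
    (F := fun (w : ℂ) (x : ℝ) => (w - x)⁻¹) (F' := fun (w : ℂ) (x : ℝ) => -1 / (w - x) ^ 2)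
    (bound := fun _ => ((z.im / 2) ^ 2)⁻¹) hU ?_ (integrable_inv_sub_ofReal hz) ?_ ?_
    (integrable_const _) ?_).2.differentiableAt
  · filter_upwards [hU] with w hw
    have hw' : z.im / 2 < w.im := hw
    exact (continuous_inv_sub_ofReal (by linarith)).aestronglyMeasurable
  · refine Continuous.aestronglyMeasurable ?_
    refine Continuous.div (by fun_prop) (by fun_prop) fun x => ?_
    exact pow_ne_zero 2 (sub_ofReal_ne_zero hz x)
  · refine Filter.Eventually.of_forall fun x w hw => ?_
    have hw' : z.im / 2 < w.im := hw
    rw [norm_div, norm_neg, norm_one, norm_pow, one_div]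
    refine inv_anti₀ (by positivity) ?_
    gcongr
    exact hw'.le.trans (im_le_norm_sub_ofReal w x)
  · refine Filter.Eventually.of_forall fun x w hw => ?_
    have hw' : z.im / 2 < w.im := hw
    have hw0 : 0 < w.im := by linarith
    exact ((hasDerivAt_id w).sub_const (x : ℂ)).fun_inv (sub_ofReal_ne_zero hw0 x)

theorem IsCompactProb.im_stieltjesTransform_neg (hμ : IsCompactProb μ) (hz : 0 < z.im) :
    (stieltjesTransform μ z).im < 0 := by
  have := hμ.1
  obtain ⟨K, hK, hKμ⟩ := hμ.exists_bound
  have h1 : (stieltjesTransform μ z).im = ∫ x : ℝ, ((z - x)⁻¹).im ∂μ :=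
    (integral_im (𝕜 := ℂ) (integrable_inv_sub_ofReal hz)).symm
  have h2 : ∫ x : ℝ, ((z - x)⁻¹).im ∂μ ≤ ∫ _x : ℝ, -(z.im / (‖z‖ + K) ^ 2) ∂μ := by
    refine integral_mono_ae (integrable_inv_sub_ofReal hz).im (integrable_const _) ?_
    filter_upwards [hKμ K le_rfl] with x hx
    have h3 : ‖z - x‖ ≤ ‖z‖ + K := by
      refine (norm_sub_le _ _).trans ?_
      gcongr
      rw [Complex.norm_real]
      exact abs_le.2 hx
    have h4 : 0 < ‖z - x‖ := norm_pos_iff.2 (sub_ofReal_ne_zero hz x)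
    change ((z - x)⁻¹).im ≤ _
    rw [Complex.inv_im, Complex.normSq_eq_norm_sq, Complex.sub_im, Complex.ofReal_im, sub_zero,
      neg_div, neg_le_neg_iff]
    gcongr
  rw [integral_const, probReal_univ, one_smul] at h2
  rw [h1]
  refine h2.trans_lt (neg_lt_zero.2 ?_)
  have := norm_nonneg z
  positivity

theorem IsCompactProb.stieltjesTransform_ne_zero (hμ : IsCompactProb μ) (hz : 0 < z.im) :
    stieltjesTransform μ z ≠ 0 := fun h => by
  have := hμ.im_stieltjesTransform_neg hz
  rw [h] at this
  simp at this

end halfPlane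

/-! ### Supports and weak continuity in terms of free cumulants -/

theorem integral_pow_eq_ncMoment (μ : Measure ℝ) [IsProbabilityMeasure μ] (n : ℕ) :
    ∫ x, x ^ n ∂μ = ncMoment (freeCumulant μ) 0 n :=
  moment_eq_ncMoment (M := fun n => ∫ x, x ^ n ∂μ) (by simp) n

theorem IsCompactProb.integrable_of_continuous {μ : Measure ℝ} (hμ : IsCompactProb μ) {f : ℝ → ℝ}
    (hf : Continuous f) : Integrable f μ := by
  have := hμ.1
  obtain ⟨K, hK, hKμ⟩ := hμ.exists_bound
  obtain ⟨B, hB⟩ := isCompact_Icc.exists_bound_of_continuousOn (s := Set.Icc (-K) K) hf.continuousOn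
  refine Integrable.of_bound hf.aestronglyMeasurable B ?_
  filter_upwards [hKμ K le_rfl] with x hx using hB x hx

theorem catalan_le_four_pow (n : ℕ) : catalan n ≤ 4 ^ n := by
  refine le_trans ?_ (Nat.centralBinom_le_four_pow n)
  rw [← succ_mul_catalan_eq_centralBinom]
  exact Nat.le_mul_of_pos_left _ (Nat.succ_pos n)

/-- A geometric bound on the free cumulants bounds the support. -/
theorem ae_abs_le_of_abs_freeCumulant_le {μ : Measure ℝ} (hμ : IsCompactProb μ) {D : ℝ}
    (hD : 0 < D) (h : ∀ n, 1 ≤ n → |freeCumulant μ n| ≤ D ^ n) :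
    ∀ᵐ x ∂μ, x ∈ Set.Icc (-(8 * D)) (8 * D) := by
  have := hμ.1
  have hset : {x : ℝ | ¬ x ∈ Set.Icc (-(8 * D)) (8 * D)} ⊆ {x | 8 * D ≤ |x|} := by
    intro x hx
    rw [Set.mem_ofPred_eq, Set.mem_Icc, ← abs_le, not_le] at hx
    exact hx.le
  refine measure_mono_null hset ?_
  rw [← measureReal_eq_zero_iff]
  -- The moment of order `2 (k + 1)` is at most `(4 D) ^ (2 (k + 1))`; Markov's inequality.
  have hle : ∀ k : ℕ, μ.real {x : ℝ | 8 * D ≤ |x|} ≤ (1 / 4) ^ (k + 1) := by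
    intro k
    have h1 := mul_meas_ge_le_integral_of_nonneg (μ := μ) (f := fun x => x ^ (2 * (k + 1)))
      (Filter.Eventually.of_forall fun x => by simp only [pow_mul, Pi.zero_apply]; positivity)
      (hμ.integrable_of_continuous (by fun_prop)) ((8 * D) ^ (2 * (k + 1)))
    rw [integral_pow_eq_ncMoment] at h1
    have h2 := abs_ncMoment_le h (2 * (k + 1)) 0 (by omega)
    have h3 : (catalan (2 * (k + 1)) : ℝ) ≤ 4 ^ (2 * (k + 1)) := by
      exact_mod_cast catalan_le_four_pow _
    have h4 : {x : ℝ | 8 * D ≤ |x|} ⊆ {x | (8 * D) ^ (2 * (k + 1)) ≤ x ^ (2 * (k + 1))} := by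
      intro x hx
      have hx' : 8 * D ≤ |x| := hx
      rw [Set.mem_ofPred_eq, ← Even.pow_abs (even_two_mul (k + 1)) x]
      gcongr
    have h5 := measureReal_mono (μ := μ) h4
    have h6 : (8 * D) ^ (2 * (k + 1)) * μ.real {x : ℝ | 8 * D ≤ |x|} ≤
        D ^ (2 * (k + 1)) * 4 ^ (2 * (k + 1)) := by
      calc _ ≤ (8 * D) ^ (2 * (k + 1)) *
            μ.real {x | (8 * D) ^ (2 * (k + 1)) ≤ x ^ (2 * (k + 1))} := by
            gcongr
        _ ≤ _ := h1
        _ ≤ _ := le_abs_self _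
        _ ≤ D ^ (2 * (k + 1)) * catalan (2 * (k + 1)) := h2
        _ ≤ _ := by gcongr
    have h7 : (8 * D) ^ (2 * (k + 1)) * (1 / 4) ^ (k + 1) =
        D ^ (2 * (k + 1)) * 4 ^ (2 * (k + 1)) := by
      rw [pow_mul, pow_mul, pow_mul, ← mul_pow, ← mul_pow]
      congr 1
      ring
    rw [← h7] at h6
    exact le_of_mul_le_mul_left h6 (by positivity)
  have hlim : Filter.Tendsto (fun k : ℕ => (1 / 4 : ℝ) ^ (k + 1)) Filter.atTop (nhds 0) :=
    (tendsto_pow_atTop_nhds_zero_of_lt_one (by norm_num) (by norm_num)).comp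
      (Filter.tendsto_add_atTop_nat 1)
  exact le_antisymm (ge_of_tendsto' hlim hle) measureReal_nonneg

theorem continuousOn_ncMoment {X : Type*} [TopologicalSpace X] {S : Set X} {κ : X → ℕ → ℝ}
    (h : ∀ n, 1 ≤ n → ContinuousOn (fun s => κ s n) S) (n j : ℕ) :
    ContinuousOn (fun s => ncMoment (κ s) j n) S := by
  induction n using Nat.strong_induction_on generalizing j with
  | _ n ih =>
    cases n with
    | zero => simpa only [ncMoment_zero] using continuousOn_const
    | succ n =>
      simp only [ncMoment_succ]
      refine ((h _ (by omega)).mul (ih n (by omega) 0)).add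
        (continuousOn_finsetSum _ fun i hi => ?_)
      have hi' : i < n := by simpa using hi
      exact (ih i (by omega) 0).mul (ih (n - i) (by omega) (j + 1))

section weakContinuity

variable {X : Type*} [TopologicalSpace X] {S : Set X} {ν : X → Measure ℝ} {D : ℝ}

/-- Compactly supported laws whose free cumulants are continuous in a parameter and uniformly
geometrically bounded are weakly continuous: their moments are continuous and their supports lie
in a common interval, on which continuous functions are uniform limits of polynomials. -/
theorem continuousOn_integral_of_freeCumulant (hν : ∀ s ∈ S, IsCompactProb (ν s)) (hD : 0 < D)
    (hb : ∀ s ∈ S, ∀ n, 1 ≤ n → |freeCumulant (ν s) n| ≤ D ^ n)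
    (hc : ∀ n, 1 ≤ n → ContinuousOn (fun s => freeCumulant (ν s) n) S) {f : ℝ → ℝ}
    (hf : Continuous f) : ContinuousOn (fun s => ∫ x, f x ∂(ν s)) S := by
  have hpow : ∀ n : ℕ, ContinuousOn (fun s => ∫ x, x ^ n ∂(ν s)) S := fun n =>
    (continuousOn_ncMoment hc n 0).congr fun s hs => by
      have := (hν s hs).1
      exact integral_pow_eq_ncMoment (ν s) n
  have hpoly : ∀ p : Polynomial ℝ, ContinuousOn (fun s => ∫ x, p.eval x ∂(ν s)) S := by
    intro p
    have : ∀ s ∈ S, ∫ x, p.eval x ∂(ν s) =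
        ∑ i ∈ Finset.range (p.natDegree + 1), p.coeff i * ∫ x, x ^ i ∂(ν s) := by
      intro s hs
      simp only [Polynomial.eval_eq_sum_range]
      rw [integral_finsetSum _ fun i _ => (hν s hs).integrable_of_continuous (by fun_prop)]
      simp only [integral_const_mul]
    exact (continuousOn_finsetSum _ fun i _ => continuousOn_const.mul (hpow i)).congr this
  refine continuousOn_of_uniform_approx_of_continuousOn fun u hu => ?_
  obtain ⟨ε, hε, hεu⟩ := Metric.mem_uniformity_dist.1 hu
  obtain ⟨p, hp⟩ := exists_polynomial_near_of_continuousOn (-(8 * D)) (8 * D) f hf.continuousOn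
    (ε / 2) (half_pos hε)
  refine ⟨_, hpoly p, fun s hs => hεu ?_⟩
  have := (hν s hs).1
  rw [dist_eq_norm, ← integral_sub ((hν s hs).integrable_of_continuous hf)
    ((hν s hs).integrable_of_continuous p.continuous)]
  refine lt_of_le_of_lt (norm_integral_le_of_norm_le_const (C := ε / 2) ?_) ?_
  · filter_upwards [ae_abs_le_of_abs_freeCumulant_le (hν s hs) hD (hb s hs)] with x hx
    rw [norm_sub_rev]
    exact (hp x hx).le
  · rw [probReal_univ, mul_one]
    exact half_lt_self hε

theorem continuousOn_stieltjesTransform (hν : ∀ s ∈ S, IsCompactProb (ν s)) (hD : 0 < D)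
    (hb : ∀ s ∈ S, ∀ n, 1 ≤ n → |freeCumulant (ν s) n| ≤ D ^ n)
    (hc : ∀ n, 1 ≤ n → ContinuousOn (fun s => freeCumulant (ν s) n) S) {z : ℂ} (hz : 0 < z.im) :
    ContinuousOn (fun s => stieltjesTransform (ν s) z) S := by
  have hres := continuous_inv_sub_ofReal hz
  have h1 := continuousOn_integral_of_freeCumulant hν hD hb hc (Complex.continuous_re.comp hres)
  have h2 := continuousOn_integral_of_freeCumulant hν hD hb hc (Complex.continuous_im.comp hres)
  refine ((Complex.continuous_ofReal.comp_continuousOn h1).add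
    ((Complex.continuous_ofReal.comp_continuousOn h2).mul
      (continuousOn_const (c := Complex.I)))).congr fun s hs => ?_
  have := (hν s hs).1
  exact (integral_re_add_im (𝕜 := ℂ) (integrable_inv_sub_ofReal hz)).symm

end weakContinuity

/-! ### Subordination -/

section subordination

open Filter Topology

/-- The point `z + (s⁻¹ - 1) / w - (1 - s) v w` at which the Stieltjes transform of `μ` has to be
evaluated to obtain `s w`, for `w` the Stieltjes transform of `μ_s ⊞ γ_{1 - s}` at `z`. -/
noncomputable def subordination (v s : ℝ) (z w : ℂ) : ℂ :=
  z + ((s : ℂ)⁻¹ - 1) / w - (1 - s) * v * w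

variable {μ : Measure ℝ} {v s : ℝ} {z w : ℂ}

theorem im_le_im_subordination (hv : 0 < v) (hs : s ∈ Set.Ioc 0 1) (hw : w.im < 0) :
    z.im ≤ (subordination v s z w).im := by
  have h1 : (subordination v s z w).im =
      z.im + (s⁻¹ - 1) * (-w.im / Complex.normSq w) - (1 - s) * v * w.im := by
    have e1 : ((s : ℂ)⁻¹ - 1) / w = ((s⁻¹ - 1 : ℝ) : ℂ) * w⁻¹ := by push_cast; rfl
    have e2 : (1 - (s : ℂ)) * v * w = (((1 - s) * v : ℝ) : ℂ) * w := by push_cast; rfl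
    rw [subordination, e1, e2, Complex.sub_im, Complex.add_im, Complex.im_ofReal_mul,
      Complex.im_ofReal_mul, Complex.inv_im]
  have h2 : 0 ≤ s⁻¹ - 1 := sub_nonneg.2 ((one_le_inv₀ hs.1).2 hs.2)
  have h3 : 0 ≤ -w.im / Complex.normSq w := div_nonneg (by linarith) (Complex.normSq_nonneg w)
  have h4 : 0 ≤ (1 - s) * v := mul_nonneg (by linarith [hs.2]) hv.le
  rw [h1]
  nlinarith [mul_nonneg h2 h3, mul_nonneg h4 (by linarith : 0 ≤ -w.im)]

/-- The relation between the cumulant functions of `μ` and of `μ_s ⊞ γ_{1 - s}`. -/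
theorem eventually_cumulantFunction_interpolatedLaw (hμ : IsCompactProb μ) (hv : 0 < v)
    (hs : s ∈ Set.Ioc 0 1) {C C' : ℂ → ℂ} (hC : AnalyticAt ℂ C 0)
    (hCT : taylorSeries C = cumulantSeries (fun n => (freeCumulant μ n : ℂ)))
    (hC' : AnalyticAt ℂ C' 0) (hCT' : taylorSeries C' =
      cumulantSeries (fun n => (freeCumulant (interpolatedLaw v μ s) n : ℂ))) :
    ∀ᶠ w in 𝓝 0, C (s * w) = 1 - s + s * C' w - s * (1 - s) * v * w ^ 2 := by
  have hs0 : (s : ℂ) ≠ 0 := Complex.ofReal_ne_zero.2 hs.1.ne'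
  have ht : Tendsto (fun w : ℂ => (s : ℂ) * w) (𝓝 0) (𝓝 0) := by
    have : Continuous fun w : ℂ => (s : ℂ) * w := by fun_prop
    simpa using this.tendsto 0
  filter_upwards [ht.eventually (eventually_hasSum_taylorSeries hC),
    eventually_hasSum_taylorSeries hC'] with w h1 h2
  have h3 : HasSum (fun n : ℕ => (if n = 0 then 1 - (s : ℂ) else 0) -
      (if n = 2 then (s : ℂ) * (1 - s) * v * w ^ 2 else 0)) (1 - s - s * (1 - s) * v * w ^ 2) :=
    (hasSum_ite_eq 0 _).sub (hasSum_ite_eq 2 _)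
  have h4 := (h2.mul_left (s : ℂ)).add h3
  refine (h1.unique (h4.congr_fun fun n => ?_)).trans (by ring)
  rw [hCT, hCT', cumulantSeries, cumulantSeries, PowerSeries.coeff_mk, PowerSeries.coeff_mk]
  rcases Nat.eq_zero_or_pos n with rfl | hn
  · simp
  · rw [if_neg hn.ne', if_neg hn.ne', if_neg hn.ne', freeCumulant_interpolatedLaw hμ hv hs hn,
      semicircleCumulant, mul_pow]
    obtain ⟨k, rfl⟩ : ∃ k, n = k + 1 := ⟨n - 1, by omega⟩
    by_cases hk : k + 1 = 2
    · rw [if_pos hk, if_pos hk]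
      obtain rfl : k = 1 := by omega
      push_cast
      norm_num
      ring
    · rw [if_neg hk, if_neg hk, Nat.add_sub_cancel]
      push_cast
      ring

/-- The subordination equation near infinity, at the point `z = u⁻¹`. -/
theorem eventually_stieltjesTransform_subordination (hμ : IsCompactProb μ) (hv : 0 < v)
    (hs : s ∈ Set.Ioc 0 1) : ∀ᶠ u in 𝓝[≠] (0 : ℂ), stieltjesTransform μ (subordination v s u⁻¹
      (stieltjesTransform (interpolatedLaw v μ s) u⁻¹)) =
        s * stieltjesTransform (interpolatedLaw v μ s) u⁻¹ := by
  obtain ⟨C, hC, hCT, hK, -, -⟩ := exists_cumulantFunction hμ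
  obtain ⟨C', hC', hCT', -, hK', hG⟩ :=
    exists_cumulantFunction (isCompactProb_interpolatedLaw hμ hv hs)
  have hs0 : (s : ℂ) ≠ 0 := Complex.ofReal_ne_zero.2 hs.1.ne'
  have hmul : Tendsto (fun w : ℂ => (s : ℂ) * w) (𝓝[≠] 0) (𝓝[≠] 0) := by
    refine tendsto_nhdsWithin_iff.2 ⟨?_, ?_⟩
    · have : Continuous fun w : ℂ => (s : ℂ) * w := by fun_prop
      have h0 := this.tendsto 0
      rw [mul_zero] at h0
      exact h0.mono_left nhdsWithin_le_nhds
    · filter_upwards [self_mem_nhdsWithin] with w hw using mul_ne_zero hs0 hw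
  filter_upwards [hK', hG.eventually (hmul.eventually hK), hG.eventually self_mem_nhdsWithin,
    hG.eventually (nhdsWithin_le_nhds
      (eventually_cumulantFunction_interpolatedLaw hμ hv hs hC hCT hC' hCT'))] with u h1 h2 h3 h4
  set g := stieltjesTransform (interpolatedLaw v μ s) u⁻¹ with hg
  have hg0 : g ≠ 0 := h3
  rw [← h2, h4, h1, subordination]
  congr 1
  field_simp
  ring

theorem differentiableOn_stieltjesTransform [IsFiniteMeasure μ] :
    DifferentiableOn ℂ (stieltjesTransform μ) {z | 0 < z.im} := fun _ hz =>
  (differentiableAt_stieltjesTransform hz).differentiableWithinAt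

/-- The Stieltjes transform of `μ_s ⊞ γ_{1 - s}` is determined by that of `μ` through an equation
valid on the upper half-plane: it holds near infinity by the addition of the cumulants, and
everywhere by the identity theorem. -/
theorem stieltjesTransform_subordination (hμ : IsCompactProb μ) (hv : 0 < v)
    (hs : s ∈ Set.Ioc 0 1) (hz : 0 < z.im) : stieltjesTransform μ (subordination v s z
      (stieltjesTransform (interpolatedLaw v μ s) z)) =
        s * stieltjesTransform (interpolatedLaw v μ s) z := by
  have hν := isCompactProb_interpolatedLaw hμ hv hs
  have := hμ.1
  have := hν.1
  set G := stieltjesTransform (interpolatedLaw v μ s) with hG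
  have hopen : IsOpen {z : ℂ | 0 < z.im} := isOpen_lt continuous_const Complex.continuous_im
  have hdG : DifferentiableOn ℂ G {z | 0 < z.im} := differentiableOn_stieltjesTransform
  have hsub : DifferentiableOn ℂ (fun z => subordination v s z (G z)) {z | 0 < z.im} := by
    refine (differentiableOn_id.add ((differentiableOn_const _).div hdG fun z hz =>
      hν.stieltjesTransform_ne_zero hz)).sub ((differentiableOn_const _).mul hdG)
  have h1 : AnalyticOnNhd ℂ (fun z => stieltjesTransform μ (subordination v s z (G z)))
      {z | 0 < z.im} := by
    refine DifferentiableOn.analyticOnNhd ?_ hopen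
    refine differentiableOn_stieltjesTransform.comp hsub fun z hz => ?_
    exact lt_of_lt_of_le hz (im_le_im_subordination hv hs (hν.im_stieltjesTransform_neg hz))
  have h2 : AnalyticOnNhd ℂ (fun z => s * G z) {z | 0 < z.im} :=
    ((differentiableOn_const _).mul hdG).analyticOnNhd hopen
  obtain ⟨ε, hε, hball⟩ := Metric.eventually_nhds_iff.1 (eventually_nhdsWithin_iff.1
    (eventually_stieltjesTransform_subordination hμ hv hs))
  -- A point of the upper half-plane close enough to infinity.
  set z₀ : ℂ := ((2 / ε : ℝ) : ℂ) * Complex.I with hz₀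
  have hz₀im : 0 < z₀.im := by simp [hz₀]; positivity
  have hz₀0 : z₀ ≠ 0 := fun h => by rw [h] at hz₀im; simp at hz₀im
  have hz₀inv : ‖z₀⁻¹‖ < ε := by
    rw [norm_inv, hz₀, norm_mul, Complex.norm_I, mul_one, Complex.norm_real,
      Real.norm_of_nonneg (by positivity), inv_div]
    linarith
  refine AnalyticOnNhd.eqOn_of_preconnected_of_eventuallyEq h1 h2
    (convex_halfSpace_im_gt 0).isPreconnected (z₀ := z₀) hz₀im ?_ hz
  have hcont : ContinuousAt (fun z : ℂ => ‖z⁻¹‖) z₀ := (continuousAt_inv₀ hz₀0).norm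
  filter_upwards [hcont.eventually (Iio_mem_nhds hz₀inv), isOpen_ne.mem_nhds hz₀0] with ξ h3 h4
  have h5 := hball (y := ξ⁻¹) (by rwa [dist_zero_right]) (inv_ne_zero h4)
  rwa [inv_inv] at h5

end subordination

/-! ### The partial differential equation -/

section pde

open Filter Topology

/-- A derivative from a factorization of the increments. -/
theorem hasDerivWithinAt_of_mul_sub_eq {g A B : ℝ → ℂ} {S : Set ℝ} {s₀ : ℝ} {a b : ℂ}
    (hA : Tendsto A (𝓝[S] s₀) (𝓝 a)) (ha : a ≠ 0) (hB : Tendsto B (𝓝[S] s₀) (𝓝 b))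
    (h : ∀ s ∈ S, A s * (g s - g s₀) = ((s - s₀ : ℝ) : ℂ) * B s) :
    HasDerivWithinAt g (b / a) S s₀ := by
  rw [hasDerivWithinAt_iff_tendsto_slope]
  have hle : 𝓝[S \ {s₀}] s₀ ≤ 𝓝[S] s₀ := nhdsWithin_mono _ Set.sdiff_subset
  refine ((hB.div hA ha).mono_left hle).congr' ?_
  filter_upwards [self_mem_nhdsWithin, hle (hA.eventually_ne ha)] with s hs hAs
  have hne : ((s - s₀ : ℝ) : ℂ) ≠ 0 := Complex.ofReal_ne_zero.2 (sub_ne_zero.2 hs.2)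
  rw [slope_def_module, Complex.real_smul, Complex.ofReal_inv, Pi.div_apply, div_eq_iff hAs,
    mul_assoc, eq_inv_mul_iff_mul_eq₀ hne, ← h s hs.1, mul_comm]

variable {μ : Measure ℝ} {v s : ℝ} {z : ℂ}

/-- The derivative in `w` of `s w - G_μ (subordination v s z w)`, where `d` is the derivative of
`G_μ` at the point `subordination v s z w`. -/
noncomputable def subordinationJacobian (v s : ℝ) (d w : ℂ) : ℂ :=
  s + d * (((s : ℂ)⁻¹ - 1) / w ^ 2 + (1 - s) * v)

/-- The subordination equation, differentiated in `z`. -/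
theorem deriv_mul_subordinationJacobian (hμ : IsCompactProb μ) (hv : 0 < v)
    (hs : s ∈ Set.Ioc 0 1) (hz : 0 < z.im) :
    deriv (stieltjesTransform (interpolatedLaw v μ s)) z * subordinationJacobian v s
      (deriv (stieltjesTransform μ) (subordination v s z
        (stieltjesTransform (interpolatedLaw v μ s) z)))
      (stieltjesTransform (interpolatedLaw v μ s) z) =
    deriv (stieltjesTransform μ) (subordination v s z
      (stieltjesTransform (interpolatedLaw v μ s) z)) := by
  have hν := isCompactProb_interpolatedLaw hμ hv hs
  have := hμ.1
  have := hν.1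
  set G := stieltjesTransform (interpolatedLaw v μ s) with hG
  have hg0 : G z ≠ 0 := hν.stieltjesTransform_ne_zero hz
  have hω : 0 < (subordination v s z (G z)).im :=
    hz.trans_le (im_le_im_subordination hv hs (hν.im_stieltjesTransform_neg hz))
  have h1 := (differentiableAt_stieltjesTransform (μ := interpolatedLaw v μ s) hz).hasDerivAt
  have h2 := (differentiableAt_stieltjesTransform (μ := μ) hω).hasDerivAt
  rw [← hG] at h1
  set d := deriv (stieltjesTransform μ) (subordination v s z (G z)) with hd
  have h3 : HasDerivAt (fun ξ => subordination v s ξ (G ξ))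
      (1 + ((s : ℂ)⁻¹ - 1) * (-deriv G z / G z ^ 2) - (1 - s) * v * deriv G z) z :=
    ((hasDerivAt_id z).add ((h1.fun_inv hg0).const_mul ((s : ℂ)⁻¹ - 1))).sub
      (h1.const_mul ((1 - (s : ℂ)) * v))
  have h4 := h2.comp z h3
  have h5 : (stieltjesTransform μ ∘ fun ξ => subordination v s ξ (G ξ)) =ᶠ[𝓝 z]
      fun ξ => s * G ξ := by
    filter_upwards [(isOpen_lt continuous_const Complex.continuous_im).mem_nhds hz] with ξ hξ
    exact stieltjesTransform_subordination hμ hv hs hξ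
  have h6 := (h4.congr_of_eventuallyEq h5.symm).unique (h1.const_mul (s : ℂ))
  rw [subordinationJacobian]
  linear_combination -h6

/-- If the Jacobian vanished, then so would the derivative of `G_μ`, by the equation differentiated
in `z`, and the Jacobian would be `s`. -/
theorem subordinationJacobian_ne_zero (hμ : IsCompactProb μ) (hv : 0 < v)
    (hs : s ∈ Set.Ioc 0 1) (hz : 0 < z.im) : subordinationJacobian v s
      (deriv (stieltjesTransform μ) (subordination v s z
        (stieltjesTransform (interpolatedLaw v μ s) z)))
      (stieltjesTransform (interpolatedLaw v μ s) z) ≠ 0 := by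
  intro h
  have h1 := deriv_mul_subordinationJacobian hμ hv hs hz
  rw [h, mul_zero] at h1
  rw [← h1, subordinationJacobian, zero_mul, add_zero] at h
  exact hs.1.ne' (Complex.ofReal_eq_zero.1 h)

theorem continuousOn_stieltjesTransform_interpolatedLaw (hμ : IsCompactProb μ) (hv : 0 < v)
    (hz : 0 < z.im) :
    ContinuousOn (fun s => stieltjesTransform (interpolatedLaw v μ s) z) (Set.Ioc 0 1) := by
  obtain ⟨D, hD, -, h⟩ := exists_abs_freeCumulant_interpolatedLaw_le hμ hv
  refine continuousOn_stieltjesTransform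
    (fun s hs => isCompactProb_interpolatedLaw hμ hv hs) hD h (fun n hn => ?_) hz
  refine ContinuousOn.congr (f := fun s : ℝ => s ^ (n - 1) * freeCumulant μ n +
    (1 - s) * semicircleCumulant v n) (by fun_prop) fun s hs => ?_
  exact freeCumulant_interpolatedLaw hμ hv hs hn

/-- Implicit differentiation of the subordination equation in the parameter. -/
theorem hasDerivWithinAt_stieltjesTransform_interpolatedLaw (hμ : IsCompactProb μ) (hv : 0 < v)
    (hs : s ∈ Set.Ioc 0 1) (hz : 0 < z.im) :
    HasDerivWithinAt (fun s => stieltjesTransform (interpolatedLaw v μ s) z)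
      ((-stieltjesTransform (interpolatedLaw v μ s) z +
        deriv (stieltjesTransform μ) (subordination v s z
          (stieltjesTransform (interpolatedLaw v μ s) z)) *
        (v * stieltjesTransform (interpolatedLaw v μ s) z -
          1 / (s * s * stieltjesTransform (interpolatedLaw v μ s) z))) /
      subordinationJacobian v s
        (deriv (stieltjesTransform μ) (subordination v s z
          (stieltjesTransform (interpolatedLaw v μ s) z)))
        (stieltjesTransform (interpolatedLaw v μ s) z)) (Set.Ioc 0 1) s := by
  have := hμ.1
  have hJ := subordinationJacobian_ne_zero hμ hv hs hz
  have hG := continuousOn_stieltjesTransform_interpolatedLaw hμ hv hz s hs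
  have hne : ∀ r ∈ Set.Ioc (0 : ℝ) 1, stieltjesTransform (interpolatedLaw v μ r) z ≠ 0 :=
    fun r hr => (isCompactProb_interpolatedLaw hμ hv hr).stieltjesTransform_ne_zero hz
  have hω : 0 < (subordination v s z (stieltjesTransform (interpolatedLaw v μ s) z)).im :=
    hz.trans_le (im_le_im_subordination hv hs
      ((isCompactProb_interpolatedLaw hμ hv hs).im_stieltjesTransform_neg hz))
  have heq : ∀ r ∈ Set.Ioc (0 : ℝ) 1, stieltjesTransform μ (subordination v r z
      (stieltjesTransform (interpolatedLaw v μ r) z)) =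
        r * stieltjesTransform (interpolatedLaw v μ r) z :=
    fun r hr => stieltjesTransform_subordination hμ hv hr hz
  set g : ℝ → ℂ := fun r => stieltjesTransform (interpolatedLaw v μ r) z with hgdef
  have hd := (continuousAt_dslope_same (f := stieltjesTransform μ)).2
    (differentiableAt_stieltjesTransform hω)
  change HasDerivWithinAt g ((-g s + deriv (stieltjesTransform μ) (subordination v s z (g s)) *
    (v * g s - 1 / (s * s * g s))) / subordinationJacobian v s
      (deriv (stieltjesTransform μ) (subordination v s z (g s))) (g s)) (Set.Ioc 0 1) s
  have hne' : ∀ r ∈ Set.Ioc (0 : ℝ) 1, g r ≠ 0 := hne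
  have heq' : ∀ r ∈ Set.Ioc (0 : ℝ) 1, stieltjesTransform μ (subordination v r z (g r)) =
    r * g r := heq
  have hscalar : ∀ r ∈ Set.Ioc (0 : ℝ) 1, (r : ℂ) ≠ 0 := fun r hr =>
    Complex.ofReal_ne_zero.2 hr.1.ne'
  have hr : ContinuousWithinAt (fun r : ℝ => (r : ℂ)) (Set.Ioc 0 1) s := by fun_prop
  have hsub : Tendsto (fun r => subordination v r z (g r)) (𝓝[Set.Ioc 0 1] s)
      (𝓝 (subordination v s z (g s))) :=
    (tendsto_const_nhds.add ((((hr.inv₀ (hscalar s hs)).sub continuousWithinAt_const).div hG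
      (hne s hs)))).sub (((continuousWithinAt_const.sub hr).mul continuousWithinAt_const).mul hG)
  have hq : Tendsto (fun r => dslope (stieltjesTransform μ) (subordination v s z (g s))
      (subordination v r z (g r))) (𝓝[Set.Ioc 0 1] s)
      (𝓝 (deriv (stieltjesTransform μ) (subordination v s z (g s)))) := by
    rw [← dslope_same]
    exact hd.tendsto.comp hsub
  -- The difference quotient of `G_μ` between the two subordination points is continuous, as a
  -- `dslope`; collecting the increments of `g` and of the parameter gives the factorization.
  refine hasDerivWithinAt_of_mul_sub_eq
    (A := fun r => s + dslope (stieltjesTransform μ) (subordination v s z (g s))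
      (subordination v r z (g r)) * (((s : ℂ)⁻¹ - 1) / (g r * g s) + (1 - s) * v))
    (B := fun r => -g r + dslope (stieltjesTransform μ) (subordination v s z (g s))
      (subordination v r z (g r)) * (v * g r - 1 / (r * s * g r))) ?_ hJ ?_ ?_
  · rw [subordinationJacobian, sq]
    exact tendsto_const_nhds.add (hq.mul ((tendsto_const_nhds.div (hG.mul continuousWithinAt_const)
      (mul_ne_zero (hne s hs) (hne s hs))).add tendsto_const_nhds))
  · exact (hG.tendsto.neg).add (hq.mul ((tendsto_const_nhds.mul hG).sub (tendsto_const_nhds.div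
      ((hr.mul continuousWithinAt_const).mul hG)
      (mul_ne_zero (mul_ne_zero (hscalar s hs) (hscalar s hs)) (hne s hs)))))
  · intro r hr
    have h1 := sub_smul_dslope (stieltjesTransform μ) (subordination v s z (g s))
      (subordination v r z (g r))
    rw [smul_eq_mul, heq' r hr, heq' s hs] at h1
    have h2 : subordination v r z (g r) - subordination v s z (g s) =
        ((r : ℂ) - s) * (v * g r - 1 / (r * s * g r)) -
          (g r - g s) * (((s : ℂ)⁻¹ - 1) / (g r * g s) + (1 - s) * v) := by
      have := hne' r hr
      have := hne' s hs
      have := hscalar r hr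
      have := hscalar s hs
      rw [subordination, subordination]
      field_simp
      ring
    rw [h2] at h1
    push_cast
    linear_combination -h1

end pde

/-! ### The evolved law -/

section evolution

variable {μ : Measure ℝ} {m v t : ℝ}

theorem exp_neg_div_mem_Ioc (hm : 0 < m) (ht : 0 ≤ t) : Real.exp (-t / m) ∈ Set.Ioc (0 : ℝ) 1 :=
  ⟨Real.exp_pos _, Real.exp_le_one_iff.2 (div_nonpos_of_nonpos_of_nonneg (by linarith) hm.le)⟩

theorem plancherelWeight_pos {T V : Type*} [Group T] [Fintype T] [AddCommGroup V] [Module ℂ V]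
    [FiniteDimensional ℂ V] (ζ : Representation ℂ T V) (hζ : ζ.IsIrreducible) :
    0 < plancherelWeight ζ := by
  have hV : Nontrivial V := by
    have := (Representation.irreducible_iff_isSimpleModule_asModule ζ).1 hζ
    exact IsSimpleModule.nontrivial (MonoidAlgebra ℂ T) ζ.asModule
  have h1 : 0 < Module.finrank ℂ V := Module.finrank_pos
  have h2 : 0 < Nat.card T := Nat.card_pos
  rw [plancherelWeight]
  positivity

theorem freeCumulant_evolvedLaw_eq_evolvedCumulant (hμ : IsCompactProb μ) (hv : 0 < v)
    (hm : 0 < m) (ht : 0 ≤ t) {R : ℕ → ℂ} (hR1 : R 1 = 0)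
    (hR : ∀ j : ℕ, 1 ≤ j → (freeCumulant μ j : ℂ) = R j) {j : ℕ} (hj : 1 ≤ j) :
    (freeCumulant (evolvedLaw m v μ t) j : ℂ) =
      evolvedCumulant (fun k => Real.exp (-(k : ℝ) * t / m)) v R j := by
  have hs := exp_neg_div_mem_Ioc hm ht
  have hexp : ∀ k : ℕ, Real.exp (-(k : ℝ) * t / m) = Real.exp (-t / m) ^ k := fun k => by
    rw [← Real.exp_nat_mul]
    congr 1
    ring
  rw [show evolvedLaw m v μ t = interpolatedLaw v μ (Real.exp (-t / m)) from rfl,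
    freeCumulant_interpolatedLaw hμ hv hs hj, semicircleCumulant]
  push_cast [hR j hj]
  match j, hj with
  | 1, _ => simp [evolvedCumulant, hR1]
  | 2, _ =>
    simp only [evolvedCumulant, hexp]
    norm_num
    ring
  | k + 3, _ =>
    simp only [evolvedCumulant, hexp]
    simp

theorem hasDerivWithinAt_exp_neg_div (m t : ℝ) :
    HasDerivWithinAt (fun t => Real.exp (-t / m)) (Real.exp (-t / m) * (-1 / m)) (Set.Ici 0) t :=
  (((hasDerivAt_id t).neg.div_const m).exp).hasDerivWithinAt

end evolution

theorem corollary4p3 {T V : Type*} [Group T] [Fintype T]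
    [AddCommGroup V] [Module ℂ V] [FiniteDimensional ℂ V]
    (ζ : Representation ℂ T V) (hζ : ζ.IsIrreducible)
    (γ : ℕ → ConjClasses T → ℂ)
    (m : ℝ) (hm : 0 < m)
    (μ : Measure ℝ) (hμ : IsCompactProb μ)
    (hR : ∀ j : ℕ, 1 ≤ j → (freeCumulant μ j : ℂ) = initialCumulant ζ γ j) :
    -- the evolved cumulants are the free cumulants of the probability `𝔪(t)`
    (∀ t : ℝ, 0 ≤ t →
      IsCompactProb (evolvedLaw m (plancherelWeight ζ) μ t) ∧
      ∀ j : ℕ, 1 ≤ j →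
        (freeCumulant (evolvedLaw m (plancherelWeight ζ) μ t) j : ℂ) =
          evolvedCumulant (fun k => Real.exp (-(k : ℝ) * t / m)) (plancherelWeight ζ)
            (initialCumulant ζ γ) j) ∧
    -- the `R`-transform, with both defining series convergent on a common disc
    (∃ r : ℝ, 0 < r ∧ ∀ t : ℝ, 0 ≤ t → ∀ w : ℂ, ‖w‖ < r →
      Summable (fun k : ℕ =>
        (freeCumulant (evolvedLaw m (plancherelWeight ζ) μ t) (k + 1) : ℂ) * w ^ k) ∧
      Summable (fun k : ℕ =>
        (freeCumulant μ (k + 1) : ℂ) * ((Real.exp (-t / m) : ℂ) * w) ^ k) ∧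
      rTransform (evolvedLaw m (plancherelWeight ζ) μ t) w =
        ((1 - Real.exp (-t / m) : ℝ) : ℂ) * (plancherelWeight ζ : ℂ) * w +
          rTransform μ ((Real.exp (-t / m) : ℂ) * w)) ∧
    -- the partial differential equation (the time derivative is one-sided at `t = 0`)
    (∀ t : ℝ, 0 ≤ t → ∀ z : ℂ, 0 < z.im →
      stieltjesTransform (evolvedLaw m (plancherelWeight ζ) μ t) z ≠ 0 ∧
      ∃ Gt Gz : ℂ,
        HasDerivWithinAt
          (fun s : ℝ => stieltjesTransform (evolvedLaw m (plancherelWeight ζ) μ s) z)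
          Gt (Set.Ici 0) t ∧
        HasDerivAt
          (fun ξ : ℂ => stieltjesTransform (evolvedLaw m (plancherelWeight ζ) μ t) ξ) Gz z ∧
        Gt = (1 / ((m : ℂ) * stieltjesTransform (evolvedLaw m (plancherelWeight ζ) μ t) z) -
              (plancherelWeight ζ : ℂ) *
                (stieltjesTransform (evolvedLaw m (plancherelWeight ζ) μ t) z / (m : ℂ))) * Gz +
            stieltjesTransform (evolvedLaw m (plancherelWeight ζ) μ t) z / (m : ℂ)) := by
  have hv := plancherelWeight_pos ζ hζ
  set v := plancherelWeight ζ
  refine ⟨fun t ht => ⟨isCompactProb_interpolatedLaw hμ hv (exp_neg_div_mem_Ioc hm ht),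
    fun j hj => freeCumulant_evolvedLaw_eq_evolvedCumulant hμ hv hm ht rfl hR hj⟩, ?_, ?_⟩
  · obtain ⟨D, hD, hDμ, hDs⟩ := exists_abs_freeCumulant_interpolatedLaw_le hμ hv
    refine ⟨D⁻¹, inv_pos.2 hD, fun t ht w hw => ?_⟩
    have hs := exp_neg_div_mem_Ioc hm ht
    have hw' : ‖(Real.exp (-t / m) : ℂ) * w‖ < D⁻¹ := by
      rw [norm_mul, Complex.norm_real, Real.norm_of_nonneg hs.1.le]
      exact (mul_le_of_le_one_left (norm_nonneg w) hs.2).trans_lt hw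
    have hsum := summable_freeCumulant_mul_pow hD hDμ hw'
    exact ⟨summable_freeCumulant_mul_pow hD (hDs _ hs) hw, hsum,
      rTransform_interpolatedLaw hμ hv hs hsum⟩
  · intro t ht z hz
    have hs := exp_neg_div_mem_Ioc hm ht
    have hν := isCompactProb_interpolatedLaw hμ hv hs
    have := hν.1
    have hg := hν.stieltjesTransform_ne_zero hz
    have hs0 : (Real.exp (-t / m) : ℂ) ≠ 0 := Complex.ofReal_ne_zero.2 hs.1.ne'
    have hm0 : (m : ℂ) ≠ 0 := Complex.ofReal_ne_zero.2 hm.ne'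
    have h1 := HasDerivWithinAt.scomp t
      (hasDerivWithinAt_stieltjesTransform_interpolatedLaw hμ hv hs hz)
      (hasDerivWithinAt_exp_neg_div m t) fun r hr => exp_neg_div_mem_Ioc hm hr
    -- With `J` the Jacobian and `d` the derivative of `G_μ` at the subordination point, the
    -- derivative in `z` is `d / J`, and the equation is an identity of rational functions.
    have h2 := deriv_mul_subordinationJacobian hμ hv hs hz
    have h3 := subordinationJacobian_ne_zero hμ hv hs hz
    refine ⟨hg, _, _, h1,
      (differentiableAt_stieltjesTransform (μ := interpolatedLaw v μ (Real.exp (-t / m)))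
        hz).hasDerivAt, ?_⟩
    change _ = (1 / ((m : ℂ) * stieltjesTransform (interpolatedLaw v μ (Real.exp (-t / m))) z) -
      (v : ℂ) * (stieltjesTransform (interpolatedLaw v μ (Real.exp (-t / m))) z / (m : ℂ))) *
        deriv (stieltjesTransform (interpolatedLaw v μ (Real.exp (-t / m)))) z +
      stieltjesTransform (interpolatedLaw v μ (Real.exp (-t / m))) z / (m : ℂ)
    rw [eq_div_of_mul_eq h3 h2, Complex.real_smul, Complex.ofReal_mul]
    generalize deriv (stieltjesTransform μ) _ = d at h3 ⊢
    generalize stieltjesTransform (interpolatedLaw v μ (Real.exp (-t / m))) z = g at hg h3 ⊢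
    generalize hJ : subordinationJacobian v (Real.exp (-t / m)) d g = J at h3 ⊢
    rw [subordinationJacobian] at hJ
    generalize ((Real.exp (-t / m) : ℝ) : ℂ) = s at hs0 hJ ⊢
    have hJ' : J * s * g ^ 2 = s ^ 2 * g ^ 2 + d * ((1 - s) + (1 - s) * v * s * g ^ 2) := by
      rw [← hJ]
      field_simp
    push_cast
    field_simp
    linear_combination -hJ'
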